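/- **Sequential CHSH games.** In each of $n$ games Alice and Bob get independent uniform questions $a,b\in\{0,1\}$ and answer $x,y\in\{0,1\}$. Alice's transcript of the first $j$ games is $h^A_j=(a_1,\dots,a_j,x_1,\dots,x_j)$, similarly $h^B_j$ for Bob, and $h_j=(h^A_j,h^B_j)$. A strategy $\mathcal S$ consists of finite-dimensional complex Hilbert spaces $\mathcal H_A,\mathcal H_B$, a Hilbert space $\mathcal H_C$, a unit vector $|\psi\rangle\in\mathcal H_A\otimes\mathcal H_B\otimes\mathcal H_C$, and, for each prover $D\in\{A,B\}$, game $j$, question $\alpha$ and local transcript $h^D_{j-1}$, a reflection (self-adjoint unitary) $R^D_{j,\alpha}(h^D_{j-1})$ of $\mathcal H_D$. Let $P^A_j(h^A_j)=\frac12\big(1+(-1)^{x_j}R^A_{j,a_j}(h^A_{j-1})\big)$, $P^A_{1,j}(h^A_j)=P^A_j(h^A_j)\cdots P^A_1(h^A_1)$, and similarly for Bob. The state $|\psi(h_{j})\rangle$ after the transcript $h_{j}$ is $P^A_{1,j}(h^A_j)\otimes P^B_{1,j}(h^B_j)|\psi\rangle$, normalized (it is $0$ if this vector is $0$). Given $h_{j-1}$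 and questions $a_j,b_j$, the answers $x_j,y_j$ have probability $\|P^A_j(h^A_j)\otimes P^B_j(h^B_j)|\psi(h_{j-1})\rangle\|^2$. Let $H_j$ be the resulting random transcript of the first $j$ games. Game $(j,h_{j-1})$ is *$\epsilon$-structured* if its correlation value $\sum_{a,b}(-1)^{ab}\,\mathbb E[(-1)^{X_j+Y_j}\mid H_{j-1}=h_{j-1},A_j=a,B_j=b]$, computed from these answer probabilities, is at least $2\sqrt2-\epsilon$. The strategy $\mathcal S$ is *$(\delta,\epsilon)$-structured* ($\delta,\epsilon\ge0$) if for every $j\in\{1,\dots,n\}$, $\Pr[\text{game }(j,H_{j-1})\text{ is }\epsilon\text{-structured}]\ge1-\delta$. **Multi-qubit ideal strategies.** In $\mathbb C^2$ let $|(0,x)_A\rangle=|x\rangle$, $|(1,x)_A\rangle=\frac1{\sqrt2}(|0\rangle+(-1)^x|1\rangle)$, $|(b,0)_B\rangle=\cos\frac\pi8|0\rangle+(-1)^b\sin\frac\pi8|1\rangle$, $|(b,1)_B\rangle=\sin\frac\pi8|0\rangle-(-1)^b\cos\frac\pi8|1\rangle$, and $R^D_\alpha=|(\alpha,0)_D\rangle\langle(\alpha,0)_D|-|(\alpha,1)_D\rangle\langle(\alpha,1)_D|$.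 The strategy $\mathcal S$ is a *multi-qubit ideal strategy* if for each $D\in\{A,B\}$ there are a Hilbert space $\mathcal H_D'$, a unitary $\mathcal Y^D:\mathcal H_D\to(\mathbb C^2)^{\otimes n}\otimes\mathcal H_D'$ and unitaries $U^D_j(h^D_{j-1})$ of $(\mathbb C^2)^{\otimes(n-j+1)}\otimes\mathcal H_D'$ such that, with $$M^D_j(h^D_{j-1})=\big(1_{(\mathbb C^2)^{\otimes(j-1)}}\otimes U^D_j(h^D_{j-1})\big)\cdots\big(1_{\mathbb C^2}\otimes U^D_2(h^D_1)\big)\,U^D_1\,\mathcal Y^D,$$ one always has $R^D_{j,\alpha}(h^D_{j-1})=M^D_j(h^D_{j-1})^\dagger\,(R^D_\alpha)_j\,M^D_j(h^D_{j-1})$, where $(R)_j$ denotes $R$ acting on the $j$-th qubit. For such a strategy and $a,a',\Delta\in\{0,1\}$ let $$V^D_j(h^D_{j-1},a,a',\Delta)=M^D_j(h^D_{j-1})^\dagger\Big(\sum_{x\in\{0,1\}}|(a',x\oplus\Delta)_A\rangle\langle(a,x)_A|\Big)_jM^D_j(h^D_{j-1})$$ (Alice's bases are used for both provers). **Alice's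 post-measurement states.** Let $\rho(h^A_j)=|\psi(h^A_j)\rangle\langle\psi(h^A_j)|$, where $|\psi(h^A_j)\rangle$ is the normalization of $P^A_{1,j}(h^A_j)|\psi\rangle$ (again $0$ if this vector is $0$). For $j\le k\le n$ let $$\mathcal E^{A|h^A_j}_{j+1,k}(\rho)=\frac1{2^{k-j}}\sum_{a_{j+1},x_{j+1},\dots,a_k,x_k}|h^A_{j+1,k}\rangle\langle h^A_{j+1,k}|\otimes P\rho P^\dagger,\qquad P=P^A_k(h^A_k)\cdots P^A_{j+1}(h^A_{j+1}),$$ be the effect of Alice playing games $j+1,\dots,k$ after the transcript $h^A_j$; here $h^A_{j+1,k}=(a_{j+1},\dots,a_k,x_{j+1},\dots,x_k)$ is recorded in a separate register (for $k=j$ this is the identity map). **Theorem.** There is a universal constant $\kappa>0$ such that, with $p=p(n,\delta,\epsilon)=\kappa n^{\kappa}(\delta+\epsilon)^{1/\kappa}$, the following holds for every $(\delta,\epsilon)$-structured multi-qubit ideal strategy $\mathcal S$ for $n$ sequential CHSH games and all $1\le j\le k\le n$. With probability at least $1-p$, the transcript $H_j$ lies in the set of those $h_j$ that satisfy, for all $a_j',x_j'\in\{0,1\}$,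 $$\Big\|\mathcal E^{A|h^A_j}_{j+1,k}\big(\rho(h^A_j)\big)-V^AV^B\,\mathcal E^{A|h^A_j{}'}_{j+1,k}\big(\rho(h^A_j{}')\big)\,V^A{}^\dagger V^B{}^\dagger\Big\|_{\mathrm{tr}}\le p,$$ where $h^A_j{}'$ is $h^A_j$ with $(a_j,x_j)$ replaced by $(a_j',x_j')$, and $V^D=V^D_j(h^D_{j-1},a_j',a_j,x_j'\oplus x_j)$ for $D\in\{A,B\}$. Here $\|\cdot\|_{\mathrm{tr}}$ is the trace norm (the sum of the singular values). -/

import Mathlib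

open scoped TensorProduct InnerProductSpace

noncomputable section

namespace CHSH

/-! ### Trace norm and block-diagonal operators -/

/-- The trace norm of an operator on an inner product space, in the variational form
`sup ∑ i, |⟪e i, T (f i)⟫|` over all finite orthonormal families `e`, `f`; it takes the value `∞`
when the operator is not of trace class.  For an operator of finite rank this is the sum of the
singular values of `T` (that is, the trace of `√(T† T)`), see `traceNorm_eq_sum_singularValues`. -/
def traceNorm {V : Type*} [NormedAddCommGroup V] [InnerProductSpace ℂ V] (T : V →ₗ[ℂ] V) :
    ENNReal :=
  ⨆ (m : ℕ) (e : Fin m → V) (f : Fin m → V) (_ : Orthonormal ℂ e) (_ : Orthonormal ℂ f),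
    ∑ i, ‖⟪e i, T (f i)⟫_ℂ‖ₑ

/-- If `T = ∑ i, s i |u i⟩⟨v i|` is a singular value decomposition, then the trace norm of `T`
is `∑ i, s i`. -/
theorem traceNorm_eq_sum_singularValues {V : Type*} [NormedAddCommGroup V]
    [InnerProductSpace ℂ V] (T : V →ₗ[ℂ] V) (r : ℕ) (s : Fin r → ℝ) (hs : ∀ i, 0 ≤ s i)
    (u v : Fin r → V) (hu : Orthonormal ℂ u) (hv : Orthonormal ℂ v)
    (hT : ∀ x, T x = ∑ i, ((s i : ℂ) * ⟪v i, x⟫_ℂ) • u i) :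
    traceNorm T = ENNReal.ofReal (∑ i, s i) := by
  apply le_antisymm
  · refine iSup_le fun m => iSup_le fun e => iSup_le fun f => iSup_le fun he => iSup_le fun hf => ?_
    have h1 : ∑ i, ‖⟪e i, T (f i)⟫_ℂ‖ₑ = ENNReal.ofReal (∑ i, ‖⟪e i, T (f i)⟫_ℂ‖) := by
      rw [ENNReal.ofReal_sum_of_nonneg (fun i _ => norm_nonneg _)]
      simp only [ofReal_norm]
    rw [h1]
    apply ENNReal.ofReal_le_ofReal
    have h2 : ∀ i, ‖⟪e i, T (f i)⟫_ℂ‖ ≤ ∑ k, s k * (‖⟪v k, f i⟫_ℂ‖ * ‖⟪u k, e i⟫_ℂ‖) := by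
      intro i
      rw [hT, inner_sum]
      refine (norm_sum_le _ _).trans (Finset.sum_le_sum fun k _ => ?_)
      rw [inner_smul_right, norm_mul, norm_mul, Complex.norm_real, Real.norm_of_nonneg (hs k),
        norm_inner_symm (e i) (u k), mul_assoc]
    refine (Finset.sum_le_sum fun i _ => h2 i).trans ?_
    rw [Finset.sum_comm]
    refine Finset.sum_le_sum fun k _ => ?_
    rw [← Finset.mul_sum]
    refine mul_le_of_le_one_right (hs k) ?_
    have b1 : ∑ i, ‖⟪v k, f i⟫_ℂ‖ ^ 2 ≤ 1 := by
      have := hf.sum_inner_products_le (v k) (s := Finset.univ)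
      simp only [norm_inner_symm (f _) (v k), hv.1 k] at this
      simpa using this
    have b2 : ∑ i, ‖⟪u k, e i⟫_ℂ‖ ^ 2 ≤ 1 := by
      have := he.sum_inner_products_le (u k) (s := Finset.univ)
      simp only [norm_inner_symm (e _) (u k), hu.1 k] at this
      simpa using this
    have b3 : ∑ i, ‖⟪v k, f i⟫_ℂ‖ * ‖⟪u k, e i⟫_ℂ‖ ≤
        ∑ i, (‖⟪v k, f i⟫_ℂ‖ ^ 2 + ‖⟪u k, e i⟫_ℂ‖ ^ 2) / 2 :=
      Finset.sum_le_sum fun i _ => by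
        nlinarith [sq_nonneg (‖⟪v k, f i⟫_ℂ‖ - ‖⟪u k, e i⟫_ℂ‖)]
    rw [← Finset.sum_div, Finset.sum_add_distrib] at b3
    linarith
  · have h3 : ENNReal.ofReal (∑ i, s i) = ∑ i, ‖⟪u i, T (v i)⟫_ℂ‖ₑ := by
      rw [ENNReal.ofReal_sum_of_nonneg (fun i _ => hs i)]
      refine Finset.sum_congr rfl fun i _ => ?_
      have : ⟪u i, T (v i)⟫_ℂ = (s i : ℂ) := by
        classical
        rw [hT]
        simp [orthonormal_iff_ite.mp hv, hu.1 i]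
      rw [this, ← ofReal_norm, Complex.norm_real, Real.norm_of_nonneg (hs i)]
    rw [h3]
    exact le_iSup_of_le r (le_iSup_of_le u (le_iSup_of_le v (le_iSup_of_le hu
      (le_iSup_of_le hv le_rfl))))

/-- For a finite set `K` of register values, the block-diagonal operator `∑ k, |k⟩⟨k| ⊗ σ k` on
`ℂ^K ⊗ V`, which is realized as the Hilbert space of functions `K → V`. -/
def blockDiag {K V : Type*} [Fintype K] [NormedAddCommGroup V] [InnerProductSpace ℂ V]
    (σ : K → (V →ₗ[ℂ] V)) :
    PiLp 2 (fun _ : K => V) →ₗ[ℂ] PiLp 2 (fun _ : K => V) where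
  toFun φ := WithLp.toLp 2 fun k => σ k (φ k)
  map_add' φ χ := by ext k; simp
  map_smul' c φ := by ext k; simp

/-! ### The ideal one-qubit operators -/

/-- `ketA a x` is the vector `|(a,x)_A⟩` of `ℂ²`. -/
def ketA (a x : Fin 2) : Fin 2 → ℂ :=
  if a = 0 then Pi.single x 1
  else ![1 / (Real.sqrt 2 : ℂ), (-1) ^ (x : ℕ) / (Real.sqrt 2 : ℂ)]

/-- `ketB b y` is the vector `|(b,y)_B⟩` of `ℂ²`. -/
def ketB (b y : Fin 2) : Fin 2 → ℂ :=
  if y = 0 then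
    ![(Real.cos (Real.pi / 8) : ℂ), (-1) ^ (b : ℕ) * (Real.sin (Real.pi / 8) : ℂ)]
  else ![(Real.sin (Real.pi / 8) : ℂ), -((-1) ^ (b : ℕ) * (Real.cos (Real.pi / 8) : ℂ))]

/-- `outer v w` is the matrix `|v⟩⟨w|`. -/
def outer (v w : Fin 2 → ℂ) : Matrix (Fin 2) (Fin 2) ℂ := Matrix.vecMulVec v (star w)

/-- Alice's ideal reflection `|(α,0)_A⟩⟨(α,0)_A| - |(α,1)_A⟩⟨(α,1)_A|`. -/
def idealA (α : Fin 2) : Matrix (Fin 2) (Fin 2) ℂ :=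
  outer (ketA α 0) (ketA α 0) - outer (ketA α 1) (ketA α 1)

/-- Bob's ideal reflection `|(α,0)_B⟩⟨(α,0)_B| - |(α,1)_B⟩⟨(α,1)_B|`. -/
def idealB (α : Fin 2) : Matrix (Fin 2) (Fin 2) ℂ :=
  outer (ketB α 0) (ketB α 0) - outer (ketB α 1) (ketB α 1)

/-- The basis change `∑ x, |(a', x ⊕ Δ)_A⟩⟨(a, x)_A|` between Alice's ideal measurement bases
(addition in `Fin 2` is exclusive or). -/
def basisChange (a a' Δ : Fin 2) : Matrix (Fin 2) (Fin 2) ℂ :=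
  ∑ x : Fin 2, outer (ketA a' (x + Δ)) (ketA a x)

/-! ### Several qubits -/

/-- `(ℂ²)^{⊗ I} ⊗ H`, realized as the Hilbert space of functions from bit strings to `H`. -/
abbrev QubitSpace (I H : Type*) : Type _ := PiLp 2 (fun _ : I → Fin 2 => H)

section Qubits

variable {n : ℕ} {H : Type*} [NormedAddCommGroup H] [InnerProductSpace ℂ H]

/-- The one-qubit operator `M` acting on qubit `j`. -/
def onQubit (j : Fin n) (M : Matrix (Fin 2) (Fin 2) ℂ) :
    QubitSpace (Fin n) H →ₗ[ℂ] QubitSpace (Fin n) H where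
  toFun φ := WithLp.toLp 2 fun s => ∑ c : Fin 2, M (s j) c • φ (Function.update s j c)
  map_add' φ χ := by ext s; simp [Finset.sum_add_distrib]
  map_smul' z φ := by
    ext s
    simp [smul_add, smul_comm z]

/-- A bit string on `n` qubits is a bit string on the qubits before `j` together with one on the
remaining `n - j` qubits (qubits are numbered from `0`). -/
def splitBits (j : ℕ) :
    (Fin n → Fin 2) ≃
      Σ _ : ({i : Fin n // (i : ℕ) < j} → Fin 2), ({i : Fin n // ¬ (i : ℕ) < j} → Fin 2) :=
  (Equiv.piEquivPiSubtypeProd (fun i : Fin n => (i : ℕ) < j) (fun _ => Fin 2)).trans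
    (Equiv.sigmaEquivProd _ _).symm

/-- The canonical unitary `(ℂ²)^{⊗ n} ⊗ H ≅ (ℂ²)^{⊗ j} ⊗ ((ℂ²)^{⊗ (n - j)} ⊗ H)`. -/
def splitQubits (n j : ℕ) (H : Type*) [NormedAddCommGroup H] [InnerProductSpace ℂ H] :
    QubitSpace (Fin n) H ≃ₗᵢ[ℂ]
      PiLp 2 (fun _ : ({i : Fin n // (i : ℕ) < j} → Fin 2) =>
        QubitSpace {i : Fin n // ¬ (i : ℕ) < j} H) :=
  (LinearIsometryEquiv.piLpCongrLeft 2 ℂ H (splitBits j)).trans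
    (LinearIsometryEquiv.piLpCurry ℂ 2
      (fun (_ : {i : Fin n // (i : ℕ) < j} → Fin 2)
        (_ : {i : Fin n // ¬ (i : ℕ) < j} → Fin 2) => H))

/-- The unitary `1 ⊗ U` on `(ℂ²)^{⊗ n} ⊗ H`, where the identity acts on the first `j` qubits and
`U` acts on the remaining `n - j` qubits and `H`. -/
def idTensor {j : ℕ}
    (U : QubitSpace {i : Fin n // ¬ (i : ℕ) < j} H ≃ₗᵢ[ℂ]
      QubitSpace {i : Fin n // ¬ (i : ℕ) < j} H) :
    QubitSpace (Fin n) H ≃ₗᵢ[ℂ] QubitSpace (Fin n) H :=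
  ((splitQubits n j H).trans (LinearIsometryEquiv.piLpCongrRight 2 (fun _ => U))).trans
    (splitQubits n j H).symm

end Qubits

/-! ### Strategies for sequential CHSH games

Games are numbered from `0` here: game `j` is preceded by `j` games. -/

/-- One prover's transcript of `j` games: a pair (question, answer) for each of them. -/
abbrev Hist (j : ℕ) : Type := Fin j → Fin 2 × Fin 2

/-- One prover's part of a strategy for `n` sequential CHSH games: for each game `j < n`,
local transcript of the previous games, and question, a reflection of the prover's space. -/
structure Prover (n : ℕ) (H : Type*) [NormedAddCommGroup H] [InnerProductSpace ℂ H] where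
  refl : (j : Fin n) → Hist j → Fin 2 → (H →ₗ[ℂ] H)
  symmetric : ∀ j h a, (refl j h a).IsSymmetric
  involutive : ∀ j h a, refl j h a ∘ₗ refl j h a = LinearMap.id

section Prover

variable {n : ℕ} {H : Type*} [NormedAddCommGroup H] [InnerProductSpace ℂ H]

/-- The projection `½ (1 + (-1)^x R)` for the last game of the transcript `h`, where `R` is the
reflection for the last question of `h` and `x` is its last answer.  (From game `n` on, where
there is no game and where it is not used, it is set to be the identity.) -/
def Prover.proj (P : Prover n H) {j : ℕ} (h : Hist (j + 1)) : H →ₗ[ℂ] H :=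
  if hj : j < n then
    (1 / 2 : ℂ) • (LinearMap.id + ((-1 : ℂ) ^ ((h (Fin.last j)).2 : ℕ)) •
      P.refl ⟨j, hj⟩ (Fin.init h) (h (Fin.last j)).1)
  else LinearMap.id

/-- The product of the projections along the transcript `h`, the first game's rightmost. -/
def Prover.prodProj (P : Prover n H) : {j : ℕ} → Hist j → (H →ₗ[ℂ] H)
  | 0, _ => LinearMap.id
  | _ + 1, h => P.proj h ∘ₗ P.prodProj (Fin.init h)

end Prover

/-- The Hilbert space `HA ⊗ HB ⊗ HC`, with the inner product of the tensor product. -/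
def JointSpace (HA HB HC : Type*)
    [NormedAddCommGroup HA] [InnerProductSpace ℂ HA]
    [NormedAddCommGroup HB] [InnerProductSpace ℂ HB]
    [NormedAddCommGroup HC] [InnerProductSpace ℂ HC] : Type _ :=
  HA ⊗[ℂ] HB ⊗[ℂ] HC

instance instNormedAddCommGroupJointSpace (HA HB HC : Type*)
    [NormedAddCommGroup HA] [InnerProductSpace ℂ HA]
    [NormedAddCommGroup HB] [InnerProductSpace ℂ HB]
    [NormedAddCommGroup HC] [InnerProductSpace ℂ HC] :
    NormedAddCommGroup (JointSpace HA HB HC) :=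
  inferInstanceAs (NormedAddCommGroup (HA ⊗[ℂ] HB ⊗[ℂ] HC))

instance instInnerProductSpaceJointSpace (HA HB HC : Type*)
    [NormedAddCommGroup HA] [InnerProductSpace ℂ HA]
    [NormedAddCommGroup HB] [InnerProductSpace ℂ HB]
    [NormedAddCommGroup HC] [InnerProductSpace ℂ HC] :
    InnerProductSpace ℂ (JointSpace HA HB HC) :=
  inferInstanceAs (InnerProductSpace ℂ (HA ⊗[ℂ] HB ⊗[ℂ] HC))

/-- A strategy for two provers to play `n` sequential CHSH games, with initial shared state in
`HA ⊗ HB ⊗ HC`. -/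
structure Strategy (n : ℕ) (HA HB HC : Type*)
    [NormedAddCommGroup HA] [InnerProductSpace ℂ HA]
    [NormedAddCommGroup HB] [InnerProductSpace ℂ HB]
    [NormedAddCommGroup HC] [InnerProductSpace ℂ HC] where
  alice : Prover n HA
  bob : Prover n HB
  state : JointSpace HA HB HC
  norm_state : ‖state‖ = 1

section Joint

variable {HA HB HC : Type*}
  [NormedAddCommGroup HA] [InnerProductSpace ℂ HA]
  [NormedAddCommGroup HB] [InnerProductSpace ℂ HB]
  [NormedAddCommGroup HC] [InnerProductSpace ℂ HC]

/-- `M ⊗ N ⊗ 1` on `HA ⊗ HB ⊗ HC`. -/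
def joint (HC : Type*) [NormedAddCommGroup HC] [InnerProductSpace ℂ HC]
    (M : HA →ₗ[ℂ] HA) (N : HB →ₗ[ℂ] HB) :
    JointSpace HA HB HC →ₗ[ℂ] JointSpace HA HB HC :=
  TensorProduct.map (TensorProduct.map M N) LinearMap.id

/-- The normalization of a vector; the zero vector is left as it is. -/
def normalize {V : Type*} [NormedAddCommGroup V] [InnerProductSpace ℂ V] (v : V) : V :=
  ((‖v‖ : ℂ)⁻¹) • v

/-- The operator `|v⟩⟨v|`. -/
def density {V : Type*} [NormedAddCommGroup V] [InnerProductSpace ℂ V] (v : V) : V →ₗ[ℂ] V :=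
  (InnerProductSpace.rankOne ℂ v v).toLinearMap

variable {n : ℕ}

/-- The shared state after the games with full transcript `(hA, hB)`. -/
def Strategy.stateAt (S : Strategy n HA HB HC) {j : ℕ} (h : Hist j × Hist j) :
    JointSpace HA HB HC :=
  normalize (joint HC (S.alice.prodProj h.1) (S.bob.prodProj h.2) S.state)

/-- The density matrix after Alice alone has measured along her local transcript `hA`. -/
def Strategy.rhoA (S : Strategy n HA HB HC) {j : ℕ} (hA : Hist j) :
    JointSpace HA HB HC →ₗ[ℂ] JointSpace HA HB HC :=
  density (normalize (joint HC (S.alice.prodProj hA) LinearMap.id S.state))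

/-- The conditional probability of the answers in the last game of the full transcript `h`, given
the questions in this game and the transcript of the previous games. -/
def Strategy.answerProb (S : Strategy n HA HB HC) {j : ℕ} (h : Hist (j + 1) × Hist (j + 1)) : ℝ :=
  ‖joint HC (S.alice.proj h.1) (S.bob.proj h.2) (S.stateAt (Fin.init h.1, Fin.init h.2))‖ ^ 2

/-- The probability `Pr[H_j = h]` of a full transcript of `j` games: the questions are uniformly
random and independent in each game. -/
def Strategy.histProb (S : Strategy n HA HB HC) : {j : ℕ} → Hist j × Hist j → ℝ
  | 0, _ => 1
  | _ + 1, h => S.histProb (Fin.init h.1, Fin.init h.2) * (1 / 4 * S.answerProb h)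

open Classical in
/-- The probability that the transcript of the first `j` games satisfies `E`. -/
def Strategy.prob (S : Strategy n HA HB HC) {j : ℕ} (E : Hist j × Hist j → Prop) : ℝ :=
  ∑ h : Hist j × Hist j, if E h then S.histProb h else 0

/-- The correlation value `∑_{a,b} (-1)^{ab} 𝔼[(-1)^{X+Y} | A = a, B = b]` of game `j` after the
transcript `h` of the previous games. -/
def Strategy.correlation (S : Strategy n HA HB HC) {j : ℕ} (h : Hist j × Hist j) : ℝ :=
  ∑ a : Fin 2, ∑ b : Fin 2, (-1 : ℝ) ^ ((a : ℕ) * (b : ℕ)) *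
    ∑ x : Fin 2, ∑ y : Fin 2, (-1 : ℝ) ^ ((x : ℕ) + (y : ℕ)) *
      S.answerProb (Fin.snoc (α := fun _ => Fin 2 × Fin 2) h.1 (a, x),
        Fin.snoc (α := fun _ => Fin 2 × Fin 2) h.2 (b, y))

/-- Game `j` after the transcript `h` is `ε`-structured. -/
def Strategy.GameStructured (S : Strategy n HA HB HC) (ε : ℝ) {j : ℕ} (h : Hist j × Hist j) :
    Prop :=
  2 * Real.sqrt 2 - ε ≤ S.correlation h

/-- The strategy is `(δ, ε)`-structured: each game is `ε`-structured with probability at least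
`1 - δ` over the transcript of the previous games. -/
def Strategy.Structured (S : Strategy n HA HB HC) (δ ε : ℝ) : Prop :=
  ∀ j : Fin n, 1 - δ ≤ S.prob (j := j) (fun h => S.GameStructured ε h)

/-- Alice's super-operator for the `m`-th game after the transcript `hA` (counting from `0`).  Its
arguments and values are block-diagonal operators `∑ t, |t⟩⟨t| ⊗ σ t`, given by the function `σ`,
where the register holds Alice's transcript `t` of the games after `hA`; it maps
`|t⟩⟨t| ⊗ ρ` to `½ ∑_{a,x} |t,a,x⟩⟨t,a,x| ⊗ P ρ P`. -/
def Strategy.stepA (S : Strategy n HA HB HC) {j : ℕ} (hA : Hist j) {m : ℕ}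
    (σ : Hist m → (JointSpace HA HB HC →ₗ[ℂ] JointSpace HA HB HC)) :
    Hist (m + 1) → (JointSpace HA HB HC →ₗ[ℂ] JointSpace HA HB HC) := fun t =>
  let P := joint HC (S.alice.proj (j := j + m) (Fin.append (m := j) (n := m + 1) hA t)) (LinearMap.id : HB →ₗ[ℂ] HB)
  (1 / 2 : ℂ) • (P ∘ₗ σ (Fin.init t) ∘ₗ P)

/-- The effect on `ρ` of Alice playing the `m` games that follow the transcript `hA`. -/
def Strategy.playA (S : Strategy n HA HB HC) {j : ℕ} (hA : Hist j)
    (ρ : JointSpace HA HB HC →ₗ[ℂ] JointSpace HA HB HC) :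
    (m : ℕ) → Hist m → (JointSpace HA HB HC →ₗ[ℂ] JointSpace HA HB HC)
  | 0 => fun _ => ρ
  | m + 1 => S.stepA hA (S.playA hA ρ m)

end Joint

/-! ### Multi-qubit ideal strategies -/

/-- The data that locate one prover's qubits: a unitary `H ≅ (ℂ²)^{⊗ n} ⊗ H'`, and for each game
`j` and local transcript of the previous games a unitary on all but the first `j` qubits. -/
structure QubitFrame (n : ℕ) (H H' : Type*) [NormedAddCommGroup H] [InnerProductSpace ℂ H]
    [NormedAddCommGroup H'] [InnerProductSpace ℂ H'] where
  Y : H ≃ₗᵢ[ℂ] QubitSpace (Fin n) H'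
  U : (j : Fin n) → Hist j →
    (QubitSpace {i : Fin n // ¬ (i : ℕ) < (j : ℕ)} H' ≃ₗᵢ[ℂ]
      QubitSpace {i : Fin n // ¬ (i : ℕ) < (j : ℕ)} H')

section Frame

variable {n : ℕ} {H H' : Type*} [NormedAddCommGroup H] [InnerProductSpace ℂ H]
  [NormedAddCommGroup H'] [InnerProductSpace ℂ H']

/-- `1 ⊗ U_j(h)` (and the identity if there is no game `j`, a case that is not used). -/
def QubitFrame.step (F : QubitFrame n H H') {j : ℕ} (h : Hist j) :
    QubitSpace (Fin n) H' ≃ₗᵢ[ℂ] QubitSpace (Fin n) H' :=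
  if hj : j < n then idTensor (F.U ⟨j, hj⟩ h) else LinearIsometryEquiv.refl ℂ _

/-- The basis change `(1 ⊗ U_j) ⋯ (1 ⊗ U_1) U_0 Y` along the local transcript `h` of the games
before game `j`. -/
def QubitFrame.frame (F : QubitFrame n H H') :
    {j : ℕ} → Hist j → (H ≃ₗᵢ[ℂ] QubitSpace (Fin n) H')
  | 0, h => F.Y.trans (F.step h)
  | _ + 1, h => (F.frame (Fin.init h)).trans (F.step h)

/-- The one-qubit operator `M` acting on the prover's qubit for game `j` after the local
transcript `h`. -/
def QubitFrame.onGameQubit (F : QubitFrame n H H') (j : Fin n) (h : Hist j)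
    (M : Matrix (Fin 2) (Fin 2) ℂ) : H →ₗ[ℂ] H :=
  (F.frame h).symm.toLinearEquiv.toLinearMap ∘ₗ onQubit j M ∘ₗ
    (F.frame h).toLinearEquiv.toLinearMap

/-- Each of the prover's reflections is the ideal reflection `R α` on the prover's qubit for the
game in question. -/
def QubitFrame.Realizes (F : QubitFrame n H H') (R : Fin 2 → Matrix (Fin 2) (Fin 2) ℂ)
    (P : Prover n H) : Prop :=
  ∀ (j : Fin n) (h : Hist j) (α : Fin 2), P.refl j h α = F.onGameQubit j h (R α)

end Frame

end CHSH

end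

open scoped TensorProduct InnerProductSpace

noncomputable section

namespace CHSH

/-! Write `Z`, `X` for Alice's two ideal reflections; Bob's are `(Z ± X)/√2`. The CHSH correlation
of a game in a state `φ` then equals `√2 ⟪φ, (Z ⊗ Z + X ⊗ X) φ⟫`. For a unit vector `φ`, the squared
norms of `(Z ⊗ 1 - 1 ⊗ Z) φ` and `(X ⊗ 1 - 1 ⊗ X) φ` therefore add up to `√2` times the gap between
the correlation and `2√2`. So in a structured game the two qubits nearly form an EPR pair, on which
`1 ⊗ M` may be replaced by `Mᵀ ⊗ 1`. `Strategy.wnorm_deviation_le` is this statement averaged over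
transcripts.

It concerns states in which both players have measured, whereas the theorem is about Alice measuring
alone. To remove Bob's measurements, each of his projections `|w⟩⟨w|` is replaced by `|z⟩⟨w|`, where
`z` is Alice's question and answer in the same game. This changes no relevant norm, but it leaves
Bob's qubit in the state `|z⟩`, where Alice's measurement of the near-EPR pair had already put it.
Hence the resulting vector is close to Alice's own state times the product of the overlaps `⟨w|z⟩`
(`wnorm_transferred_sub_le`), and near-perfect correlation passes to Alice's state, weighted by
these overlaps (`wnorm_deviation_measured_le`).

Now take two transcripts of Alice that differ in game `j` alone. Right after game `j` the basis
change on both qubits carries one state to the other, because `O ⊗ O` fixes an EPR pair when `O` is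
real orthogonal. In the later games the location of Alice's qubits depends on what happened in game
`j`, so her projections along the two transcripts cannot be compared directly. They are moved to
Bob's qubits (`wnorm_measured_sub_chainFrom_le`), which are located by Bob's transcript. There the
two products of projections coincide (`chainFrom_update`) and commute with the basis change. This
yields `wnorm_measured_update_le`, with an error polynomial in `n` times `√(δ + ε)`.

Finally, the overlap weights approximate the true transcript distribution, so a Markov argument
bounds the probability of the transcripts with a large distance (`Strategy.sq_mul_prob_le`), and
closeness of unnormalized vectors gives closeness of the normalized ensembles in trace norm
(`traceNorm_blockDiag_normalized_le`). -/

/-! ### One-qubit identities -/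

/-- `1 / √2` as a complex number. -/
def invSqrtTwo : ℂ := (((Real.sqrt 2)⁻¹ : ℝ) : ℂ)

/-- `cos (π / 8)` as a complex number. -/
def cosPiDivEight : ℂ := ((Real.cos (Real.pi / 8) : ℝ) : ℂ)

/-- `sin (π / 8)` as a complex number. -/
def sinPiDivEight : ℂ := ((Real.sin (Real.pi / 8) : ℝ) : ℂ)

theorem star_invSqrtTwo : star invSqrtTwo = invSqrtTwo := Complex.conj_ofReal _
theorem star_cosPiDivEight : star cosPiDivEight = cosPiDivEight := Complex.conj_ofReal _
theorem star_sinPiDivEight : star sinPiDivEight = sinPiDivEight := Complex.conj_ofReal _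

theorem sqrt_two_div_two : Real.sqrt 2 / 2 = (Real.sqrt 2)⁻¹ := by
  rw [eq_comm, inv_eq_iff_eq_inv, inv_div, eq_div_iff (by positivity), Real.mul_self_sqrt]
  norm_num

theorem invSqrtTwo_sq : invSqrtTwo ^ 2 = 1 / 2 := by
  rw [invSqrtTwo, ← Complex.ofReal_pow, inv_pow, Real.sq_sqrt (by norm_num)]; norm_num

theorem cos_sq_add_sin_sq_pi_div_eight : cosPiDivEight ^ 2 + sinPiDivEight ^ 2 = 1 := by
  rw [cosPiDivEight, sinPiDivEight, ← Complex.ofReal_pow, ← Complex.ofReal_pow,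
    ← Complex.ofReal_add, Real.cos_sq_add_sin_sq, Complex.ofReal_one]

theorem cos_sq_sub_sin_sq_pi_div_eight :
    cosPiDivEight ^ 2 - sinPiDivEight ^ 2 = invSqrtTwo := by
  have h := Real.cos_two_mul (Real.pi / 8)
  have h' := Real.cos_sq_add_sin_sq (Real.pi / 8)
  rw [show 2 * (Real.pi / 8) = Real.pi / 4 by ring, Real.cos_pi_div_four, sqrt_two_div_two] at h
  rw [cosPiDivEight, sinPiDivEight, invSqrtTwo, ← Complex.ofReal_pow, ← Complex.ofReal_pow,
    ← Complex.ofReal_sub]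
  congr 1
  rw [h]; linarith

theorem two_mul_cos_mul_sin_pi_div_eight :
    2 * cosPiDivEight * sinPiDivEight = invSqrtTwo := by
  have h := Real.sin_two_mul (Real.pi / 8)
  rw [show 2 * (Real.pi / 8) = Real.pi / 4 by ring, Real.sin_pi_div_four, sqrt_two_div_two] at h
  rw [cosPiDivEight, sinPiDivEight, invSqrtTwo, ← Complex.ofReal_ofNat, ← Complex.ofReal_mul,
    ← Complex.ofReal_mul]
  congr 1
  rw [h]; ring

theorem ketA_zero_zero : ketA 0 0 = ![1, 0] := by
  ext i; fin_cases i <;> simp [ketA]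
theorem ketA_zero_one : ketA 0 1 = ![0, 1] := by
  ext i; fin_cases i <;> simp [ketA]
theorem ketA_one_zero : ketA 1 0 = ![invSqrtTwo, invSqrtTwo] := by
  ext i; fin_cases i <;> simp [ketA, invSqrtTwo]
theorem ketA_one_one : ketA 1 1 = ![invSqrtTwo, -invSqrtTwo] := by
  ext i; fin_cases i <;> simp [ketA, invSqrtTwo, neg_div]
theorem ketB_zero_zero : ketB 0 0 = ![cosPiDivEight, sinPiDivEight] := by
  ext i; fin_cases i <;> simp [ketB, cosPiDivEight, sinPiDivEight]
theorem ketB_zero_one : ketB 0 1 = ![sinPiDivEight, -cosPiDivEight] := by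
  ext i; fin_cases i <;> simp [ketB, cosPiDivEight, sinPiDivEight]
theorem ketB_one_zero : ketB 1 0 = ![cosPiDivEight, -sinPiDivEight] := by
  ext i; fin_cases i <;> simp [ketB, cosPiDivEight, sinPiDivEight]
theorem ketB_one_one : ketB 1 1 = ![sinPiDivEight, cosPiDivEight] := by
  ext i; fin_cases i <;> simp [ketB, cosPiDivEight, sinPiDivEight]

theorem outer_apply (u v : Fin 2 → ℂ) (i k : Fin 2) : outer u v i k = u i * star (v k) := rfl

theorem outer_mul_outer (u v w z : Fin 2 → ℂ) :
    outer u v * outer w z = (star v ⬝ᵥ w) • outer u z := by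
  simp only [outer]
  rw [Matrix.vecMulVec_mul_vecMulVec]
  ext i j
  simp [Matrix.vecMulVec_apply]; ring

theorem conjTranspose_outer (u v : Fin 2 → ℂ) : (outer u v).conjTranspose = outer v u := by
  ext i j; simp [outer, Matrix.vecMulVec_apply, mul_comm]

theorem star_ketA (a x : Fin 2) : star (ketA a x) = ketA a x := by
  have h := star_invSqrtTwo
  ext i
  revert a x i
  simp only [Fin.forall_fin_two, ketA_zero_zero, ketA_zero_one,
    ketA_one_zero, ketA_one_one]
  simpa using h

theorem star_ketB (b y : Fin 2) : star (ketB b y) = ketB b y := by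
  have h := star_cosPiDivEight
  have h' := star_sinPiDivEight
  ext i
  revert b y i
  simp only [Fin.forall_fin_two, ketB_zero_zero, ketB_zero_one,
    ketB_one_zero, ketB_one_one]
  simp only [Complex.star_def] at h h'
  simp [h, h']

theorem ketA_orthonormal (a x x' : Fin 2) :
    star (ketA a x) ⬝ᵥ ketA a x' = if x = x' then 1 else 0 := by
  have h := invSqrtTwo_sq
  rw [star_ketA]
  revert a x x'
  simp only [Fin.forall_fin_two, ketA_zero_zero, ketA_zero_one,
    ketA_one_zero, ketA_one_one]
  constructorm* _ ∧ _ <;> simp [dotProduct, Fin.sum_univ_two] <;> linear_combination 2 * h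

theorem ketB_orthonormal (b y y' : Fin 2) :
    star (ketB b y) ⬝ᵥ ketB b y' = if y = y' then 1 else 0 := by
  have h := cos_sq_add_sin_sq_pi_div_eight
  rw [star_ketB]
  revert b y y'
  simp only [Fin.forall_fin_two, ketB_zero_zero, ketB_zero_one,
    ketB_one_zero, ketB_one_one]
  constructorm* _ ∧ _ <;> simp [dotProduct, Fin.sum_univ_two] <;>
    first | linear_combination h | linear_combination 0 * h

/-- `|(a,x)_A⟩⟨(a,x)_A|`. -/
def measA (z : Fin 2 × Fin 2) : Matrix (Fin 2) (Fin 2) ℂ := outer (ketA z.1 z.2) (ketA z.1 z.2)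

/-- `|(b,y)_B⟩⟨(b,y)_B|`. -/
def measB (z : Fin 2 × Fin 2) : Matrix (Fin 2) (Fin 2) ℂ := outer (ketB z.1 z.2) (ketB z.1 z.2)

theorem measA_apply (z : Fin 2 × Fin 2) (i k : Fin 2) :
    measA z i k = ketA z.1 z.2 i * ketA z.1 z.2 k := by
  rw [measA, outer_apply, ← Pi.star_apply, star_ketA]

theorem measB_apply (z : Fin 2 × Fin 2) (i k : Fin 2) :
    measB z i k = ketB z.1 z.2 i * ketB z.1 z.2 k := by
  rw [measB, outer_apply, ← Pi.star_apply, star_ketB]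

theorem sum_measA (a : Fin 2) : ∑ x, measA (a, x) = 1 := by
  have h := invSqrtTwo_sq
  ext i k
  rw [Matrix.sum_apply, Fin.sum_univ_two]
  simp only [measA_apply]
  revert a i k
  simp only [Fin.forall_fin_two, ketA_zero_zero, ketA_zero_one,
    ketA_one_zero, ketA_one_one]
  constructorm* _ ∧ _ <;> simp <;> linear_combination 2 * h

theorem sum_measB (a : Fin 2) : ∑ x, measB (a, x) = 1 := by
  have h := cos_sq_add_sin_sq_pi_div_eight
  ext i k
  rw [Matrix.sum_apply, Fin.sum_univ_two]
  simp only [measB_apply]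
  revert a i k
  simp only [Fin.forall_fin_two, ketB_zero_zero, ketB_zero_one,
    ketB_one_zero, ketB_one_one]
  constructorm* _ ∧ _ <;> simp <;>
    first | linear_combination h | linear_combination 0 * h

theorem idealA_eq (a : Fin 2) : idealA a = measA (a, 0) - measA (a, 1) := rfl
theorem idealB_eq (b : Fin 2) : idealB b = measB (b, 0) - measB (b, 1) := rfl

theorem measA_eq (a x : Fin 2) :
    measA (a, x) = (1 / 2 : ℂ) • (1 + (-1 : ℂ) ^ (x : ℕ) • idealA a) := by
  have h := sum_measA a
  rw [Fin.sum_univ_two] at h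
  rw [idealA_eq, ← h]
  fin_cases x
  · ext i k; simp; ring
  · ext i k; simp; ring

theorem measB_eq (a x : Fin 2) :
    measB (a, x) = (1 / 2 : ℂ) • (1 + (-1 : ℂ) ^ (x : ℕ) • idealB a) := by
  have h := sum_measB a
  rw [Fin.sum_univ_two] at h
  rw [idealB_eq, ← h]
  fin_cases x
  · ext i k; simp; ring
  · ext i k; simp; ring

theorem idealA_apply (a i k : Fin 2) :
    idealA a i k = ketA a 0 i * ketA a 0 k - ketA a 1 i * ketA a 1 k := by
  rw [idealA_eq, Matrix.sub_apply, measA_apply, measA_apply]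

theorem idealB_apply (a i k : Fin 2) :
    idealB a i k = ketB a 0 i * ketB a 0 k - ketB a 1 i * ketB a 1 k := by
  rw [idealB_eq, Matrix.sub_apply, measB_apply, measB_apply]

theorem idealA_zero : idealA 0 = !![1, 0; 0, -1] := by
  ext i k
  rw [idealA_apply, ketA_zero_zero, ketA_zero_one]
  fin_cases i <;> fin_cases k <;> simp

theorem idealA_one : idealA 1 = !![0, 1; 1, 0] := by
  have h := invSqrtTwo_sq
  ext i k
  rw [idealA_apply, ketA_one_zero, ketA_one_one]
  fin_cases i <;> fin_cases k <;> simp <;> linear_combination 2 * h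

/-- Bob's bases are rotated by `π/8`, which makes his observables `(Z ± X)/√2`. This reduces all
correlations between the players to those of Alice's two reflections. -/
theorem idealB_eq_smul (b : Fin 2) :
    idealB b = invSqrtTwo • (idealA 0 + (-1 : ℂ) ^ (b : ℕ) • idealA 1) := by
  have h1 := cos_sq_sub_sin_sq_pi_div_eight
  have h2 := two_mul_cos_mul_sin_pi_div_eight
  rw [idealA_zero, idealA_one]
  ext i k
  rw [idealB_apply]
  revert b i k
  simp only [Fin.forall_fin_two, ketB_zero_zero, ketB_zero_one,
    ketB_one_zero, ketB_one_one]
  constructorm* _ ∧ _ <;> simp <;>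
    first | linear_combination h1 | linear_combination -h1 | linear_combination h2 |
      linear_combination -h2

theorem idealA_mul_self (a : Fin 2) : idealA a * idealA a = 1 := by
  fin_cases a
  · simp [idealA_zero, Matrix.one_fin_two]
  · simp [idealA_one, Matrix.one_fin_two]

theorem conjTranspose_idealA (a : Fin 2) : (idealA a).conjTranspose = idealA a := by
  simp [idealA, conjTranspose_outer]

theorem conjTranspose_measA (z : Fin 2 × Fin 2) : (measA z).conjTranspose = measA z :=
  conjTranspose_outer _ _

theorem conjTranspose_measB (z : Fin 2 × Fin 2) : (measB z).conjTranspose = measB z :=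
  conjTranspose_outer _ _

theorem measA_mul_self (z : Fin 2 × Fin 2) : measA z * measA z = measA z := by
  rw [measA, outer_mul_outer, ketA_orthonormal]; simp

theorem measB_mul_self (z : Fin 2 × Fin 2) : measB z * measB z = measB z := by
  rw [measB, outer_mul_outer, ketB_orthonormal]; simp

/-! ### Transfer operators, overlaps and basis changes. -/

/-- `|(a,x)_A⟩⟨(b,y)_B|`. -/
def transferMatrix (z w : Fin 2 × Fin 2) : Matrix (Fin 2) (Fin 2) ℂ :=
  outer (ketA z.1 z.2) (ketB w.1 w.2)

/-- The norm of `M v` depends on `M† M` alone. So Bob's projection can be exchanged for the transfer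
operator without changing norms, although the resulting state of the qubit is different. -/
theorem conjTranspose_transferMatrix_mul_self (z w : Fin 2 × Fin 2) :
    (transferMatrix z w).conjTranspose * transferMatrix z w = measB w := by
  rw [transferMatrix, conjTranspose_outer, measB, outer_mul_outer, ketA_orthonormal]; simp

/-- The overlap `⟨(b,y)_B|(a,x)_A⟩`. -/
def overlap (z w : Fin 2 × Fin 2) : ℂ := star (ketB w.1 w.2) ⬝ᵥ ketA z.1 z.2

/-- On a qubit already in Alice's state `|z⟩`, the transfer operator only multiplies by a scalar.
This is why it nearly undoes Bob's measurement. -/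
theorem transferMatrix_mul_measA (z w : Fin 2 × Fin 2) :
    transferMatrix z w * measA z = overlap z w • measA z := by
  rw [transferMatrix, measA, outer_mul_outer]; rfl

theorem norm_sq_eq_of_sq_eq {z : ℂ} {r : ℝ} (hr : 0 ≤ r) (h : z ^ 2 = r) : ‖z‖ ^ 2 = r := by
  rw [← norm_pow, h, Complex.norm_real, Real.norm_of_nonneg hr]

/-- The vectors of the two players' bases meet at odd multiples of `π/8`, so the only possible
values are `cos²(π/8)` and `sin²(π/8)`. -/
theorem norm_overlap_sq (z w : Fin 2 × Fin 2) :
    ‖overlap z w‖ ^ 2 = (2 + Real.sqrt 2) / 4 ∨ ‖overlap z w‖ ^ 2 = (2 - Real.sqrt 2) / 4 := by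
  have hs : Real.sqrt 2 ^ 2 = 2 := Real.sq_sqrt (by norm_num)
  have h2 : Real.sqrt 2 ≤ 2 := by nlinarith [Real.sqrt_nonneg 2]
  have e : ((Real.sqrt 2 : ℝ) : ℂ) = 2 * invSqrtTwo := by
    rw [invSqrtTwo, ← sqrt_two_div_two]; push_cast; ring
  have h : overlap z w ^ 2 = (1 + invSqrtTwo) / 2 ∨ overlap z w ^ 2 = (1 - invSqrtTwo) / 2 := by
    have h0 := invSqrtTwo_sq
    have h1 := cos_sq_sub_sin_sq_pi_div_eight
    have h2 := two_mul_cos_mul_sin_pi_div_eight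
    have h3 := cos_sq_add_sin_sq_pi_div_eight
    obtain ⟨a, x⟩ := z
    obtain ⟨b, y⟩ := w
    rw [overlap, star_ketB]
    simp only
    revert a x b y
    simp only [Fin.forall_fin_two, ketA_zero_zero, ketA_zero_one,
    ketA_one_zero, ketA_one_one, ketB_zero_zero, ketB_zero_one,
    ketB_one_zero, ketB_one_one]
    constructorm* _ ∧ _ <;> simp [dotProduct, Fin.sum_univ_two] <;>
      first
      | (left; linear_combination (h3 + h1) / 2)
      | (right; linear_combination (h3 - h1) / 2)
      | (left; linear_combination (cosPiDivEight + sinPiDivEight) ^ 2 * h0 + (h3 + h2) / 2)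
      | (right; linear_combination (cosPiDivEight - sinPiDivEight) ^ 2 * h0 + (h3 - h2) / 2)
  rcases h with h | h
  · left
    refine norm_sq_eq_of_sq_eq (by positivity) ?_
    rw [h]; push_cast; rw [e]; ring
  · right
    refine norm_sq_eq_of_sq_eq (by linarith) ?_
    rw [h]; push_cast; rw [e]; ring

theorem norm_overlap_le_one (z w : Fin 2 × Fin 2) : ‖overlap z w‖ ≤ 1 := by
  have hs : Real.sqrt 2 ^ 2 = 2 := Real.sq_sqrt (by norm_num)
  have h2 : Real.sqrt 2 ≤ 2 := by nlinarith [Real.sqrt_nonneg 2]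
  rcases norm_overlap_sq z w with h | h <;> nlinarith [Real.sqrt_nonneg 2, norm_nonneg (overlap z w)]

theorem norm_overlap_pos (z w : Fin 2 × Fin 2) : 0 < ‖overlap z w‖ := by
  have hs : Real.sqrt 2 ^ 2 = 2 := Real.sq_sqrt (by norm_num)
  have h2 : Real.sqrt 2 < 2 := by nlinarith [Real.sqrt_nonneg 2]
  have h0 : 0 < ‖overlap z w‖ ^ 2 → 0 < ‖overlap z w‖ := fun h =>
    (norm_nonneg _).lt_of_ne' (sq_pos_iff.mp h)
  apply h0
  rcases norm_overlap_sq z w with h | h <;> rw [h] <;> linarith [Real.sqrt_nonneg 2]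

/-- The extreme ratio is `(2 + √2)/(2 - √2) = 3 + 2√2 < 7`. It controls the change of weight when
one entry of Alice's transcript is replaced. -/
theorem norm_overlap_sq_le (z z' w : Fin 2 × Fin 2) :
    ‖overlap z w‖ ^ 2 ≤ 7 * ‖overlap z' w‖ ^ 2 := by
  have hs : Real.sqrt 2 ^ 2 = 2 := Real.sq_sqrt (by norm_num)
  have h2 : Real.sqrt 2 < 3 / 2 := by nlinarith [Real.sqrt_nonneg 2]
  rcases norm_overlap_sq z w with h | h <;> rcases norm_overlap_sq z' w with h' | h' <;>
    rw [h, h'] <;> linarith [Real.sqrt_nonneg 2]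

theorem sum_norm_overlap_sq (z : Fin 2 × Fin 2) (b : Fin 2) :
    ∑ y, ‖overlap z (b, y)‖ ^ 2 = 1 := by
  have hc : ∀ w, ((‖overlap z w‖ ^ 2 : ℝ) : ℂ) = star (overlap z w) * overlap z w := by
    intro w
    rw [Complex.ofReal_pow, ← Complex.conj_mul']; rfl
  have h := congrArg (fun M => star (ketA z.1 z.2) ⬝ᵥ Matrix.mulVec M (ketA z.1 z.2)) (sum_measB b)
  simp only [Matrix.one_mulVec, ketA_orthonormal, if_true] at h
  rw [← Complex.ofReal_inj, Complex.ofReal_sum, Complex.ofReal_one, ← h, Matrix.sum_mulVec,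
    dotProduct_sum]
  refine Finset.sum_congr rfl fun y _ => ?_
  rw [hc, measB, outer, Matrix.vecMulVec_mulVec, overlap]
  simp [dotProduct, Fin.sum_univ_two]
  ring

theorem sum_norm_overlap_sq_prod (z : Fin 2 × Fin 2) : ∑ w, ‖overlap z w‖ ^ 2 = 2 := by
  rw [Fintype.sum_prod_type]
  simp only [sum_norm_overlap_sq]
  simp

/-- Alice's vectors are real. The transposition rule for an EPR pair therefore produces the inverse
of the basis change. -/
theorem conjTranspose_basisChange (a a' d : Fin 2) :
    (basisChange a a' d).conjTranspose = (basisChange a a' d).transpose := by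
  simp only [basisChange, Matrix.conjTranspose_sum, Matrix.transpose_sum, conjTranspose_outer]
  refine Finset.sum_congr rfl fun x _ => ?_
  simp only [outer, star_ketA]
  rw [Matrix.transpose_vecMulVec]

theorem conjTranspose_basisChange_mul_self (a a' d : Fin 2) :
    (basisChange a a' d).conjTranspose * basisChange a a' d = 1 := by
  simp only [basisChange, Matrix.conjTranspose_sum, conjTranspose_outer, Finset.sum_mul,
    Finset.mul_sum, outer_mul_outer, ketA_orthonormal]
  simp [add_left_inj]
  simpa [measA] using sum_measA a

theorem basisChange_mul_conjTranspose_self (a a' d : Fin 2) :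
    basisChange a a' d * (basisChange a a' d).conjTranspose = 1 :=
  mul_eq_one_comm.mp (conjTranspose_basisChange_mul_self a a' d)

/-- The shift `x' + x` is the one that sends the answer `x'` to `x`, so the basis change intertwines
the two projections. -/
theorem basisChange_mul_measA (a' a x' x : Fin 2) :
    basisChange a' a (x' + x) * measA (a', x') = measA (a, x) * basisChange a' a (x' + x) := by
  have h : ∀ y : Fin 2, x = y + (x' + x) ↔ y = x' := by
    revert x x'; decide
  have h' : x' + (x' + x) = x := by
    revert x x'; decide
  simp only [basisChange, measA, Finset.sum_mul, Finset.mul_sum, outer_mul_outer,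
    ketA_orthonormal, h, ite_smul, one_smul, zero_smul, Finset.sum_ite_eq', Finset.mem_univ, if_true, h']

theorem norm_basisChange_apply_le (a a' d i k : Fin 2) : ‖basisChange a a' d i k‖ ≤ 1 := by
  have h := congrFun (congrFun (conjTranspose_basisChange_mul_self a a' d) k) k
  rw [Matrix.mul_apply] at h
  simp only [Matrix.conjTranspose_apply, Matrix.one_apply_eq] at h
  have h' : ∑ l, ‖basisChange a a' d l k‖ ^ 2 = 1 := by
    rw [← Complex.ofReal_inj, Complex.ofReal_sum, Complex.ofReal_one, ← h]
    refine Finset.sum_congr rfl fun l _ => ?_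
    rw [Complex.ofReal_pow, ← Complex.conj_mul']; rfl
  have h2 : ‖basisChange a a' d i k‖ ^ 2 ≤ 1 := by
    rw [← h']
    exact Finset.single_le_sum (f := fun l => ‖basisChange a a' d l k‖ ^ 2)
      (fun l _ => by positivity) (Finset.mem_univ i)
  nlinarith [norm_nonneg (basisChange a a' d i k)]

/-- The expansion of a matrix in products of Alice's two reflections. -/
theorem matrix_eq_combination (M : Matrix (Fin 2) (Fin 2) ℂ) :
    M = ((M 0 0 + M 1 1) / 2) • (1 : Matrix (Fin 2) (Fin 2) ℂ) +
      ((M 0 0 - M 1 1) / 2) • idealA 0 + ((M 0 1 + M 1 0) / 2) • idealA 1 +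
      ((M 0 1 - M 1 0) / 2) • (idealA 0 * idealA 1) := by
  rw [idealA_zero, idealA_one]
  ext i k
  fin_cases i <;> fin_cases k <;> simp <;> ring

/-! ### Weighted norms of functions of a pair of transcripts -/

/-- Separate the last game from a pair of transcripts. -/
def histPairEquiv (k : ℕ) :
    (Hist k × Hist k) × ((Fin 2 × Fin 2) × (Fin 2 × Fin 2)) ≃ Hist (k + 1) × Hist (k + 1) where
  toFun p := (Fin.snoc (α := fun _ => Fin 2 × Fin 2) p.1.1 p.2.1,
    Fin.snoc (α := fun _ => Fin 2 × Fin 2) p.1.2 p.2.2)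
  invFun h := ((Fin.init h.1, Fin.init h.2), (h.1 (Fin.last k), h.2 (Fin.last k)))
  left_inv p := by simp
  right_inv h := by simp

theorem sum_histPair_succ {M : Type*} [AddCommMonoid M] {k : ℕ}
    (f : Hist (k + 1) × Hist (k + 1) → M) :
    ∑ h, f h = ∑ h : Hist k × Hist k, ∑ z, ∑ w,
      f (Fin.snoc (α := fun _ => Fin 2 × Fin 2) h.1 z,
        Fin.snoc (α := fun _ => Fin 2 × Fin 2) h.2 w) := by
  rw [← (histPairEquiv k).sum_comp, Fintype.sum_prod_type]
  exact Finset.sum_congr rfl fun h _ => Fintype.sum_prod_type _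

section WeightedNorm

variable {E F : Type*} [NormedAddCommGroup E] [NormedAddCommGroup F]

/-- The `ℓ²` norm of a function of pairs of transcripts of `k` games, normalized by the
probability `4^{-k}` of each sequence of questions. -/
def wnorm {k : ℕ} (f : Hist k × Hist k → E) : ℝ := ‖WithLp.toLp 2 f‖ / 2 ^ k

theorem wnorm_nonneg {k : ℕ} (f : Hist k × Hist k → E) : 0 ≤ wnorm f := by
  unfold wnorm; positivity

theorem wnorm_sq {k : ℕ} (f : Hist k × Hist k → E) :
    wnorm f ^ 2 = (1 / 4) ^ k * ∑ h, ‖f h‖ ^ 2 := by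
  rw [wnorm, div_pow, PiLp.norm_sq_eq_of_L2, ← pow_mul, mul_comm k 2, pow_mul, div_pow, one_pow]
  norm_num
  ring

theorem wnorm_add_le {k : ℕ} (f g : Hist k × Hist k → E) :
    wnorm (fun h => f h + g h) ≤ wnorm f + wnorm g := by
  unfold wnorm
  rw [← add_div]
  gcongr
  exact norm_add_le (WithLp.toLp 2 f) (WithLp.toLp 2 g)

theorem wnorm_le_of_sum_le {k l : ℕ} {f : Hist k × Hist k → E} {g : Hist l × Hist l → F} {C : ℝ}
    (hC : 0 ≤ C)
    (h : (1 / 4) ^ k * ∑ h, ‖f h‖ ^ 2 ≤ C ^ 2 * ((1 / 4) ^ l * ∑ h, ‖g h‖ ^ 2)) :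
    wnorm f ≤ C * wnorm g := by
  rw [← wnorm_sq, ← wnorm_sq, ← mul_pow] at h
  exact le_of_sq_le_sq h (mul_nonneg hC (wnorm_nonneg _))

theorem wnorm_le_mul {k : ℕ} {f : Hist k × Hist k → E} {g : Hist k × Hist k → F} {C : ℝ}
    (hC : 0 ≤ C) (h : ∀ h, ‖f h‖ ≤ C * ‖g h‖) : wnorm f ≤ C * wnorm g := by
  refine wnorm_le_of_sum_le hC ?_
  rw [mul_left_comm, Finset.mul_sum Finset.univ _ (C ^ 2)]
  gcongr with x
  rw [← mul_pow]
  gcongr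
  exact h x

theorem wnorm_mono {k : ℕ} {f : Hist k × Hist k → E} {g : Hist k × Hist k → F}
    (h : ∀ h, ‖f h‖ ≤ ‖g h‖) : wnorm f ≤ wnorm g := by
  simpa using wnorm_le_mul zero_le_one (f := f) (g := g) (by simpa using h)

/-- The form used in all inductions over games: one more game contributes a factor `1/4` for its
pair of questions, so the sum over its sixteen outcomes may be as large as `4 C²`. -/
theorem wnorm_succ_le {k : ℕ} {f : Hist (k + 1) × Hist (k + 1) → E} {g : Hist k × Hist k → F}
    {C : ℝ} (hC : 0 ≤ C)
    (h : ∀ h : Hist k × Hist k, ∑ z, ∑ w, ‖f (Fin.snoc (α := fun _ => Fin 2 × Fin 2) h.1 z,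
      Fin.snoc (α := fun _ => Fin 2 × Fin 2) h.2 w)‖ ^ 2 ≤ 4 * C ^ 2 * ‖g h‖ ^ 2) :
    wnorm f ≤ C * wnorm g := by
  refine wnorm_le_of_sum_le hC ?_
  rw [sum_histPair_succ, pow_succ, mul_left_comm (C ^ 2), mul_assoc]
  refine mul_le_mul_of_nonneg_left ?_ (by positivity)
  rw [Finset.mul_sum, Finset.mul_sum]
  exact Finset.sum_le_sum fun x _ => by linarith [h x]

end WeightedNorm

/-! ### Families of qubits -/

/-- One-qubit operators for the games of one player, acting on `K`.  The qubit for game `j` depends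
on the player's transcript of the previous games, and qubits along one transcript are
independent. -/
structure QubitFamily (n : ℕ) (K : Type*) [NormedAddCommGroup K] [InnerProductSpace ℂ K] where
  op (j : Fin n) (h : Hist j) : Matrix (Fin 2) (Fin 2) ℂ →ₐ[ℂ] Module.End ℂ K
  inner_op : ∀ j h M x y, ⟪op j h M x, y⟫_ℂ = ⟪x, op j h M.conjTranspose y⟫_ℂ
  commute_op : ∀ (i j : Fin n) (hij : i < j) (h : Hist j) M N,
    Commute (op j h M) (op i (fun x => h (Fin.castLE hij.le x)) N)

namespace QubitFamily

variable {n : ℕ} {K : Type*} [NormedAddCommGroup K] [InnerProductSpace ℂ K]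

section Single

variable (F : QubitFamily n K) (j : Fin n) (h : Hist j)

theorem norm_op_sq (M : Matrix (Fin 2) (Fin 2) ℂ) (v : K) :
    ((‖F.op j h M v‖ ^ 2 : ℝ) : ℂ) = ⟪v, F.op j h (M.conjTranspose * M) v⟫_ℂ := by
  rw [map_mul, Module.End.mul_apply, ← F.inner_op, inner_self_eq_norm_sq_to_K]
  simp

theorem norm_op_of_isometry {M : Matrix (Fin 2) (Fin 2) ℂ} (hM : M.conjTranspose * M = 1)
    (v : K) : ‖F.op j h M v‖ = ‖v‖ := by
  have := F.norm_op_sq j h M v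
  rw [hM, map_one, Module.End.one_apply, inner_self_eq_norm_sq_to_K] at this
  have h2 : ‖F.op j h M v‖ ^ 2 = ‖v‖ ^ 2 := by
    rw [← Complex.ofReal_inj, this]; simp
  exact (sq_eq_sq₀ (norm_nonneg _) (norm_nonneg _)).mp h2

theorem norm_op_sq_eq_of_eq {M N : Matrix (Fin 2) (Fin 2) ℂ}
    (hMN : M.conjTranspose * M = N.conjTranspose * N) (v : K) :
    ‖F.op j h M v‖ ^ 2 = ‖F.op j h N v‖ ^ 2 := by
  rw [← Complex.ofReal_inj, norm_op_sq, norm_op_sq, hMN]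

theorem sum_norm_op_sq {ι : Type*} [Fintype ι] {M : ι → Matrix (Fin 2) (Fin 2) ℂ}
    (hM : ∑ i, (M i).conjTranspose * M i = 1) (v : K) :
    ∑ i, ‖F.op j h (M i) v‖ ^ 2 = ‖v‖ ^ 2 := by
  rw [← Complex.ofReal_inj, Complex.ofReal_sum]
  simp only [norm_op_sq]
  rw [← inner_sum, ← LinearMap.sum_apply, ← map_sum, hM, map_one, Module.End.one_apply,
    inner_self_eq_norm_sq_to_K]
  simp

theorem sum_norm_op_measA_sq (a : Fin 2) (v : K) :
    ∑ x, ‖F.op j h (measA (a, x)) v‖ ^ 2 = ‖v‖ ^ 2 :=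
  F.sum_norm_op_sq j h (by simp only [conjTranspose_measA, measA_mul_self, sum_measA]) v

theorem sum_norm_op_measA_sq_prod (v : K) :
    ∑ z, ‖F.op j h (measA z) v‖ ^ 2 = 2 * ‖v‖ ^ 2 := by
  rw [Fintype.sum_prod_type]
  simp only [sum_norm_op_measA_sq]
  simp

theorem norm_op_measA_le (z : Fin 2 × Fin 2) (v : K) : ‖F.op j h (measA z) v‖ ≤ ‖v‖ := by
  refine le_of_sq_le_sq ?_ (norm_nonneg _)
  rw [← F.sum_norm_op_measA_sq j h z.1 v]
  exact Finset.single_le_sum (f := fun x => ‖F.op j h (measA (z.1, x)) v‖ ^ 2)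
    (fun _ _ => by positivity) (Finset.mem_univ z.2)

theorem norm_op_transfer_le (z w : Fin 2 × Fin 2) (v : K) :
    ‖F.op j h (transferMatrix z w) v‖ ≤ ‖v‖ := by
  refine le_of_sq_le_sq ?_ (norm_nonneg _)
  rw [F.norm_op_sq_eq_of_eq j h (N := measB w) (by
      rw [conjTranspose_transferMatrix_mul_self, conjTranspose_measB, measB_mul_self]),
    ← F.sum_norm_op_sq j h (M := fun y => measB (w.1, y))
      (by simp only [conjTranspose_measB, measB_mul_self, sum_measB]) v]
  exact Finset.single_le_sum (f := fun x => ‖F.op j h (measB (w.1, x)) v‖ ^ 2)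
    (fun _ _ => by positivity) (Finset.mem_univ w.2)

theorem norm_op_idealA (a : Fin 2) (v : K) : ‖F.op j h (idealA a) v‖ = ‖v‖ :=
  F.norm_op_of_isometry j h (by rw [conjTranspose_idealA, idealA_mul_self]) v

theorem norm_op_basisChange (a a' d : Fin 2) (v : K) :
    ‖F.op j h (basisChange a a' d) v‖ = ‖v‖ :=
  F.norm_op_of_isometry j h (conjTranspose_basisChange_mul_self a a' d) v

end Single

/-- The product of one-qubit operators along the transcript `h`, the first game's rightmost; the
operator for each game is `M` evaluated at the entries of `g` and `h` for this game. -/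
def chain (F : QubitFamily n K)
    (M : Fin 2 × Fin 2 → Fin 2 × Fin 2 → Matrix (Fin 2) (Fin 2) ℂ) :
    {k : ℕ} → k ≤ n → Hist k → Hist k → Module.End ℂ K
  | 0, _, _, _ => 1
  | k + 1, hk, g, h =>
    F.op ⟨k, hk⟩ (Fin.init h) (M (g (Fin.last k)) (h (Fin.last k))) *
      F.chain M (Nat.le_of_succ_le hk) (Fin.init g) (Fin.init h)

/-- The part of such a product that belongs to the games from game `J` on. -/
def chainFrom (F : QubitFamily n K)
    (M : Fin 2 × Fin 2 → Fin 2 × Fin 2 → Matrix (Fin 2) (Fin 2) ℂ) {J : ℕ} :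
    {m : ℕ} → J + m ≤ n → Hist (J + m) → Hist (J + m) → Module.End ℂ K
  | 0, _, _, _ => 1
  | m + 1, hm, g, h =>
    F.op ⟨J + m, hm⟩ (Fin.init h) (M (g (Fin.last (J + m))) (h (Fin.last (J + m)))) *
      F.chainFrom M (Nat.le_of_succ_le hm) (Fin.init g) (Fin.init h)

theorem commute_op_chain_castLE (F : QubitFamily n K)
    (M : Fin 2 × Fin 2 → Fin 2 × Fin 2 → Matrix (Fin 2) (Fin 2) ℂ) (j : Fin n) (h : Hist j)
    (N : Matrix (Fin 2) (Fin 2) ℂ) {k : ℕ} (hk : k ≤ n) (hkj : k ≤ j) (g : Hist k) :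
    Commute (F.op j h N) (F.chain M hk g (fun x => h (Fin.castLE hkj x))) := by
  induction k with
  | zero => exact Commute.one_right _
  | succ k ih =>
    exact (F.commute_op ⟨k, hk⟩ j hkj h _ _).mul_right
      (ih (Nat.le_of_succ_le hk) (Nat.le_of_succ_le hkj) (Fin.init g))

theorem commute_op_chain (F : QubitFamily n K)
    (M : Fin 2 × Fin 2 → Fin 2 × Fin 2 → Matrix (Fin 2) (Fin 2) ℂ) {k : ℕ} (hk : k < n)
    (h : Hist k) (N : Matrix (Fin 2) (Fin 2) ℂ) (g : Hist k) :
    Commute (F.op ⟨k, hk⟩ h N) (F.chain M hk.le g h) :=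
  F.commute_op_chain_castLE M ⟨k, hk⟩ h N hk.le le_rfl g

/-- Along a single transcript, the qubit for game `j` is disjoint from those of all later games.
Only this transcript-wise independence is available, hence the restriction of `h`. -/
theorem commute_op_chainFrom (F : QubitFamily n K)
    (M : Fin 2 × Fin 2 → Fin 2 × Fin 2 → Matrix (Fin 2) (Fin 2) ℂ) (j : Fin n) {J m : ℕ}
    (hJ : (j : ℕ) < J) (hm : J + m ≤ n) (N : Matrix (Fin 2) (Fin 2) ℂ) (g h : Hist (J + m)) :
    Commute (F.op j (fun x => h (Fin.castLE (by omega) x)) N) (F.chainFrom M hm g h) := by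
  induction m with
  | zero => exact Commute.one_right _
  | succ m ih =>
    have hlt : j < (⟨J + m, hm⟩ : Fin n) := by
      rw [Fin.lt_def]; simp only; omega
    exact (F.commute_op j ⟨J + m, hm⟩ hlt (Fin.init h) _ _).symm.mul_right
      (ih (Nat.le_of_succ_le hm) (Fin.init g) (Fin.init h))

theorem commute_chain_of_commute (B : QubitFamily n K) (X : Module.End ℂ K)
    (M : Fin 2 × Fin 2 → Fin 2 × Fin 2 → Matrix (Fin 2) (Fin 2) ℂ)
    (hX : ∀ j h N, Commute X (B.op j h N)) {k : ℕ} (hk : k ≤ n) (g h : Hist k) :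
    Commute X (B.chain M hk g h) := by
  induction k with
  | zero => exact Commute.one_right _
  | succ k ih => exact (hX _ _ _).mul_right (ih _ _ _)

theorem commute_chainFrom_of_commute (B : QubitFamily n K) (X : Module.End ℂ K)
    (M : Fin 2 × Fin 2 → Fin 2 × Fin 2 → Matrix (Fin 2) (Fin 2) ℂ)
    (hX : ∀ j h N, Commute X (B.op j h N)) {J m : ℕ} (hm : J + m ≤ n) (g h : Hist (J + m)) :
    Commute X (B.chainFrom M hm g h) := by
  induction m with
  | zero => exact Commute.one_right _
  | succ k ih => exact (hX _ _ _).mul_right (ih _ _ _)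

/-- The factors commute, so each can be brought to the outermost position, where only its `M† M`
matters. They are then exchanged one at a time. -/
theorem norm_chain_transfer (F : QubitFamily n K) {k : ℕ} (hk : k ≤ n) (g h : Hist k) (v : K) :
    ‖F.chain transferMatrix hk g h v‖ = ‖F.chain (fun _ w => measB w) hk h h v‖ := by
  induction k generalizing v with
  | zero => rfl
  | succ k ih =>
    simp only [chain]
    have h1 := F.commute_op_chain transferMatrix hk (Fin.init h)
    have h2 := F.commute_op_chain (fun _ w => measB w) hk (Fin.init h)
    rw [(h2 _ _).eq, Module.End.mul_apply, Module.End.mul_apply, ← ih _ (Fin.init g),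
      ← Module.End.mul_apply (F.chain transferMatrix _ _ _), ← (h1 _ _).eq, Module.End.mul_apply]
    refine (sq_eq_sq₀ (norm_nonneg _) (norm_nonneg _)).mp (F.norm_op_sq_eq_of_eq _ _ ?_ _)
    rw [conjTranspose_transferMatrix_mul_self, conjTranspose_measB, measB_mul_self]

end QubitFamily

/-! ### Nearly perfectly correlated qubits, and Alice's states without Bob's measurements. -/

namespace QubitFamily

variable {n : ℕ} {K : Type*} [NormedAddCommGroup K] [InnerProductSpace ℂ K]

/-- The deviation from perfect correlation of two qubits in the state `v`: the vectors
`(R_a ⊗ 1 - 1 ⊗ R_a) v` for Alice's two ideal reflections `R_a`. -/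
def deviation (A B : QubitFamily n K) (j : Fin n) (g h : Hist j) :
    K →ₗ[ℂ] PiLp 2 (fun _ : Fin 2 => K) where
  toFun v := WithLp.toLp 2 fun a => A.op j g (idealA a) v - B.op j h (idealA a) v
  map_add' u v := by ext a; simp; abel
  map_smul' c v := by ext a; simp [smul_sub]

section Deviation

variable (A B : QubitFamily n K) (j : Fin n) (g h : Hist j)

theorem norm_deviation_sq (v : K) :
    ‖A.deviation B j g h v‖ ^ 2 =
      ∑ a, ‖A.op j g (idealA a) v - B.op j h (idealA a) v‖ ^ 2 := by
  rw [PiLp.norm_sq_eq_of_L2]; rfl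

theorem norm_deviation_le (v : K) : ‖A.deviation B j g h v‖ ≤ 3 * ‖v‖ := by
  refine le_of_sq_le_sq ?_ (by positivity)
  have h1 : ∀ a, ‖A.op j g (idealA a) v - B.op j h (idealA a) v‖ ^ 2 ≤ (2 * ‖v‖) ^ 2 := by
    intro a
    gcongr
    refine (norm_sub_le _ _).trans ?_
    rw [A.norm_op_idealA, B.norm_op_idealA]; linarith
  rw [norm_deviation_sq, Fin.sum_univ_two]
  nlinarith [h1 0, h1 1, sq_nonneg ‖v‖]

theorem norm_measA_sub (z : Fin 2 × Fin 2) (v : K) :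
    ‖A.op j g (measA z) v - B.op j h (measA z) v‖ =
      1 / 2 * ‖A.op j g (idealA z.1) v - B.op j h (idealA z.1) v‖ := by
  have e : A.op j g (measA z) v - B.op j h (measA z) v =
      (1 / 2 * (-1 : ℂ) ^ (z.2 : ℕ)) •
        (A.op j g (idealA z.1) v - B.op j h (idealA z.1) v) := by
    obtain ⟨a, x⟩ := z
    rw [measA_eq]
    simp only [map_smul, map_add, map_one, LinearMap.smul_apply, LinearMap.add_apply,
      Module.End.one_apply, smul_add, smul_sub, mul_smul]
    abel
  rw [e, norm_smul]
  simp

theorem sum_norm_measA_sub_sq (v : K) :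
    ∑ z, ‖A.op j g (measA z) v - B.op j h (measA z) v‖ ^ 2 =
      1 / 2 * ‖A.deviation B j g h v‖ ^ 2 := by
  simp only [norm_measA_sub, norm_deviation_sq, Fintype.sum_prod_type, mul_pow]
  simp
  ring

/-- Transferring a real matrix from one qubit to the other transposes it. -/
theorem norm_op_transpose_sub_le (hAB : ∀ M N, Commute (A.op j g M) (B.op j h N))
    {M : Matrix (Fin 2) (Fin 2) ℂ} (hM : ∀ i k, ‖M i k‖ ≤ 1) (v : K) :
    ‖A.op j g M.transpose v - B.op j h M v‖ ≤
      2 * (‖A.op j g (idealA 0) v - B.op j h (idealA 0) v‖ +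
        ‖A.op j g (idealA 1) v - B.op j h (idealA 1) v‖) := by
  set d0 := A.op j g (idealA 0) v - B.op j h (idealA 0) v with hd0
  set d1 := A.op j g (idealA 1) v - B.op j h (idealA 1) v with hd1
  have t0 : (idealA 0).transpose = idealA 0 := by
    rw [idealA_zero]; ext i k; fin_cases i <;> fin_cases k <;> rfl
  have t1 : (idealA 1).transpose = idealA 1 := by
    rw [idealA_one]; ext i k; fin_cases i <;> fin_cases k <;> rfl
  -- Moving a product across the pair one factor at a time reverses its order; this is the source of
  -- the transpose.
  have hprod : A.op j g (idealA 1 * idealA 0) v - B.op j h (idealA 0 * idealA 1) v =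
      A.op j g (idealA 1) d0 + B.op j h (idealA 0) d1 := by
    have hc := congrArg (fun T : Module.End ℂ K => T v) (hAB (idealA 1) (idealA 0)).eq
    simp only [Module.End.mul_apply] at hc
    simp only [hd0, hd1, map_mul, Module.End.mul_apply, map_sub, hc]
    abel
  have hsplit : A.op j g M.transpose v - B.op j h M v =
      ((M 0 0 - M 1 1) / 2) • d0 + ((M 0 1 + M 1 0) / 2) • d1 +
        ((M 0 1 - M 1 0) / 2) • (A.op j g (idealA 1) d0 + B.op j h (idealA 0) d1) := by
    conv_lhs => rw [matrix_eq_combination M]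
    rw [← hprod]
    simp only [Matrix.transpose_add, Matrix.transpose_smul, Matrix.transpose_mul, t0, t1,
      Matrix.transpose_one, map_add, map_smul, map_one, LinearMap.add_apply, LinearMap.smul_apply,
      Module.End.one_apply, smul_sub, hd0, hd1]
    abel
  have hhalf : ∀ a b : ℂ, ‖a‖ ≤ 1 → ‖b‖ ≤ 1 → ‖(a + b) / 2‖ ≤ 1 ∧ ‖(a - b) / 2‖ ≤ 1 := by
    intro a b ha hb
    have h1 := norm_add_le a b
    have h2 := norm_sub_le a b
    simp only [norm_div, Complex.norm_ofNat]
    constructor <;> linarith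
  have hsm : ∀ (c : ℂ) (x : K), ‖c‖ ≤ 1 → ‖c • x‖ ≤ ‖x‖ := by
    intro c x hc
    rw [norm_smul]
    exact mul_le_of_le_one_left (norm_nonneg _) hc
  rw [hsplit]
  refine (norm_add₃_le).trans ?_
  have b0 := hsm _ d0 (hhalf _ _ (hM 0 0) (hM 1 1)).2
  have b1 := hsm _ d1 (hhalf _ _ (hM 0 1) (hM 1 0)).1
  have b2 := hsm _ (A.op j g (idealA 1) d0 + B.op j h (idealA 0) d1)
    (hhalf _ _ (hM 0 1) (hM 1 0)).2
  have b3 := norm_add_le (A.op j g (idealA 1) d0) (B.op j h (idealA 0) d1)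
  rw [A.norm_op_idealA, B.norm_op_idealA] at b3
  linarith

/-- With `O` the basis change, `v - (O ⊗ O) v` is `O ⊗ 1` applied to `(Oᵀ ⊗ 1 - 1 ⊗ O) v`, and the
latter is small by the transposition rule. The constant comes from `(2 (s + t))² ≤ 8 (s² + t²)`. -/
theorem norm_sub_basisChange_sq_le (hAB : ∀ M N, Commute (A.op j g M) (B.op j h N))
    (a a' d : Fin 2) (v : K) :
    ‖v - A.op j g (basisChange a a' d) (B.op j h (basisChange a a' d) v)‖ ^ 2 ≤
      8 * ‖A.deviation B j g h v‖ ^ 2 := by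
  have e : v - A.op j g (basisChange a a' d) (B.op j h (basisChange a a' d) v) =
      A.op j g (basisChange a a' d)
        (A.op j g (basisChange a a' d).transpose v - B.op j h (basisChange a a' d) v) := by
    rw [map_sub, ← conjTranspose_basisChange, ← Module.End.mul_apply (A.op j g _) (A.op j g _) v,
      ← map_mul, basisChange_mul_conjTranspose_self, map_one, Module.End.one_apply]
  rw [e, A.norm_op_basisChange, norm_deviation_sq, Fin.sum_univ_two]
  have := A.norm_op_transpose_sub_le B j g h hAB (norm_basisChange_apply_le a a' d) v
  refine (pow_le_pow_left₀ (norm_nonneg _) this 2).trans ?_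
  nlinarith [sq_nonneg (‖A.op j g (idealA 0) v - B.op j h (idealA 0) v‖ -
        ‖A.op j g (idealA 1) v - B.op j h (idealA 1) v‖)]

end Deviation

/-- The unnormalized state after Alice alone has measured along her transcript `g`. -/
def measured (A : QubitFamily n K) (ψ : K) {k : ℕ} (hk : k ≤ n) (g : Hist k) : K :=
  A.chain (fun z _ => measA z) hk g g ψ

/-- The product of the overlaps of the measurement bases along a pair of transcripts. -/
def _root_.CHSH.overlapProd {k : ℕ} (g h : Hist k) : ℂ := ∏ i, overlap (g i) (h i)

theorem _root_.CHSH.overlapProd_succ {k : ℕ} (g h : Hist (k + 1)) :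
    overlapProd g h =
      overlap (g (Fin.last k)) (h (Fin.last k)) * overlapProd (Fin.init g) (Fin.init h) := by
  rw [overlapProd, Fin.prod_univ_castSucc, mul_comm]; rfl

theorem measured_succ (A : QubitFamily n K) (ψ : K) {k : ℕ} (hk : k + 1 ≤ n) (g : Hist (k + 1)) :
    A.measured ψ hk g = A.op ⟨k, hk⟩ (Fin.init g) (measA (g (Fin.last k)))
      (A.measured ψ (Nat.le_of_succ_le hk) (Fin.init g)) := rfl

/-- The state after both players have measured, with each of Bob's measured qubits moved to the
state in which Alice's measurement puts it. -/
def transferred (A B : QubitFamily n K) (ψ : K) {k : ℕ} (hk : k ≤ n) (g h : Hist k) : K :=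
  B.chain transferMatrix hk g h (A.measured ψ hk g)

theorem sum_norm_overlap_smul_sq (X : Fin 2 × Fin 2 → K) :
    ∑ z, ∑ w, ‖overlap z w • X z‖ ^ 2 = 2 * ∑ z, ‖X z‖ ^ 2 := by
  simp only [norm_smul, mul_pow, ← Finset.sum_mul, sum_norm_overlap_sq_prod, Finset.mul_sum]

section State

variable {A B : QubitFamily n K} (hAB : ∀ i g M j h N, Commute (A.op i g M) (B.op j h N)) {ψ : K}

include hAB

theorem commute_apply {i : Fin n} {g : Hist i} {M} {j : Fin n} {h : Hist j} {N} (v : K) :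
    A.op i g M (B.op j h N v) = B.op j h N (A.op i g M v) :=
  congrArg (fun T : Module.End ℂ K => T v) (hAB i g M j h N).eq

theorem transferred_succ {k : ℕ} (hk : k + 1 ≤ n) (g h : Hist (k + 1)) :
    A.transferred B ψ hk g h =
      B.op ⟨k, hk⟩ (Fin.init h) (transferMatrix (g (Fin.last k)) (h (Fin.last k)))
        (A.op ⟨k, hk⟩ (Fin.init g) (measA (g (Fin.last k)))
          (A.transferred B ψ (Nat.le_of_succ_le hk) (Fin.init g) (Fin.init h))) := by
  have hc := B.commute_chain_of_commute (A.op ⟨k, hk⟩ (Fin.init g) (measA (g (Fin.last k))))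
    transferMatrix (fun j h N => hAB _ _ _ j h N) (Nat.le_of_succ_le hk) (Fin.init g) (Fin.init h)
  simp only [transferred, measured_succ]
  rw [← Module.End.mul_apply (A.op _ _ _), hc.eq]
  rfl

/-- The operators measuring the deviation in game `k` commute with Bob's products over the earlier
games, so the exchange of projections for transfer operators does not affect its norm. -/
theorem norm_deviation_transferred {k : ℕ} (hk : k < n) (g h : Hist k) :
    ‖A.deviation B ⟨k, hk⟩ g h (A.transferred B ψ hk.le g h)‖ =
      ‖A.deviation B ⟨k, hk⟩ g h (B.chain (fun _ w => measB w) hk.le h h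
        (A.measured ψ hk.le g))‖ := by
  refine (sq_eq_sq₀ (norm_nonneg _) (norm_nonneg _)).mp ?_
  rw [norm_deviation_sq, norm_deviation_sq]
  have hcomm : ∀ (M : Fin 2 × Fin 2 → Fin 2 × Fin 2 → Matrix (Fin 2) (Fin 2) ℂ) (g' : Hist k)
      (N : Matrix (Fin 2) (Fin 2) ℂ) (v : K),
      A.op ⟨k, hk⟩ g N (B.chain M hk.le g' h v) - B.op ⟨k, hk⟩ h N (B.chain M hk.le g' h v) =
        B.chain M hk.le g' h (A.op ⟨k, hk⟩ g N v - B.op ⟨k, hk⟩ h N v) := by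
    intro M g' N v
    have h1 := B.commute_chain_of_commute (A.op ⟨k, hk⟩ g N) M (fun j h N => hAB _ _ _ j h N)
      hk.le g' h
    have h2 := B.commute_op_chain M hk h N g'
    rw [map_sub]
    congr 1
    · exact congrArg (fun T : Module.End ℂ K => T v) h1.eq
    · exact congrArg (fun T : Module.End ℂ K => T v) h2.eq
  refine Finset.sum_congr rfl fun a _ => ?_
  rw [transferred, hcomm, hcomm, norm_chain_transfer]

/-- After Alice's projection, Bob's qubit is in the state `|z⟩` up to an error `u`, and there the
transfer operator is exactly the scalar. What remains is the transfer operator and the scalar acting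
on `u`: at most `2 ‖u‖`, where `‖u‖` is at most half the deviation because `measA z` is `½ (1 ± R)`.
-/
theorem norm_transfer_sub_overlap_le (j : Fin n) (g h : Hist j) (z w : Fin 2 × Fin 2) (v : K) :
    ‖B.op j h (transferMatrix z w) (A.op j g (measA z) v) - overlap z w • A.op j g (measA z) v‖ ≤
      ‖A.op j g (idealA z.1) v - B.op j h (idealA z.1) v‖ := by
  set u := A.op j g (measA z) (A.op j g (measA z) v - B.op j h (measA z) v) with hu
  have hpp : A.op j g (measA z) (A.op j g (measA z) v) = A.op j g (measA z) v := by
    rw [← Module.End.mul_apply, ← map_mul, measA_mul_self]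
  have hu' : A.op j g (measA z) v = u + B.op j h (measA z) (A.op j g (measA z) v) := by
    rw [hu, map_sub, hpp, commute_apply hAB]; abel
  have htQ : B.op j h (transferMatrix z w) (B.op j h (measA z) (A.op j g (measA z) v)) =
      overlap z w • B.op j h (measA z) (A.op j g (measA z) v) := by
    rw [← Module.End.mul_apply, ← map_mul, transferMatrix_mul_measA, map_smul,
      LinearMap.smul_apply]
  have e : B.op j h (transferMatrix z w) (A.op j g (measA z) v) -
      overlap z w • A.op j g (measA z) v = B.op j h (transferMatrix z w) u - overlap z w • u := by
    conv_lhs => rw [hu', map_add, htQ, smul_add]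
    abel
  have b1 := norm_sub_le (B.op j h (transferMatrix z w) u) (overlap z w • u)
  have b2 := B.norm_op_transfer_le j h z w u
  have b3 : ‖overlap z w • u‖ ≤ ‖u‖ := by
    rw [norm_smul]
    exact mul_le_of_le_one_left (norm_nonneg _) (norm_overlap_le_one z w)
  have b4 := A.norm_op_measA_le j g z (A.op j g (measA z) v - B.op j h (measA z) v)
  rw [norm_measA_sub, ← hu] at b4
  rw [e]; linarith

/-- Each game adds one error of `norm_transfer_sub_overlap_le`. The inherited error does not grow:
the squared overlaps sum to 2 over `w`, Alice's projections contribute 2 when summed over `z`, and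
the product cancels the factor `1/4` in the weight. -/
theorem wnorm_transferred_sub_le {η : ℝ}
    (hη : ∀ k (hk : k < n), wnorm (fun h : Hist k × Hist k => A.deviation B ⟨k, hk⟩ h.1 h.2
      (A.transferred B ψ hk.le h.1 h.2)) ≤ η) {k : ℕ} (hk : k ≤ n) :
    wnorm (fun h : Hist k × Hist k => A.transferred B ψ hk h.1 h.2 -
      overlapProd h.1 h.2 • A.measured ψ hk h.1) ≤ k * (2 * η) := by
  induction k with
  | zero =>
    have : wnorm (fun h : Hist 0 × Hist 0 => A.transferred B ψ hk h.1 h.2 -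
      overlapProd h.1 h.2 • A.measured ψ hk h.1) ^ 2 = 0 := by
      rw [wnorm_sq]
      simp [transferred, measured, chain, overlapProd]
    rw [pow_eq_zero_iff two_ne_zero] at this
    rw [this]; simp
  | succ k ih =>
    have hk' : k < n := hk
    let w : Hist k × Hist k → K := fun h => A.transferred B ψ hk'.le h.1 h.2
    let x : Hist k × Hist k → K := fun h => overlapProd h.1 h.2 • A.measured ψ hk'.le h.1
    let p : Hist (k + 1) × Hist (k + 1) → K → K := fun h =>
      A.op ⟨k, hk⟩ (Fin.init h.1) (measA (h.1 (Fin.last k)))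
    let c : Hist (k + 1) × Hist (k + 1) → ℂ := fun h =>
      overlap (h.1 (Fin.last k)) (h.2 (Fin.last k))
    have e : (fun h : Hist (k + 1) × Hist (k + 1) => A.transferred B ψ hk h.1 h.2 -
      overlapProd h.1 h.2 • A.measured ψ hk h.1) = fun h =>
        (B.op ⟨k, hk⟩ (Fin.init h.2) (transferMatrix (h.1 (Fin.last k)) (h.2 (Fin.last k)))
          (p h (w (Fin.init h.1, Fin.init h.2))) - c h • p h (w (Fin.init h.1, Fin.init h.2))) +
        c h • p h (w (Fin.init h.1, Fin.init h.2) - x (Fin.init h.1, Fin.init h.2)) := by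
      funext h
      rw [transferred_succ hAB, measured_succ, overlapProd_succ]
      simp only [p, w, x, c, map_sub, map_smul, smul_sub, mul_smul]
      abel
    rw [e]
    refine (wnorm_add_le _ _).trans ?_
    have h1 : wnorm (fun h => B.op ⟨k, hk⟩ (Fin.init h.2)
          (transferMatrix (h.1 (Fin.last k)) (h.2 (Fin.last k)))
          (p h (w (Fin.init h.1, Fin.init h.2))) - c h • p h (w (Fin.init h.1, Fin.init h.2))) ≤
        2 * wnorm (fun h : Hist k × Hist k => A.deviation B ⟨k, hk⟩ h.1 h.2 (w h)) := by
      refine wnorm_succ_le (by norm_num) fun h => ?_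
      simp only [p, c, Fin.init_snoc, Fin.snoc_last]
      refine (Finset.sum_le_sum fun z _ => Finset.sum_le_sum fun w' _ =>
        pow_le_pow_left₀ (norm_nonneg _)
          (norm_transfer_sub_overlap_le hAB ⟨k, hk⟩ h.1 h.2 z w' (w h)) 2).trans ?_
      -- The summand depends on Alice's question alone, so it is counted `2 * 4 = 8` times, within
      -- the allowed `4 * 2²`.
      rw [norm_deviation_sq, Fintype.sum_prod_type]
      simp only [Finset.sum_const, Finset.card_univ, Fintype.card_prod, Fintype.card_fin,
        nsmul_eq_mul, ← Finset.mul_sum]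
      have : 0 ≤ ∑ a, ‖A.op ⟨k, hk⟩ h.1 (idealA a) (w h) -
        B.op ⟨k, hk⟩ h.2 (idealA a) (w h)‖ ^ 2 := Finset.sum_nonneg fun _ _ => by positivity
      push_cast
      nlinarith
    have h2 : wnorm (fun h => c h • p h (w (Fin.init h.1, Fin.init h.2) -
        x (Fin.init h.1, Fin.init h.2))) ≤ 1 * wnorm (fun h => w h - x h) := by
      refine wnorm_succ_le (by norm_num) fun h => ?_
      simp only [p, c, Fin.init_snoc, Fin.snoc_last]
      rw [sum_norm_overlap_smul_sq (fun z => A.op ⟨k, hk⟩ h.1 (measA z) (w h - x h)),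
        sum_norm_op_measA_sq_prod]
      exact le_of_eq (by ring)
    have h3 := ih hk'.le
    have h4 := hη k hk'
    push_cast
    simp only [w, x] at h1 h2
    linarith

/-- The deviation is linear with norm at most 3, so replacing the transferred state by the weighted
state of Alice costs `3 * k * 2η`. Together with `η` this is at most `7 n η`, since `k + 1 ≤ n`. -/
theorem wnorm_deviation_measured_le {η : ℝ}
    (hη : ∀ k (hk : k < n), wnorm (fun h : Hist k × Hist k => A.deviation B ⟨k, hk⟩ h.1 h.2
      (A.transferred B ψ hk.le h.1 h.2)) ≤ η) {k : ℕ} (hk : k < n) :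
    wnorm (fun h : Hist k × Hist k => A.deviation B ⟨k, hk⟩ h.1 h.2
      (overlapProd h.1 h.2 • A.measured ψ hk.le h.1)) ≤ 7 * n * η := by
  have e : (fun h : Hist k × Hist k => A.deviation B ⟨k, hk⟩ h.1 h.2
      (overlapProd h.1 h.2 • A.measured ψ hk.le h.1)) = fun h =>
      A.deviation B ⟨k, hk⟩ h.1 h.2 (A.transferred B ψ hk.le h.1 h.2) +
      -(A.deviation B ⟨k, hk⟩ h.1 h.2 (A.transferred B ψ hk.le h.1 h.2 -
        overlapProd h.1 h.2 • A.measured ψ hk.le h.1)) := by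
    funext h
    rw [map_sub]; abel
  rw [e]
  refine (wnorm_add_le _ _).trans ?_
  have h1 := hη k hk
  have h0 := (wnorm_nonneg _).trans h1
  have h2 : wnorm (fun h : Hist k × Hist k =>
      -(A.deviation B ⟨k, hk⟩ h.1 h.2 (A.transferred B ψ hk.le h.1 h.2 -
        overlapProd h.1 h.2 • A.measured ψ hk.le h.1))) ≤ 3 * (k * (2 * η)) := by
    refine (wnorm_le_mul (by norm_num) fun h => ?_).trans
      (mul_le_mul_of_nonneg_left (wnorm_transferred_sub_le hAB hη hk.le) (by norm_num))
    rw [norm_neg]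
    exact A.norm_deviation_le B _ _ _ _
  have h3 : (k : ℝ) + 1 ≤ n := by exact_mod_cast hk
  have h4 : 0 ≤ (n - (k + 1) : ℝ) * η := mul_nonneg (by linarith) h0
  have h5 : 0 ≤ (k : ℝ) * η := mul_nonneg (by positivity) h0
  nlinarith

end State

/-- Projecting Bob's qubits from game `J` on to the states of Alice's transcript preserves the
weighted norm. -/
theorem wnorm_chainFrom_le (B : QubitFamily n K) {J m : ℕ} (hm : J + m ≤ n)
    (x : Hist J × Hist J → K) :
    wnorm (fun h : Hist (J + m) × Hist (J + m) => overlapProd h.1 h.2 •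
      B.chainFrom (fun z _ => measA z) hm h.1 h.2
        (x (fun i => h.1 (Fin.castAdd m i), fun i => h.2 (Fin.castAdd m i)))) ≤
      wnorm (fun h => overlapProd h.1 h.2 • x h) := by
  induction m with
  | zero => exact le_rfl
  | succ m ih =>
    refine le_trans ?_ (ih (Nat.le_of_succ_le hm))
    refine (wnorm_succ_le (k := J + m) zero_le_one fun h => ?_).trans_eq (one_mul _)
    · let u := B.chainFrom (fun z _ => measA z) (Nat.le_of_succ_le hm) h.1 h.2
        (x (fun i => h.1 (Fin.castAdd m i), fun i => h.2 (Fin.castAdd m i)))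
      have e : ∀ z w : Fin 2 × Fin 2,
          B.chainFrom (m := m + 1) (fun z _ => measA z) hm
            (Fin.snoc (α := fun _ => Fin 2 × Fin 2) h.1 z)
            (Fin.snoc (α := fun _ => Fin 2 × Fin 2) h.2 w)
            (x (fun i => Fin.snoc (α := fun _ => Fin 2 × Fin 2) h.1 z (Fin.castAdd (m + 1) i),
              fun i => Fin.snoc (α := fun _ => Fin 2 × Fin 2) h.2 w (Fin.castAdd (m + 1) i))) =
          B.op ⟨J + m, hm⟩ h.2 (measA z) u := by
        intro z w
        have e1 : ∀ (g : Hist (J + m)) (z : Fin 2 × Fin 2),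
            (fun i : Fin J => Fin.snoc (α := fun _ => Fin 2 × Fin 2) g z
              (Fin.castAdd (m + 1) i)) = fun i => g (Fin.castAdd m i) := by
          intro g z
          funext i
          exact Fin.snoc_castSucc (α := fun _ => Fin 2 × Fin 2) (x := z) (p := g)
            (i := Fin.castAdd m i)
        rw [e1, e1, chainFrom]
        simp only [Fin.init_snoc]
        exact congrArg (fun z' => B.op ⟨J + m, hm⟩ h.2 (measA z') u)
          (Fin.snoc_last (α := fun _ => Fin 2 × Fin 2) z h.1)
      have e2 : ∀ z w : Fin 2 × Fin 2, overlapProd (k := J + m + 1)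
            (Fin.snoc (α := fun _ => Fin 2 × Fin 2) h.1 z)
            (Fin.snoc (α := fun _ => Fin 2 × Fin 2) h.2 w) = overlap z w * overlapProd h.1 h.2 := by
        intro z w
        rw [overlapProd_succ]
        simp only [Fin.init_snoc, Fin.snoc_last]
      calc _ = ∑ z, ∑ w, ‖overlap z w • B.op ⟨J + m, hm⟩ h.2 (measA z)
              (overlapProd h.1 h.2 • u)‖ ^ 2 := by
            refine Finset.sum_congr rfl fun z _ => Finset.sum_congr rfl fun w _ => ?_
            rw [map_smul, ← mul_smul, ← e2, ← e z w]
        _ ≤ _ := by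
            rw [sum_norm_overlap_smul_sq (fun z => B.op ⟨J + m, hm⟩ h.2 (measA z)
              (overlapProd h.1 h.2 • u)), sum_norm_op_measA_sq_prod]
            exact le_of_eq (by ring)

end QubitFamily

/-! ### Changing one entry of Alice's transcript. -/

theorem sum_update_le {ι X : Type*} [Fintype ι] [DecidableEq ι] [Fintype X] (i : ι) (z : X)
    (F : (ι → X) → ℝ) (hF : ∀ f, 0 ≤ F f) :
    ∑ f, F (Function.update f i z) ≤ Fintype.card X * ∑ f, F f := by
  rw [← (Equiv.funSplitAt i X).symm.sum_comp, ← (Equiv.funSplitAt i X).symm.sum_comp F,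
    Fintype.sum_prod_type, Fintype.sum_prod_type]
  have e : ∀ (y : X) (r : {j // j ≠ i} → X),
      Function.update ((Equiv.funSplitAt i X).symm (y, r)) i z =
        (Equiv.funSplitAt i X).symm (z, r) := by
    intro y r
    funext j
    by_cases hj : j = i
    · subst hj; simp [Equiv.funSplitAt, Equiv.piSplitAt]
    · simp [Equiv.funSplitAt, Equiv.piSplitAt, hj]
  simp only [e, Finset.sum_const, Finset.card_univ, nsmul_eq_mul]
  gcongr
  exact Finset.single_le_sum (f := fun y => ∑ r, F ((Equiv.funSplitAt i X).symm (y, r)))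
    (fun _ _ => Finset.sum_nonneg fun _ _ => hF _) (Finset.mem_univ z)

theorem norm_overlapProd_sq_le {k : ℕ} (g h : Hist k) (i : Fin k) (z : Fin 2 × Fin 2) :
    ‖overlapProd g h‖ ^ 2 ≤ 7 * ‖overlapProd (Function.update g i z) h‖ ^ 2 := by
  have e : ∏ l ∈ Finset.univ.erase i, overlap (Function.update g i z l) (h l) =
      ∏ l ∈ Finset.univ.erase i, overlap (g l) (h l) :=
    Finset.prod_congr rfl fun l hl => by
      rw [Function.update_of_ne (Finset.ne_of_mem_erase hl)]
  rw [overlapProd, overlapProd, ← Finset.mul_prod_erase _ _ (Finset.mem_univ i),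
    ← Finset.mul_prod_erase Finset.univ (fun l => overlap (Function.update g i z l) (h l))
      (Finset.mem_univ i), e, Function.update_self, norm_mul, norm_mul, mul_pow, mul_pow,
    ← mul_assoc]
  gcongr
  exact norm_overlap_sq_le _ _ _

/-- The weight changes by a factor of at most 7, and each updated transcript arises from four
originals; `7 * 4 = 28 ≤ 6²`. -/
theorem wnorm_update_le {E : Type*} [NormedAddCommGroup E] [NormedSpace ℂ E] {k : ℕ} (i : Fin k)
    (z : Fin 2 × Fin 2) (f : Hist k × Hist k → E) :
    wnorm (fun h => overlapProd h.1 h.2 • f (Function.update h.1 i z, h.2)) ≤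
      6 * wnorm (fun h => overlapProd h.1 h.2 • f h) := by
  refine wnorm_le_of_sum_le (by norm_num) ?_
  rw [mul_left_comm]
  refine mul_le_mul_of_nonneg_left ?_ (by positivity)
  simp only [norm_smul, mul_pow]
  rw [Fintype.sum_prod_type_right, Fintype.sum_prod_type_right, Finset.mul_sum]
  refine Finset.sum_le_sum fun y _ => ?_
  refine (Finset.sum_le_sum fun x _ => mul_le_mul_of_nonneg_right
    (norm_overlapProd_sq_le x y i z) (by positivity)).trans ?_
  have := sum_update_le i z (fun x : Hist k => ‖overlapProd x y‖ ^ 2 * ‖f (x, y)‖ ^ 2)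
    (fun _ => by positivity)
  simp only [mul_assoc, ← Finset.mul_sum]
  simp only [Fintype.card_prod, Fintype.card_fin] at this
  have h0 : 0 ≤ ∑ x, ‖overlapProd x y‖ ^ 2 * ‖f (x, y)‖ ^ 2 :=
    Finset.sum_nonneg fun _ _ => by positivity
  push_cast at this
  linarith

/-! ### Comparison of Alice's states along two transcripts. -/

namespace QubitFamily

variable {n : ℕ} {K : Type*} [NormedAddCommGroup K] [InnerProductSpace ℂ K]
  {A B : QubitFamily n K} {ψ : K}

/-- On a nearly perfectly correlated pair, Alice's projection for each game from `J` on can be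
applied to Bob's qubit instead. Each game costs at most one deviation `σ`, and applying Bob's
projection to the inherited error does not increase its weighted norm. -/
theorem wnorm_measured_sub_chainFrom_le {σ : ℝ}
    (hσ : ∀ k (hk : k < n), wnorm (fun h : Hist k × Hist k => A.deviation B ⟨k, hk⟩ h.1 h.2
      (overlapProd h.1 h.2 • A.measured ψ hk.le h.1)) ≤ σ) {J m : ℕ} (hm : J + m ≤ n) :
    wnorm (fun h : Hist (J + m) × Hist (J + m) => overlapProd h.1 h.2 • (A.measured ψ hm h.1 -
      B.chainFrom (fun z _ => measA z) hm h.1 h.2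
        (A.measured ψ (Nat.le_of_add_right_le hm) (fun i => h.1 (Fin.castAdd m i))))) ≤ m * σ := by
  induction m with
  | zero =>
    have : wnorm (fun h : Hist (J + 0) × Hist (J + 0) => overlapProd h.1 h.2 •
      (A.measured ψ hm h.1 - B.chainFrom (fun z _ => measA z) hm h.1 h.2
        (A.measured ψ (Nat.le_of_add_right_le hm) (fun i => h.1 (Fin.castAdd 0 i))))) ^ 2 = 0 := by
      rw [wnorm_sq]
      have : ∀ h : Hist (J + 0) × Hist (J + 0), A.measured ψ hm h.1 =
        B.chainFrom (fun z _ => measA z) hm h.1 h.2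
        (A.measured ψ (Nat.le_of_add_right_le hm) (fun i => h.1 (Fin.castAdd 0 i))) := fun h => rfl
      simp only [← this, sub_self, smul_zero, norm_zero]
      simp
    rw [pow_eq_zero_iff two_ne_zero] at this
    rw [this]; simp
  | succ m ih =>
    have hk : J + m < n := hm
    have hJ : J ≤ n := Nat.le_of_add_right_le hm
    let u : Hist (J + m) × Hist (J + m) → K := fun h => A.measured ψ hk.le h.1
    let q : Hist (J + m) × Hist (J + m) → K := fun h =>
      B.chainFrom (fun z _ => measA z) hk.le h.1 h.2
        (A.measured ψ hJ (fun i => h.1 (Fin.castAdd m i)))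
    have e : (fun h : Hist (J + (m + 1)) × Hist (J + (m + 1)) => overlapProd h.1 h.2 •
        (A.measured ψ hm h.1 - B.chainFrom (fun z _ => measA z) hm h.1 h.2
          (A.measured ψ hJ (fun i => h.1 (Fin.castAdd (m + 1) i))))) =
        fun h : Hist (J + m + 1) × Hist (J + m + 1) =>
        overlap (h.1 (Fin.last (J + m))) (h.2 (Fin.last (J + m))) •
          (A.op ⟨J + m, hk⟩ (Fin.init h.1) (measA (h.1 (Fin.last (J + m))))
            (overlapProd (Fin.init h.1) (Fin.init h.2) • u (Fin.init h.1, Fin.init h.2)) -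
          B.op ⟨J + m, hk⟩ (Fin.init h.2) (measA (h.1 (Fin.last (J + m))))
            (overlapProd (Fin.init h.1) (Fin.init h.2) • u (Fin.init h.1, Fin.init h.2))) +
        overlap (h.1 (Fin.last (J + m))) (h.2 (Fin.last (J + m))) •
          B.op ⟨J + m, hk⟩ (Fin.init h.2) (measA (h.1 (Fin.last (J + m))))
            (overlapProd (Fin.init h.1) (Fin.init h.2) •
              (u (Fin.init h.1, Fin.init h.2) - q (Fin.init h.1, Fin.init h.2))) := by
      funext h
      change overlapProd (k := J + m + 1) h.1 h.2 •
        (A.op ⟨J + m, hk⟩ (Fin.init h.1) (measA (h.1 (Fin.last (J + m))))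
          (u (Fin.init h.1, Fin.init h.2)) -
        B.op ⟨J + m, hk⟩ (Fin.init h.2) (measA (h.1 (Fin.last (J + m))))
          (q (Fin.init h.1, Fin.init h.2))) = _
      rw [overlapProd_succ]
      simp only [map_sub, map_smul, smul_sub, mul_smul]
      abel
    rw [e]
    refine (wnorm_add_le (k := J + m + 1) _ _).trans ?_
    have h1 : wnorm (fun h : Hist (J + m + 1) × Hist (J + m + 1) =>
        overlap (h.1 (Fin.last (J + m))) (h.2 (Fin.last (J + m))) •
          (A.op ⟨J + m, hk⟩ (Fin.init h.1) (measA (h.1 (Fin.last (J + m))))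
            (overlapProd (Fin.init h.1) (Fin.init h.2) • u (Fin.init h.1, Fin.init h.2)) -
          B.op ⟨J + m, hk⟩ (Fin.init h.2) (measA (h.1 (Fin.last (J + m))))
            (overlapProd (Fin.init h.1) (Fin.init h.2) • u (Fin.init h.1, Fin.init h.2)))) ≤
        1 * wnorm (fun h : Hist (J + m) × Hist (J + m) => A.deviation B ⟨J + m, hk⟩ h.1 h.2
          (overlapProd h.1 h.2 • u h)) := by
      refine wnorm_succ_le zero_le_one fun h => ?_
      simp only [Fin.init_snoc, Fin.snoc_last]
      rw [sum_norm_overlap_smul_sq (fun z => A.op ⟨J + m, hk⟩ h.1 (measA z)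
            (overlapProd h.1 h.2 • u h) - B.op ⟨J + m, hk⟩ h.2 (measA z)
            (overlapProd h.1 h.2 • u h)), sum_norm_measA_sub_sq]
      nlinarith [sq_nonneg ‖A.deviation B ⟨J + m, hk⟩ h.1 h.2 (overlapProd h.1 h.2 • u h)‖]
    have h2 : wnorm (fun h : Hist (J + m + 1) × Hist (J + m + 1) =>
        overlap (h.1 (Fin.last (J + m))) (h.2 (Fin.last (J + m))) •
          B.op ⟨J + m, hk⟩ (Fin.init h.2) (measA (h.1 (Fin.last (J + m))))
            (overlapProd (Fin.init h.1) (Fin.init h.2) •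
              (u (Fin.init h.1, Fin.init h.2) - q (Fin.init h.1, Fin.init h.2)))) ≤
        1 * wnorm (fun h => overlapProd h.1 h.2 • (u h - q h)) := by
      refine wnorm_succ_le zero_le_one fun h => ?_
      simp only [Fin.init_snoc, Fin.snoc_last]
      rw [sum_norm_overlap_smul_sq (fun z => B.op ⟨J + m, hk⟩ h.2 (measA z)
            (overlapProd h.1 h.2 • (u h - q h))), sum_norm_op_measA_sq_prod]
      exact le_of_eq (by ring)
    have h3 := ih hk.le
    have h4 := hσ (J + m) hk
    push_cast
    simp only [u, q] at h1 h2
    linarith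

/-- Before game `j` both transcripts lead to the same state `v`. The basis change intertwines the
two projections of game `j`, so the difference is Alice's projection applied to `v - (O ⊗ O) v`. The
constant: a factor 2 from the overlaps, four values of `z` and the factor 8 give `64 = 4 * 4²`. -/
theorem wnorm_measured_sub_basisChange_le
    (hAB : ∀ i g M j h N, Commute (A.op i g M) (B.op j h N)) {σ : ℝ}
    (hσ : ∀ k (hk : k < n), wnorm (fun h : Hist k × Hist k => A.deviation B ⟨k, hk⟩ h.1 h.2
      (overlapProd h.1 h.2 • A.measured ψ hk.le h.1)) ≤ σ) (j : Fin n) (z' : Fin 2 × Fin 2) :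
    wnorm (fun h : Hist ((j : ℕ) + 1) × Hist ((j : ℕ) + 1) => overlapProd h.1 h.2 •
      (A.measured ψ j.isLt h.1 -
        A.op j (Fin.init h.1) (basisChange z'.1 (h.1 (Fin.last j)).1 (z'.2 + (h.1 (Fin.last j)).2))
          (B.op j (Fin.init h.2)
            (basisChange z'.1 (h.1 (Fin.last j)).1 (z'.2 + (h.1 (Fin.last j)).2))
            (A.measured ψ j.isLt (Function.update h.1 (Fin.last (j : ℕ)) z'))))) ≤ 4 * σ := by
  refine le_trans ?_ (mul_le_mul_of_nonneg_left (hσ j j.isLt) (by norm_num))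
  refine wnorm_succ_le (by norm_num) fun h => ?_
  set v := A.measured ψ j.isLt.le h.1 with hv
  have e : ∀ z : Fin 2 × Fin 2,
      A.measured ψ j.isLt (Fin.snoc (α := fun _ => Fin 2 × Fin 2) h.1 z) -
        A.op j h.1 (basisChange z'.1 z.1 (z'.2 + z.2)) (B.op j h.2
          (basisChange z'.1 z.1 (z'.2 + z.2)) (A.measured ψ j.isLt
            (Function.update (Fin.snoc (α := fun _ => Fin 2 × Fin 2) h.1 z)
              (Fin.last (j : ℕ)) z'))) =
      A.op j h.1 (measA z) (v - A.op j h.1 (basisChange z'.1 z.1 (z'.2 + z.2)) (B.op j h.2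
          (basisChange z'.1 z.1 (z'.2 + z.2)) v)) := by
    intro z
    rw [measured_succ, measured_succ, Fin.update_snoc_last]
    simp only [Fin.init_snoc, Fin.snoc_last]
    rw [map_sub, ← Module.End.mul_apply (A.op j h.1 (measA z)), ← map_mul,
      ← basisChange_mul_measA, map_mul, Module.End.mul_apply,
      commute_apply hAB (M := measA (z'.1, z'.2))]
  simp only [overlapProd_succ, Fin.init_snoc, Fin.snoc_last, mul_smul, e]
  have e2 : ∀ z w : Fin 2 × Fin 2, overlap z w • overlapProd h.1 h.2 •
      A.op j h.1 (measA z) (v - A.op j h.1 (basisChange z'.1 z.1 (z'.2 + z.2)) (B.op j h.2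
          (basisChange z'.1 z.1 (z'.2 + z.2)) v)) = overlap z w •
      A.op j h.1 (measA z) (overlapProd h.1 h.2 • v -
        A.op j h.1 (basisChange z'.1 z.1 (z'.2 + z.2)) (B.op j h.2
          (basisChange z'.1 z.1 (z'.2 + z.2)) (overlapProd h.1 h.2 • v))) := by
    intro z w
    simp only [map_sub, map_smul, smul_sub]
  simp only [e2]
  rw [sum_norm_overlap_smul_sq (fun z => A.op j h.1 (measA z) (overlapProd h.1 h.2 • v -
        A.op j h.1 (basisChange z'.1 z.1 (z'.2 + z.2)) (B.op j h.2
          (basisChange z'.1 z.1 (z'.2 + z.2)) (overlapProd h.1 h.2 • v))))]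
  have b : ∀ z : Fin 2 × Fin 2, ‖A.op j h.1 (measA z) (overlapProd h.1 h.2 • v -
        A.op j h.1 (basisChange z'.1 z.1 (z'.2 + z.2)) (B.op j h.2
          (basisChange z'.1 z.1 (z'.2 + z.2)) (overlapProd h.1 h.2 • v)))‖ ^ 2 ≤
      8 * ‖A.deviation B j h.1 h.2 (overlapProd h.1 h.2 • v)‖ ^ 2 := fun z =>
    (pow_le_pow_left₀ (norm_nonneg _) (A.norm_op_measA_le j h.1 z _) 2).trans
      (A.norm_sub_basisChange_sq_le B j h.1 h.2 (fun M N => hAB j h.1 M j h.2 N) _ _ _ _)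
  refine (mul_le_mul_of_nonneg_left (Finset.sum_le_sum fun z _ => b z) (by norm_num)).trans ?_
  simp only [Finset.sum_const, Finset.card_univ, Fintype.card_prod, Fintype.card_fin,
    nsmul_eq_mul]
  push_cast
  exact le_of_eq (by ring)

/-- Bob's qubits are located by `h`, and `g` supplies only the entries of the games from `J` on.
This insensitivity to an earlier entry of `g` is the reason for moving Alice's later measurements to
Bob. -/
theorem chainFrom_update (B : QubitFamily n K)
    (M : Fin 2 × Fin 2 → Fin 2 × Fin 2 → Matrix (Fin 2) (Fin 2) ℂ) {J m : ℕ} (hm : J + m ≤ n)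
    (g h : Hist (J + m)) (i : Fin J) (z : Fin 2 × Fin 2) :
    B.chainFrom M hm (Function.update g (Fin.castAdd m i) z) h = B.chainFrom M hm g h := by
  induction m with
  | zero => rfl
  | succ m ih =>
    have hne : (Fin.last (J + m)) ≠ (Fin.castAdd m i).castSucc := (Fin.castSucc_ne_last _).symm
    have h1 : Function.update g (Fin.castAdd (m + 1) i) z (Fin.last (J + m)) =
        g (Fin.last (J + m)) := Function.update_of_ne hne _ _
    have h2 : Fin.init (n := J + m) (α := fun _ => Fin 2 × Fin 2)
        (Function.update g (Fin.castAdd (m + 1) i) z) =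
        Function.update (Fin.init (n := J + m) (α := fun _ => Fin 2 × Fin 2) g)
          (Fin.castAdd m i) z :=
      Fin.init_update_castSucc (α := fun _ => Fin 2 × Fin 2) (q := g) (Fin.castAdd m i) z
    rw [chainFrom, chainFrom, h1, h2, ih]

/-- Alice's states after game `j + m`, for two transcripts that differ in game `j` alone, agree up
to the basis change on the qubits for game `j`. -/
theorem wnorm_measured_update_le
    (hAB : ∀ i g M j h N, Commute (A.op i g M) (B.op j h N)) {η : ℝ}
    (hη : ∀ k (hk : k < n), wnorm (fun h : Hist k × Hist k => A.deviation B ⟨k, hk⟩ h.1 h.2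
      (A.transferred B ψ hk.le h.1 h.2)) ≤ η) (j : Fin n) (z' : Fin 2 × Fin 2) {m : ℕ}
    (hm : (j : ℕ) + 1 + m ≤ n) :
    wnorm (fun h : Hist ((j : ℕ) + 1 + m) × Hist ((j : ℕ) + 1 + m) => overlapProd h.1 h.2 •
      (A.measured ψ hm h.1 -
        A.op j (fun x => h.1 (Fin.castLE (by omega) x))
          (basisChange z'.1 (h.1 (Fin.castAdd m (Fin.last j))).1
            (z'.2 + (h.1 (Fin.castAdd m (Fin.last j))).2))
          (B.op j (fun x => h.2 (Fin.castLE (by omega) x))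
            (basisChange z'.1 (h.1 (Fin.castAdd m (Fin.last j))).1
              (z'.2 + (h.1 (Fin.castAdd m (Fin.last j))).2))
            (A.measured ψ hm (Function.update h.1 (Fin.castAdd m (Fin.last (j : ℕ))) z'))))) ≤
      80 * n ^ 2 * η := by
  have hσ := fun k hk => wnorm_deviation_measured_le hAB hη (k := k) hk
  have hη0 : 0 ≤ η := (wnorm_nonneg _).trans (hη j j.isLt)
  have hn : (1 : ℝ) ≤ n := by exact_mod_cast (Nat.zero_lt_of_lt j.isLt)
  have hmn : (m : ℝ) ≤ n := by exact_mod_cast (by omega : m ≤ n)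
  let mat : Fin 2 × Fin 2 → Matrix (Fin 2) (Fin 2) ℂ := fun z => basisChange z'.1 z.1 (z'.2 + z.2)
  let V : Hist ((j : ℕ) + 1 + m) × Hist ((j : ℕ) + 1 + m) → Module.End ℂ K := fun h =>
    A.op j (fun x => h.1 (Fin.castLE (by omega) x)) (mat (h.1 (Fin.castAdd m (Fin.last j)))) *
    B.op j (fun x => h.2 (Fin.castLE (by omega) x)) (mat (h.1 (Fin.castAdd m (Fin.last j))))
  let Q : Hist ((j : ℕ) + 1 + m) × Hist ((j : ℕ) + 1 + m) → Module.End ℂ K := fun h =>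
    B.chainFrom (fun z _ => measA z) hm h.1 h.2
  let u : Hist ((j : ℕ) + 1 + m) → K := fun g => A.measured ψ hm g
  let r : Hist ((j : ℕ) + 1 + m) → K := fun g =>
    A.measured ψ j.isLt (fun i => g (Fin.castAdd m i))
  let upd : Hist ((j : ℕ) + 1 + m) → Hist ((j : ℕ) + 1 + m) := fun g =>
    Function.update g (Fin.castAdd m (Fin.last (j : ℕ))) z'
  have hV : ∀ h v, ‖V h v‖ = ‖v‖ := fun h v => by
    simp only [V, mat, Module.End.mul_apply, norm_op_basisChange]
  have hVQ : ∀ h, Commute (V h) (Q h) := fun h =>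
    Commute.mul_left
      (B.commute_chainFrom_of_commute _ _ (fun j h N => hAB _ _ _ j h N) hm h.1 h.2)
      (B.commute_op_chainFrom _ j (Nat.lt_succ_self _) hm _ h.1 h.2)
  have hQ : ∀ h : Hist ((j : ℕ) + 1 + m) × Hist ((j : ℕ) + 1 + m), Q (upd h.1, h.2) = Q h :=
    fun h => B.chainFrom_update _ hm h.1 h.2 (Fin.last j) z'
  change wnorm (fun h => overlapProd h.1 h.2 • (u h.1 - V h (u (upd h.1)))) ≤ _
  -- Three errors: moving the later measurements to Bob for `h.1`, the basis change at game `j`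
  -- underneath them, and moving the later measurements back to Alice for the updated transcript.
  -- `V` passes through `Q`, and `Q` is the same for both transcripts.
  have e : (fun h : Hist ((j : ℕ) + 1 + m) × Hist ((j : ℕ) + 1 + m) =>
      overlapProd h.1 h.2 • (u h.1 - V h (u (upd h.1)))) = fun h =>
      (overlapProd h.1 h.2 • (u h.1 - Q h (r h.1)) +
        overlapProd h.1 h.2 • Q h (r h.1 - V h (r (upd h.1)))) +
      overlapProd h.1 h.2 • -(V h (u (upd h.1) - Q (upd h.1, h.2) (r (upd h.1)))) := by
    funext h
    have hc : V h (Q h (r (upd h.1))) = Q h (V h (r (upd h.1))) :=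
      congrArg (fun T : Module.End ℂ K => T (r (upd h.1))) (hVQ h).eq
    rw [← smul_add, ← smul_add, hQ, map_sub, map_sub, hc]
    congr 1
    abel
  rw [e]
  refine (wnorm_add_le _ _).trans ((add_le_add_left (wnorm_add_le _ _) _).trans ?_)
  have h1 : wnorm (fun h : Hist ((j : ℕ) + 1 + m) × Hist ((j : ℕ) + 1 + m) =>
      overlapProd h.1 h.2 • (u h.1 - Q h (r h.1))) ≤ m * (7 * n * η) :=
    wnorm_measured_sub_chainFrom_le hσ hm
  have h2 : wnorm (fun h : Hist ((j : ℕ) + 1 + m) × Hist ((j : ℕ) + 1 + m) =>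
      overlapProd h.1 h.2 • Q h (r h.1 - V h (r (upd h.1)))) ≤ 4 * (7 * n * η) := by
    refine le_trans (le_of_eq ?_) ((B.wnorm_chainFrom_le hm _).trans
      (wnorm_measured_sub_basisChange_le hAB hσ j z'))
    congr 1
    funext h
    have hr : r (upd h.1) = A.measured ψ j.isLt
        (Function.update (fun i => h.1 (Fin.castAdd m i)) (Fin.last (j : ℕ)) z') := by
      simp only [r, upd]
      congr 1
      exact Function.update_comp_eq_of_injective h.1 (Fin.castAdd_injective _ m) _ z'
    rw [hr]
    rfl
  have h3 : wnorm (fun h : Hist ((j : ℕ) + 1 + m) × Hist ((j : ℕ) + 1 + m) =>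
      overlapProd h.1 h.2 • -(V h (u (upd h.1) - Q (upd h.1, h.2) (r (upd h.1))))) ≤
      6 * (m * (7 * n * η)) := by
    refine le_trans (wnorm_mono fun h => ?_) ((wnorm_update_le (Fin.castAdd m (Fin.last (j : ℕ))) z'
      (fun h : Hist ((j : ℕ) + 1 + m) × Hist ((j : ℕ) + 1 + m) => u h.1 - Q h (r h.1))).trans
      (mul_le_mul_of_nonneg_left h1 (by norm_num)))
    rw [norm_smul, norm_smul, norm_neg, hV]
  have h4 : (m : ℝ) * (7 * n * η) ≤ n * (7 * n * η) := by gcongr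
  have h5 : (n : ℝ) * η ≤ n * (n * η) := le_mul_of_one_le_left (by positivity) hn
  -- The three errors total `(7m + 28 + 42m) n η`, at most `77 n² η`.
  nlinarith

end QubitFamily

/-! ### Operators on the joint space. -/

section Joint

variable {HA HB HC : Type*}
  [NormedAddCommGroup HA] [InnerProductSpace ℂ HA]
  [NormedAddCommGroup HB] [InnerProductSpace ℂ HB]
  [NormedAddCommGroup HC] [InnerProductSpace ℂ HC]

theorem joint_mul (M M' : Module.End ℂ HA) (N N' : Module.End ℂ HB) :
    joint HC (M * M') (N * N') =
      (joint HC M N * joint HC M' N' : Module.End ℂ (JointSpace HA HB HC)) := by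
  have h := TensorProduct.map_comp (TensorProduct.map M N)
    (LinearMap.id (R := ℂ) (M := HC)) (TensorProduct.map M' N') LinearMap.id
  rw [← TensorProduct.map_comp, LinearMap.id_comp] at h
  exact h

theorem joint_one : joint HC (1 : Module.End ℂ HA) (1 : Module.End ℂ HB) =
    (1 : Module.End ℂ (JointSpace HA HB HC)) := by
  have h := TensorProduct.map_id (R := ℂ) (M := HA ⊗[ℂ] HB) (N := HC)
  rw [← TensorProduct.map_id (R := ℂ) (M := HA) (N := HB)] at h
  exact h

theorem joint_add_left (M M' : Module.End ℂ HA) (N : Module.End ℂ HB) :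
    joint HC (M + M') N = joint HC M N + joint HC M' N := by
  have h := TensorProduct.map_add_left (TensorProduct.map M N) (TensorProduct.map M' N)
    (LinearMap.id (R := ℂ) (M := HC))
  rw [← TensorProduct.map_add_left] at h
  exact h

theorem joint_add_right (M : Module.End ℂ HA) (N N' : Module.End ℂ HB) :
    joint HC M (N + N') = joint HC M N + joint HC M N' := by
  have h := TensorProduct.map_add_left (TensorProduct.map M N) (TensorProduct.map M N')
    (LinearMap.id (R := ℂ) (M := HC))
  rw [← TensorProduct.map_add_right] at h
  exact h

theorem joint_smul_left (c : ℂ) (M : Module.End ℂ HA) (N : Module.End ℂ HB) :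
    joint HC (c • M) N = c • joint HC M N := by
  have h := TensorProduct.map_smul_left c (TensorProduct.map M N)
    (LinearMap.id (R := ℂ) (M := HC))
  rw [← TensorProduct.map_smul_left] at h
  exact h

theorem joint_smul_right (c : ℂ) (M : Module.End ℂ HA) (N : Module.End ℂ HB) :
    joint HC M (c • N) = c • joint HC M N := by
  have h := TensorProduct.map_smul_left c (TensorProduct.map M N)
    (LinearMap.id (R := ℂ) (M := HC))
  rw [← TensorProduct.map_smul_right] at h
  exact h

/-- Tensor products of operators with formal adjoints have formal adjoints. -/
theorem inner_tensorMap {E F : Type*} [NormedAddCommGroup E] [InnerProductSpace ℂ E]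
    [NormedAddCommGroup F] [InnerProductSpace ℂ F] {M M' : E →ₗ[ℂ] E} {N N' : F →ₗ[ℂ] F}
    (hM : ∀ x y, ⟪M x, y⟫_ℂ = ⟪x, M' y⟫_ℂ) (hN : ∀ x y, ⟪N x, y⟫_ℂ = ⟪x, N' y⟫_ℂ)
    (x y : E ⊗[ℂ] F) :
    ⟪TensorProduct.map M N x, y⟫_ℂ = ⟪x, TensorProduct.map M' N' y⟫_ℂ := by
  induction x using TensorProduct.induction_on with
  | zero => simp
  | add x₁ x₂ h₁ h₂ => rw [map_add, inner_add_left, inner_add_left, h₁, h₂]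
  | tmul a b =>
    induction y using TensorProduct.induction_on with
    | zero => simp
    | add y₁ y₂ h₁ h₂ => rw [map_add, inner_add_right, inner_add_right, h₁, h₂]
    | tmul c d =>
      rw [TensorProduct.map_tmul, TensorProduct.map_tmul, TensorProduct.inner_tmul,
        TensorProduct.inner_tmul, hM, hN]

/-- Adjoints appear as pairs of maps with an identity of inner products, because no completeness or
finite dimension is assumed here. -/
theorem inner_joint {M M' : HA →ₗ[ℂ] HA} {N N' : HB →ₗ[ℂ] HB}
    (hM : ∀ x y, ⟪M x, y⟫_ℂ = ⟪x, M' y⟫_ℂ) (hN : ∀ x y, ⟪N x, y⟫_ℂ = ⟪x, N' y⟫_ℂ)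
    (x y : JointSpace HA HB HC) :
    ⟪joint HC M N x, y⟫_ℂ = ⟪x, joint HC M' N' y⟫_ℂ :=
  inner_tensorMap (inner_tensorMap hM hN) (fun _ _ => rfl) x y

end Joint

/-! ### One-qubit operators on several qubits. -/

section Qubits

variable {n : ℕ} {H : Type*} [NormedAddCommGroup H] [InnerProductSpace ℂ H]

theorem onQubit_apply (j : Fin n) (M : Matrix (Fin 2) (Fin 2) ℂ) (φ : QubitSpace (Fin n) H)
    (s : Fin n → Fin 2) :
    onQubit j M φ s = ∑ c : Fin 2, M (s j) c • φ (Function.update s j c) := rfl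

/-- The action of one-qubit operators on qubit `j`, as an algebra homomorphism. -/
def onQubitHom (n : ℕ) (H : Type*) [NormedAddCommGroup H] [InnerProductSpace ℂ H] (j : Fin n) :
    Matrix (Fin 2) (Fin 2) ℂ →ₐ[ℂ] Module.End ℂ (QubitSpace (Fin n) H) :=
  AlgHom.ofLinearMap
    { toFun := onQubit j
      map_add' := fun M N => by
        ext φ s
        simp [onQubit_apply, add_smul, Finset.sum_add_distrib]
      map_smul' := fun c M => by
        ext φ s
        simp [onQubit_apply, mul_smul] }
    (by
      ext φ s
      simp [onQubit_apply, Matrix.one_apply])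
    (fun M N => by
      ext φ s
      simp only [LinearMap.coe_mk, AddHom.coe_mk, Module.End.mul_apply, onQubit_apply,
        Function.update_self, Function.update_idem, Matrix.mul_apply, Finset.sum_smul,
        Finset.smul_sum, mul_smul]
      exact Finset.sum_comm)

theorem onQubitHom_apply (j : Fin n) (M : Matrix (Fin 2) (Fin 2) ℂ) :
    onQubitHom n H j M = onQubit j M := rfl

/-- Exchanging the old and the new bit at `i` permutes the pairs of strings that agree elsewhere.
This is the change of summation that gives the adjoint of a one-qubit operator. -/
theorem sum_update_funSplitAt {I M : Type*} [Fintype I] [DecidableEq I] [AddCommMonoid M] (i : I)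
    (f : (I → Fin 2) → (I → Fin 2) → M) :
    ∑ s, ∑ c, f s (Function.update s i c) = ∑ s, ∑ c, f (Function.update s i c) s := by
  have e : ∀ (b c : Fin 2) (r : {l // l ≠ i} → Fin 2),
      Function.update ((Equiv.funSplitAt i (Fin 2)).symm (b, r)) i c =
        (Equiv.funSplitAt i (Fin 2)).symm (c, r) := by
    intro b c r
    funext l
    by_cases hl : l = i
    · subst hl; simp [Equiv.funSplitAt, Equiv.piSplitAt]
    · simp [Equiv.funSplitAt, Equiv.piSplitAt, hl]
  rw [← (Equiv.funSplitAt i (Fin 2)).symm.sum_comp,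
    ← (Equiv.funSplitAt i (Fin 2)).symm.sum_comp (fun s => ∑ c, f (Function.update s i c) s),
    Fintype.sum_prod_type_right, Fintype.sum_prod_type_right]
  simp only [e]
  exact Finset.sum_congr rfl fun r _ => Finset.sum_comm

theorem inner_onQubit (j : Fin n) (M : Matrix (Fin 2) (Fin 2) ℂ)
    (φ χ : QubitSpace (Fin n) H) :
    ⟪onQubit j M φ, χ⟫_ℂ = ⟪φ, onQubit j M.conjTranspose χ⟫_ℂ := by
  simp only [PiLp.inner_apply, onQubit_apply, sum_inner, inner_sum, inner_smul_left,
    inner_smul_right]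
  have h := sum_update_funSplitAt j (fun s t : Fin n → Fin 2 =>
    (starRingEnd ℂ) (M (s j) (t j)) * ⟪φ t, χ s⟫_ℂ)
  simp only [Function.update_self] at h
  rw [h]
  rfl

theorem commute_onQubit {i j : Fin n} (hij : i ≠ j) (M N : Matrix (Fin 2) (Fin 2) ℂ)
    (φ : QubitSpace (Fin n) H) :
    onQubit j M (onQubit i N φ) = onQubit i N (onQubit j M φ) := by
  ext s
  simp only [onQubit_apply, Finset.smul_sum, Function.update_of_ne hij, Function.update_of_ne hij.symm]
  rw [Finset.sum_comm]
  refine Finset.sum_congr rfl fun c _ => Finset.sum_congr rfl fun d _ => ?_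
  rw [smul_comm, Function.update_comm hij]

theorem idTensor_apply {k : ℕ}
    (U : QubitSpace {i : Fin n // ¬ (i : ℕ) < k} H ≃ₗᵢ[ℂ] QubitSpace {i : Fin n // ¬ (i : ℕ) < k} H)
    (φ : QubitSpace (Fin n) H) (s : Fin n → Fin 2) :
    idTensor U φ s = U (WithLp.toLp 2 fun t => φ ((Equiv.piEquivPiSubtypeProd
      (fun i : Fin n => (i : ℕ) < k) (fun _ => Fin 2)).symm (fun i => s i, t))) (fun i => s i) := by
  simp only [idTensor, splitQubits, LinearIsometryEquiv.trans_apply, LinearIsometryEquiv.symm_trans]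
  simp [splitBits]
  rfl

/-- For fixed bits before `k`, the unitary acts linearly on the remaining tensor factor, while the
operator on qubit `i` only forms linear combinations over one of the fixed bits. -/
theorem idTensor_onQubit {k : ℕ}
    (U : QubitSpace {i : Fin n // ¬ (i : ℕ) < k} H ≃ₗᵢ[ℂ] QubitSpace {i : Fin n // ¬ (i : ℕ) < k} H)
    (i : Fin n) (hi : (i : ℕ) < k) (M : Matrix (Fin 2) (Fin 2) ℂ) (φ : QubitSpace (Fin n) H) :
    idTensor U (onQubit i M φ) = onQubit i M (idTensor U φ) := by
  ext s
  rw [onQubit_apply, idTensor_apply]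
  have e1 : ∀ t : {i : Fin n // ¬ (i : ℕ) < k} → Fin 2,
      (Equiv.piEquivPiSubtypeProd (fun i : Fin n => (i : ℕ) < k) (fun _ => Fin 2)).symm
        (fun i => s i, t) i = s i := by
    intro t
    simp [Equiv.piEquivPiSubtypeProd, hi]
  have e2 : ∀ (t : {i : Fin n // ¬ (i : ℕ) < k} → Fin 2) (c : Fin 2),
      Function.update ((Equiv.piEquivPiSubtypeProd (fun i : Fin n => (i : ℕ) < k)
        (fun _ => Fin 2)).symm (fun i => s i, t)) i c =
      (Equiv.piEquivPiSubtypeProd (fun i : Fin n => (i : ℕ) < k) (fun _ => Fin 2)).symm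
        (fun l => Function.update s i c l, t) := by
    intro t c
    funext l
    by_cases hl : l = i
    · subst hl; simp [Equiv.piEquivPiSubtypeProd, hi]
    · by_cases hlk : (l : ℕ) < k <;> simp [Equiv.piEquivPiSubtypeProd, hl, hlk]
  have e3 : ∀ c : Fin 2, (fun l : {i : Fin n // ¬ (i : ℕ) < k} => Function.update s i c l) =
      fun l : {i : Fin n // ¬ (i : ℕ) < k} => s l := by
    intro c
    funext l
    exact Function.update_of_ne (fun h => l.2 (by rw [h]; exact hi)) _ _
  have e4 : (WithLp.toLp 2 fun t => onQubit i M φ ((Equiv.piEquivPiSubtypeProd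
      (fun i : Fin n => (i : ℕ) < k) (fun _ => Fin 2)).symm (fun i => s i, t)) :
        QubitSpace {i : Fin n // ¬ (i : ℕ) < k} H) =
      ∑ c, M (s i) c • (WithLp.toLp 2 fun t => φ ((Equiv.piEquivPiSubtypeProd
      (fun i : Fin n => (i : ℕ) < k) (fun _ => Fin 2)).symm
        (fun l => Function.update s i c l, t))) := by
    ext t
    simp only [onQubit_apply, e1, e2]
    simp
  rw [e4, map_sum]
  simp only [map_smul, idTensor_apply, e3]
  simp

end Qubits

/-! ### The game qubits of one prover. -/

section Frame

variable {n : ℕ} {H H' : Type*} [NormedAddCommGroup H] [InnerProductSpace ℂ H]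
  [NormedAddCommGroup H'] [InnerProductSpace ℂ H']

theorem QubitFrame.step_onQubit (F : QubitFrame n H H') {k : ℕ} (h : Hist k) (i : Fin n)
    (hi : (i : ℕ) < k) (M : Matrix (Fin 2) (Fin 2) ℂ) (φ : QubitSpace (Fin n) H') :
    F.step h (onQubit i M φ) = onQubit i M (F.step h φ) := by
  rw [QubitFrame.step]
  split_ifs with hk
  · exact idTensor_onQubit _ i hi M φ
  · rfl

theorem QubitFrame.onGameQubit_apply (F : QubitFrame n H H') (j : Fin n) (h : Hist j)
    (M : Matrix (Fin 2) (Fin 2) ℂ) (x : H) :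
    F.onGameQubit j h M x = (F.frame h).symm (onQubit j M (F.frame h x)) := rfl

/-- The qubit for an earlier game along a transcript is in its place in the frame for a later
game. -/
theorem QubitFrame.frame_onGameQubit (F : QubitFrame n H H') (i : Fin n) {k : ℕ} (hik : i ≤ k)
    (h : Hist k) (M : Matrix (Fin 2) (Fin 2) ℂ) (x : H) :
    F.frame h (F.onGameQubit i (fun l => h (Fin.castLE hik l)) M x) =
      onQubit i M (F.frame h x) := by
  induction k with
  | zero =>
    obtain ⟨i, hi⟩ := i
    obtain rfl : i = 0 := by simpa using hik
    exact (F.frame h).apply_symm_apply _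
  | succ k ih =>
    by_cases hk : (i : ℕ) = k + 1
    · obtain ⟨i, hi⟩ := i
      obtain rfl : i = k + 1 := hk
      exact (F.frame h).apply_symm_apply _
    · have hlt : (i : ℕ) < k + 1 := lt_of_le_of_ne hik hk
      have := ih (Nat.le_of_lt_succ hlt) (Fin.init h)
      change F.step h (F.frame (Fin.init h) (F.onGameQubit i
        (fun l => Fin.init h (Fin.castLE (Nat.le_of_lt_succ hlt) l)) M x)) = _
      rw [this, F.step_onQubit h i hlt]
      rfl

/-- One prover's game qubits on the prover's own space. -/
def QubitFrame.family (F : QubitFrame n H H') : QubitFamily n H where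
  op j h := AlgHom.ofLinearMap
    { toFun := F.onGameQubit j h
      map_add' := fun M N => by
        ext x
        simp [QubitFrame.onGameQubit_apply, ← onQubitHom_apply]
      map_smul' := fun c M => by
        ext x
        simp [QubitFrame.onGameQubit_apply, ← onQubitHom_apply] }
    (by
      ext x
      simp [QubitFrame.onGameQubit_apply, ← onQubitHom_apply])
    (fun M N => by
      ext x
      simp [QubitFrame.onGameQubit_apply, ← onQubitHom_apply])
  inner_op j h M x y := by
    change ⟪(F.frame h).symm (onQubit j M (F.frame h x)), y⟫_ℂ =
      ⟪x, (F.frame h).symm (onQubit j M.conjTranspose (F.frame h y))⟫_ℂ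
    rw [← LinearIsometryEquiv.inner_map_map (F.frame h), LinearIsometryEquiv.apply_symm_apply,
      inner_onQubit, ← LinearIsometryEquiv.inner_map_map (F.frame h) x,
      LinearIsometryEquiv.apply_symm_apply]
  commute_op i j hij h M N := by
    refine LinearMap.ext fun x => (F.frame h).injective ?_
    have e1 : ∀ y, F.frame h (F.onGameQubit j h M y) = onQubit j M (F.frame h y) := fun y =>
      (F.frame h).apply_symm_apply _
    have e2 := F.frame_onGameQubit i hij.le h N
    change F.frame h (F.onGameQubit j h M (F.onGameQubit i _ N x)) =
      F.frame h (F.onGameQubit i _ N (F.onGameQubit j h M x))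
    rw [e1, e2, e2, e1, commute_onQubit hij.ne]

theorem QubitFrame.family_op (F : QubitFrame n H H') (j : Fin n) (h : Hist j)
    (M : Matrix (Fin 2) (Fin 2) ℂ) : F.family.op j h M = F.onGameQubit j h M := rfl

end Frame

/-! ### Alice's and Bob's qubits in the joint space. -/

section JointFamily

variable {n : ℕ} {HA HB : Type*} (HC : Type*)
  [NormedAddCommGroup HA] [InnerProductSpace ℂ HA]
  [NormedAddCommGroup HB] [InnerProductSpace ℂ HB]
  [NormedAddCommGroup HC] [InnerProductSpace ℂ HC]

/-- A family of qubits of Alice, acting on the joint space. -/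
def QubitFamily.onAlice (HB : Type*) [NormedAddCommGroup HB] [InnerProductSpace ℂ HB]
    (F : QubitFamily n HA) : QubitFamily n (JointSpace HA HB HC) where
  op j h := AlgHom.ofLinearMap
    { toFun := fun M => joint HC (F.op j h M) (1 : Module.End ℂ HB)
      map_add' := fun M N => by rw [map_add, joint_add_left]
      map_smul' := fun c M => by rw [map_smul, joint_smul_left]; rfl }
    (by simp only [LinearMap.coe_mk, AddHom.coe_mk, map_one, joint_one])
    (fun M N => by
      simp only [LinearMap.coe_mk, AddHom.coe_mk, map_mul]
      rw [← joint_mul, one_mul])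
  inner_op j h M := inner_joint (F.inner_op j h M) (fun _ _ => rfl)
  commute_op i j hij h M N := by
    change joint HC _ _ * joint HC _ _ = joint HC _ _ * joint HC _ _
    rw [← joint_mul, ← joint_mul, (F.commute_op i j hij h M N).eq]

/-- A family of qubits of Bob, acting on the joint space. -/
def QubitFamily.onBob (HA : Type*) [NormedAddCommGroup HA] [InnerProductSpace ℂ HA]
    (F : QubitFamily n HB) : QubitFamily n (JointSpace HA HB HC) where
  op j h := AlgHom.ofLinearMap
    { toFun := fun M => joint HC (1 : Module.End ℂ HA) (F.op j h M)
      map_add' := fun M N => by rw [map_add, joint_add_right]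
      map_smul' := fun c M => by rw [map_smul, joint_smul_right]; rfl }
    (by simp only [LinearMap.coe_mk, AddHom.coe_mk, map_one, joint_one])
    (fun M N => by
      simp only [LinearMap.coe_mk, AddHom.coe_mk, map_mul]
      rw [← joint_mul, one_mul])
  inner_op j h M := inner_joint (fun _ _ => rfl) (F.inner_op j h M)
  commute_op i j hij h M N := by
    change joint HC _ _ * joint HC _ _ = joint HC _ _ * joint HC _ _
    rw [← joint_mul, ← joint_mul, (F.commute_op i j hij h M N).eq]

variable {HC}

theorem QubitFamily.onAlice_op (F : QubitFamily n HA) (j : Fin n) (h : Hist j)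
    (M : Matrix (Fin 2) (Fin 2) ℂ) :
    (F.onAlice HC HB).op j h M = joint HC (F.op j h M) (1 : Module.End ℂ HB) := rfl

theorem QubitFamily.onBob_op (F : QubitFamily n HB) (j : Fin n) (h : Hist j)
    (M : Matrix (Fin 2) (Fin 2) ℂ) :
    (F.onBob HC HA).op j h M = joint HC (1 : Module.End ℂ HA) (F.op j h M) := rfl

theorem QubitFamily.commute_onAlice_onBob (F : QubitFamily n HA) (G : QubitFamily n HB)
    (i : Fin n) (g : Hist i) (M : Matrix (Fin 2) (Fin 2) ℂ) (j : Fin n) (h : Hist j)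
    (N : Matrix (Fin 2) (Fin 2) ℂ) :
    Commute ((F.onAlice HC HB).op i g M) ((G.onBob HC HA).op j h N) := by
  change joint HC _ _ * joint HC _ _ = joint HC _ _ * joint HC _ _
  rw [← joint_mul, ← joint_mul, one_mul, mul_one, mul_one, one_mul]

theorem QubitFamily.chain_onAlice (F : QubitFamily n HA)
    (M : Fin 2 × Fin 2 → Fin 2 × Fin 2 → Matrix (Fin 2) (Fin 2) ℂ) {k : ℕ} (hk : k ≤ n)
    (g h : Hist k) :
    (F.onAlice HC HB).chain M hk g h = joint HC (F.chain M hk g h) (1 : Module.End ℂ HB) := by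
  induction k with
  | zero => exact joint_one.symm
  | succ k ih =>
    simp only [QubitFamily.chain]
    rw [ih, QubitFamily.onAlice_op, ← joint_mul, one_mul]

theorem QubitFamily.chain_onBob (F : QubitFamily n HB)
    (M : Fin 2 × Fin 2 → Fin 2 × Fin 2 → Matrix (Fin 2) (Fin 2) ℂ) {k : ℕ} (hk : k ≤ n)
    (g h : Hist k) :
    (F.onBob HC HA).chain M hk g h = joint HC (1 : Module.End ℂ HA) (F.chain M hk g h) := by
  induction k with
  | zero => exact joint_one.symm
  | succ k ih =>
    simp only [QubitFamily.chain]
    rw [ih, QubitFamily.onBob_op, ← joint_mul, one_mul]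

end JointFamily

/-- `measured` takes its matrices from the first transcript, while Bob's products with `measB` take
them from the second, the one that locates the qubits. The two conventions agree on equal
transcripts. -/
theorem QubitFamily.chain_diagonal {n : ℕ} {K : Type*} [NormedAddCommGroup K]
    [InnerProductSpace ℂ K] (F : QubitFamily n K) (M : Fin 2 × Fin 2 → Matrix (Fin 2) (Fin 2) ℂ)
    {k : ℕ} (hk : k ≤ n) (h : Hist k) :
    F.chain (fun z _ => M z) hk h h = F.chain (fun _ w => M w) hk h h := by
  induction k with
  | zero => rfl
  | succ k ih => rw [QubitFamily.chain, QubitFamily.chain, ih]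

/-! ### Projections of an ideal prover as one-qubit operators. -/

section ProverFamily

variable {n : ℕ} {H H' : Type*} [NormedAddCommGroup H] [InnerProductSpace ℂ H]
  [NormedAddCommGroup H'] [InnerProductSpace ℂ H']

theorem Prover.proj_eq_op {P : Prover n H} {F : QubitFrame n H H'}
    {R : Fin 2 → Matrix (Fin 2) (Fin 2) ℂ} {M : Fin 2 × Fin 2 → Matrix (Fin 2) (Fin 2) ℂ}
    (hF : F.Realizes R P)
    (hM : ∀ a x, M (a, x) = (1 / 2 : ℂ) • (1 + (-1 : ℂ) ^ (x : ℕ) • R a))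
    {k : ℕ} (hk : k < n) (h : Hist (k + 1)) :
    P.proj h = F.family.op ⟨k, hk⟩ (Fin.init h) (M (h (Fin.last k))) := by
  rw [Prover.proj, dif_pos hk, hF, ← QubitFrame.family_op,
    ← Prod.mk.eta (p := h (Fin.last k)), hM, map_smul, map_add, map_one, map_smul]
  rfl

theorem Prover.prodProj_eq_chain {P : Prover n H} {F : QubitFrame n H H'}
    {R : Fin 2 → Matrix (Fin 2) (Fin 2) ℂ} {M : Fin 2 × Fin 2 → Matrix (Fin 2) (Fin 2) ℂ}
    (hF : F.Realizes R P)
    (hM : ∀ a x, M (a, x) = (1 / 2 : ℂ) • (1 + (-1 : ℂ) ^ (x : ℕ) • R a))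
    {k : ℕ} (hk : k ≤ n) (h : Hist k) :
    P.prodProj h = F.family.chain (fun z _ => M z) hk h h := by
  induction k with
  | zero => rfl
  | succ k ih =>
    rw [Prover.prodProj, P.proj_eq_op hF hM hk, ih (Nat.le_of_succ_le hk)]
    rfl

end ProverFamily

/-! ### Transcript probabilities, and correlation as deviation. -/

section Strategy

variable {n : ℕ} {HA HB HC HA' HB' : Type*}
  [NormedAddCommGroup HA] [InnerProductSpace ℂ HA]
  [NormedAddCommGroup HB] [InnerProductSpace ℂ HB]
  [NormedAddCommGroup HC] [InnerProductSpace ℂ HC]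
  [NormedAddCommGroup HA'] [InnerProductSpace ℂ HA']
  [NormedAddCommGroup HB'] [InnerProductSpace ℂ HB']

theorem norm_normalize_le {V : Type*} [NormedAddCommGroup V] [InnerProductSpace ℂ V] (v : V) :
    ‖normalize v‖ ≤ 1 := by
  rw [normalize, norm_smul, norm_inv, Complex.norm_real, norm_norm]
  exact inv_mul_le_one

theorem norm_smul_normalize {V : Type*} [NormedAddCommGroup V] [InnerProductSpace ℂ V] (v : V) :
    (‖v‖ : ℂ) • normalize v = v := by
  by_cases hv : v = 0
  · simp [hv, normalize]
  · rw [normalize, smul_smul, mul_inv_cancel₀, one_smul]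
    simpa using hv

/-- The unnormalized state after both provers have measured. -/
def Strategy.jointState (S : Strategy n HA HB HC) {k : ℕ} (h : Hist k × Hist k) :
    JointSpace HA HB HC :=
  joint HC (S.alice.prodProj h.1) (S.bob.prodProj h.2) S.state

theorem Strategy.jointState_succ (S : Strategy n HA HB HC) {k : ℕ}
    (h : Hist (k + 1) × Hist (k + 1)) :
    S.jointState h = joint HC (S.alice.proj h.1) (S.bob.proj h.2)
      (S.jointState (Fin.init h.1, Fin.init h.2)) := by
  rw [Strategy.jointState, Strategy.jointState, Prover.prodProj, Prover.prodProj]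
  exact congrArg (fun T : Module.End ℂ (JointSpace HA HB HC) => T S.state)
    (joint_mul (HC := HC) (S.alice.proj h.1) (S.alice.prodProj (Fin.init h.1)) (S.bob.proj h.2)
      (S.bob.prodProj (Fin.init h.2)))

/-- The normalizations telescope in the product of conditional probabilities. Transcripts of
probability zero fit in, because the zero vector is its own normalization. -/
theorem Strategy.histProb_eq (S : Strategy n HA HB HC) {k : ℕ} (h : Hist k × Hist k) :
    S.histProb h = (1 / 4) ^ k * ‖S.jointState h‖ ^ 2 := by
  induction k with
  | zero =>
    have : S.jointState h = S.state :=
      congrArg (fun T : Module.End ℂ (JointSpace HA HB HC) => T S.state) joint_one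
    rw [this, S.norm_state]
    simp [Strategy.histProb]
  | succ k ih =>
    have e : S.stateAt (Fin.init h.1, Fin.init h.2) =
      normalize (S.jointState (Fin.init h.1, Fin.init h.2)) := rfl
    rw [Strategy.histProb, ih, Strategy.answerProb, e, S.jointState_succ]
    conv_rhs => rw [← norm_smul_normalize (S.jointState (Fin.init h.1, Fin.init h.2)), map_smul,
      norm_smul, Complex.norm_real, norm_norm, mul_pow]
    ring

theorem Strategy.histProb_nonneg (S : Strategy n HA HB HC) {k : ℕ} (h : Hist k × Hist k) :
    0 ≤ S.histProb h := by
  rw [S.histProb_eq]; positivity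

theorem Strategy.prob_nonneg (S : Strategy n HA HB HC) {k : ℕ} (E : Hist k × Hist k → Prop) :
    0 ≤ S.prob E :=
  Finset.sum_nonneg fun h _ => by
    split_ifs
    · exact S.histProb_nonneg h
    · exact le_rfl

theorem Strategy.prob_add_prob_not (S : Strategy n HA HB HC) {k : ℕ}
    (E : Hist k × Hist k → Prop) :
    S.prob E + S.prob (fun h => ¬ E h) = ∑ h : Hist k × Hist k, S.histProb h := by
  classical
  rw [Strategy.prob, Strategy.prob, ← Finset.sum_add_distrib]
  refine Finset.sum_congr rfl fun h _ => ?_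
  by_cases hE : E h <;> simp [hE]

variable {S : Strategy n HA HB HC} {FA : QubitFrame n HA HA'} {FB : QubitFrame n HB HB'}

theorem Strategy.jointState_eq (hA : FA.Realizes idealA S.alice) (hB : FB.Realizes idealB S.bob)
    {k : ℕ} (hk : k ≤ n) (h : Hist k × Hist k) :
    S.jointState h = (FB.family.onBob HC HA).chain (fun _ w => measB w) hk h.2 h.2
      ((FA.family.onAlice HC HB).measured S.state hk h.1) := by
  rw [Strategy.jointState, S.alice.prodProj_eq_chain hA measA_eq hk, QubitFamily.measured,
    QubitFamily.chain_onBob, QubitFamily.chain_onAlice,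
    S.bob.prodProj_eq_chain hB measB_eq hk,
    FB.family.chain_diagonal measB hk h.2, ← Module.End.mul_apply, ← joint_mul,
    one_mul, mul_one]

theorem Strategy.joint_proj_eq (hA : FA.Realizes idealA S.alice) (hB : FB.Realizes idealB S.bob)
    {k : ℕ} (hk : k < n) (g h : Hist (k + 1)) :
    joint HC (S.alice.proj g) (S.bob.proj h) =
      (FA.family.onAlice HC HB).op ⟨k, hk⟩ (Fin.init g) (measA (g (Fin.last k))) *
      (FB.family.onBob HC HA).op ⟨k, hk⟩ (Fin.init h) (measB (h (Fin.last k))) := by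
  rw [S.alice.proj_eq_op hA measA_eq hk, S.bob.proj_eq_op hB measB_eq hk,
    QubitFamily.onAlice_op, QubitFamily.onBob_op, ← joint_mul, one_mul, mul_one]

/-- In each game, for fixed questions the projections of either player form a complete measurement;
the four pairs of questions cancel the factor `1/4`. -/
theorem Strategy.sum_histProb (hA : FA.Realizes idealA S.alice) (hB : FB.Realizes idealB S.bob)
    {k : ℕ} (hk : k ≤ n) : ∑ h : Hist k × Hist k, S.histProb h = 1 := by
  simp only [Strategy.histProb_eq]
  induction k with
  | zero =>
    have : ∀ h : Hist 0 × Hist 0, S.jointState h = S.state := fun h =>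
      congrArg (fun T : Module.End ℂ (JointSpace HA HB HC) => T S.state) joint_one
    simp [this, S.norm_state]
  | succ k ih =>
    have hk' : k < n := hk
    rw [sum_histPair_succ]
    refine Eq.trans ?_ (ih hk'.le)
    refine Finset.sum_congr rfl fun h _ => ?_
    simp only [Strategy.jointState_succ, S.joint_proj_eq hA hB hk', Fin.init_snoc, Fin.snoc_last,
      Module.End.mul_apply]
    rw [Finset.sum_comm]
    simp only [← Finset.mul_sum, QubitFamily.sum_norm_op_measA_sq_prod]
    rw [Fintype.sum_prod_type]
    have := fun b : Fin 2 => (FB.family.onBob HC HA).sum_norm_op_sq ⟨k, hk⟩ h.2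
      (M := fun y => measB (b, y)) (by simp only [conjTranspose_measB, measB_mul_self, sum_measB])
      (S.jointState (h.1, h.2))
    simp only [this]
    simp
    ring

/-- The correlation value of a game measures the deviation of the two qubits from perfect
correlation. -/
theorem Strategy.norm_deviation_stateAt_sq (hA : FA.Realizes idealA S.alice)
    (hB : FB.Realizes idealB S.bob) {k : ℕ} (hk : k < n) (h : Hist k × Hist k) :
    ‖(FA.family.onAlice HC HB).deviation (FB.family.onBob HC HA) ⟨k, hk⟩ h.1 h.2
      (S.stateAt h)‖ ^ 2 = 4 * ‖S.stateAt h‖ ^ 2 - Real.sqrt 2 * S.correlation h := by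
  set A := FA.family.onAlice HC HB with hAdef
  set B := FB.family.onBob HC HA with hBdef
  set φ := S.stateAt h with hφ
  set α : Matrix (Fin 2) (Fin 2) ℂ →ₐ[ℂ] Module.End ℂ (JointSpace HA HB HC) := A.op ⟨k, hk⟩ h.1
    with hα
  set β : Matrix (Fin 2) (Fin 2) ℂ →ₐ[ℂ] Module.End ℂ (JointSpace HA HB HC) := B.op ⟨k, hk⟩ h.2
    with hβ
  have hAB : ∀ M N, Commute (α M) (β N) := fun M N =>
    FA.family.commute_onAlice_onBob FB.family _ _ _ _ _ _
  have hans : ∀ a b x y : Fin 2, ((S.answerProb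
      (Fin.snoc (α := fun _ => Fin 2 × Fin 2) h.1 (a, x),
        Fin.snoc (α := fun _ => Fin 2 × Fin 2) h.2 (b, y)) : ℝ) : ℂ) =
      ⟪φ, α (measA (a, x)) (β (measB (b, y)) φ)⟫_ℂ := by
    intro a b x y
    rw [Strategy.answerProb, S.joint_proj_eq hA hB hk]
    simp only [Fin.init_snoc, Fin.snoc_last]
    change ((‖α (measA (a, x)) (β (measB (b, y)) φ)‖ ^ 2 : ℝ) : ℂ) = _
    rw [hα, A.norm_op_sq, conjTranspose_measA, measA_mul_self, B.inner_op, conjTranspose_measB]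
    congr 1
    have := congrArg (fun T : Module.End ℂ _ => T (β (measB (b, y)) φ))
      (hAB (measA (a, x)) (measB (b, y))).eq
    simp only [Module.End.mul_apply] at this
    rw [← hβ, ← hα, ← this, ← Module.End.mul_apply (β _), hβ, ← map_mul, measB_mul_self]
  -- With Bob's observables `(Z ± X)/√2`, the signed sum over `b` leaves `√2 Z` for `a = 0` and `√2
  -- X` for `a = 1`.
  have hcorr : ((S.correlation h : ℝ) : ℂ) = 2 * invSqrtTwo *
      (⟪φ, α (idealA 0) (β (idealA 0) φ)⟫_ℂ + ⟪φ, α (idealA 1) (β (idealA 1) φ)⟫_ℂ) := by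
    have hE : ∀ a b : Fin 2, ∑ x : Fin 2, ∑ y : Fin 2, (-1 : ℂ) ^ ((x : ℕ) + (y : ℕ)) *
        ⟪φ, α (measA (a, x)) (β (measB (b, y)) φ)⟫_ℂ = ⟪φ, α (idealA a) (β (idealB b) φ)⟫_ℂ := by
      intro a b
      rw [idealA_eq, idealB_eq, hα, hβ]
      simp only [Fin.sum_univ_two, map_sub, LinearMap.sub_apply, inner_sub_right]
      simp
      ring
    have hb : ∀ a b : Fin 2, ⟪φ, α (idealA a) (β (idealB b) φ)⟫_ℂ = invSqrtTwo *
        (⟪φ, α (idealA a) (β (idealA 0) φ)⟫_ℂ +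
          (-1) ^ (b : ℕ) * ⟪φ, α (idealA a) (β (idealA 1) φ)⟫_ℂ) := by
      intro a b
      rw [idealB_eq_smul, hα, hβ]
      simp only [map_add, map_smul, LinearMap.add_apply, LinearMap.smul_apply, inner_add_right,
        inner_smul_right]
    rw [Strategy.correlation]
    push_cast
    simp only [hans, hE, hb]
    simp only [Fin.sum_univ_two]
    simp
    ring
  have hdev : ∀ a, ‖α (idealA a) φ - β (idealA a) φ‖ ^ 2 =
      2 * ‖φ‖ ^ 2 - 2 * (⟪φ, α (idealA a) (β (idealA a) φ)⟫_ℂ).re := by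
    intro a
    rw [@norm_sub_sq ℂ, hα, A.inner_op, conjTranspose_idealA, A.norm_op_idealA, hβ,
      B.norm_op_idealA]
    simp only [RCLike.re_to_complex]
    ring
  have hre : Real.sqrt 2 * S.correlation h = 2 * (⟪φ, α (idealA 0) (β (idealA 0) φ)⟫_ℂ).re +
      2 * (⟪φ, α (idealA 1) (β (idealA 1) φ)⟫_ℂ).re := by
    have h1 := congrArg Complex.re hcorr
    have h2 : (2 * invSqrtTwo : ℂ) = ((2 * (Real.sqrt 2)⁻¹ : ℝ) : ℂ) := by
      rw [invSqrtTwo]; push_cast; rfl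
    rw [h2, Complex.re_ofReal_mul, Complex.ofReal_re, Complex.add_re] at h1
    rw [h1, ← mul_assoc, mul_left_comm, mul_inv_cancel₀ (by positivity)]
    ring
  rw [QubitFamily.norm_deviation_sq, Fin.sum_univ_two]
  change ‖α (idealA 0) φ - β (idealA 0) φ‖ ^ 2 + ‖α (idealA 1) φ - β (idealA 1) φ‖ ^ 2 = _
  rw [hdev, hdev, hre]
  ring

/-- The weighted square is the expectation, over transcripts, of the squared deviation in the
normalized state: small for structured games, bounded by an absolute constant for the others, which
have probability at most `δ`. -/
theorem Strategy.wnorm_deviation_le (hA : FA.Realizes idealA S.alice)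
    (hB : FB.Realizes idealB S.bob) {δ ε : ℝ} (hδ : 0 ≤ δ) (hε : 0 ≤ ε)
    (hS : S.Structured δ ε) {k : ℕ} (hk : k < n) :
    wnorm (fun h : Hist k × Hist k => (FA.family.onAlice HC HB).deviation
      (FB.family.onBob HC HA) ⟨k, hk⟩ h.1 h.2
      ((FA.family.onAlice HC HB).transferred (FB.family.onBob HC HA) S.state hk.le h.1 h.2)) ≤
      3 * Real.sqrt (δ + ε) := by
  refine le_of_sq_le_sq ?_ (by positivity)
  rw [wnorm_sq, mul_pow, Real.sq_sqrt (by positivity), Finset.mul_sum]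
  classical
  -- In a structured game the squared deviation is at most `4 - √2 (2√2 - ε) = √2 ε`, which is below
  -- `9 ε`; otherwise the crude bound `3² = 9` applies.
  have hterm : ∀ h : Hist k × Hist k, (1 / 4) ^ k * ‖(FA.family.onAlice HC HB).deviation
      (FB.family.onBob HC HA) ⟨k, hk⟩ h.1 h.2
      ((FA.family.onAlice HC HB).transferred (FB.family.onBob HC HA) S.state hk.le h.1 h.2)‖ ^ 2 ≤
      9 * (if ¬ S.GameStructured ε h then S.histProb h else 0) + 9 * ε * S.histProb h := by
    intro h
    have hst : S.stateAt h = normalize (S.jointState h) := rfl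
    rw [QubitFamily.norm_deviation_transferred (FA.family.commute_onAlice_onBob FB.family) hk,
      ← S.jointState_eq hA hB, ← norm_smul_normalize (S.jointState h), map_smul, norm_smul,
      Complex.norm_real, norm_norm, mul_pow, ← mul_assoc, ← S.histProb_eq, ← hst]
    have hp := S.histProb_nonneg h
    have hn : ‖S.stateAt h‖ ≤ 1 := norm_normalize_le _
    by_cases hG : S.GameStructured ε h
    · rw [S.norm_deviation_stateAt_sq hA hB hk, if_neg (not_not.mpr hG)]
      have hG' : 2 * Real.sqrt 2 - ε ≤ S.correlation h := hG
      have h2 : Real.sqrt 2 * Real.sqrt 2 = 2 := Real.mul_self_sqrt (by norm_num)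
      have h3 : Real.sqrt 2 ≤ 2 := by nlinarith [Real.sqrt_nonneg 2]
      have h4 : ‖S.stateAt h‖ ^ 2 ≤ 1 := pow_le_one₀ (norm_nonneg _) hn
      have h5 := mul_le_mul_of_nonneg_left hG' (Real.sqrt_nonneg 2)
      have h6 : 4 * ‖S.stateAt h‖ ^ 2 - Real.sqrt 2 * S.correlation h ≤ 9 * ε := by nlinarith
      nlinarith [mul_le_mul_of_nonneg_left h6 hp]
    · rw [if_pos hG]
      have h1 := (FA.family.onAlice HC HB).norm_deviation_le (FB.family.onBob HC HA) ⟨k, hk⟩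
        h.1 h.2 (S.stateAt h)
      have h2 := pow_le_pow_left₀ (norm_nonneg _) (h1.trans
        (mul_le_mul_of_nonneg_left hn (by norm_num))) 2
      have h3 := mul_le_mul_of_nonneg_left h2 hp
      have h4 : 0 ≤ ε * S.histProb h := mul_nonneg hε hp
      linarith
  refine (Finset.sum_le_sum fun h _ => hterm h).trans ?_
  rw [Finset.sum_add_distrib, ← Finset.mul_sum, ← Finset.mul_sum, S.sum_histProb hA hB hk.le]
  have h1 := S.prob_add_prob_not (fun h : Hist k × Hist k => S.GameStructured ε h)
  rw [S.sum_histProb hA hB hk.le] at h1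
  have h2 : 1 - δ ≤ S.prob (fun h : Hist k × Hist k => S.GameStructured ε h) := hS ⟨k, hk⟩
  have h3 : S.prob (fun h : Hist k × Hist k => ¬ S.GameStructured ε h) =
      ∑ h : Hist k × Hist k, if ¬ S.GameStructured ε h then S.histProb h else 0 := by
    rw [Strategy.prob]
    exact Finset.sum_congr rfl fun h _ => by congr
  rw [← h3]
  linarith

end Strategy

/-! ### Trace-norm estimates for ensembles of pure states. -/

section TraceNorm

variable {V : Type*} [NormedAddCommGroup V] [InnerProductSpace ℂ V]

theorem density_apply (v x : V) : density v x = ⟪v, x⟫_ℂ • v := rfl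

theorem comp_density_comp {P P' : V →ₗ[ℂ] V} (h : ∀ x y, ⟪P x, y⟫_ℂ = ⟪x, P' y⟫_ℂ) (v : V) :
    P ∘ₗ density v ∘ₗ P' = density (P v) := by
  ext x
  simp only [LinearMap.comp_apply, density_apply, map_smul, h]

/-- Bessel's inequality for one component of an orthonormal family in a direct sum. -/
theorem sum_norm_inner_component_sq_le {K : Type*} [Fintype K] {r : ℕ}
    {e : Fin r → PiLp 2 (fun _ : K => V)} (he : Orthonormal ℂ e) (t : K) (u : V) :
    ∑ i, ‖⟪e i t, u⟫_ℂ‖ ^ 2 ≤ ‖u‖ ^ 2 := by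
  classical
  have h := he.sum_inner_products_le (WithLp.toLp 2 (Pi.single t u)) (s := Finset.univ)
  have h1 : ∀ i, ⟪e i, WithLp.toLp 2 (Pi.single t u)⟫_ℂ = ⟪e i t, u⟫_ℂ := by
    intro i
    rw [PiLp.inner_apply, Finset.sum_eq_single t]
    · simp
    · intro b _ hb
      simp [Pi.single_eq_of_ne hb]
    · simp
  have h2 : ‖(WithLp.toLp 2 (Pi.single t u) : PiLp 2 (fun _ : K => V))‖ = ‖u‖ := by
    rw [← sq_eq_sq₀ (norm_nonneg _) (norm_nonneg _), PiLp.norm_sq_eq_of_L2,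
      Finset.sum_eq_single t]
    · simp
    · intro b _ hb
      simp [Pi.single_eq_of_ne hb]
    · simp
  simp only [h1, h2] at h
  exact h

theorem sum_norm_inner_mul_norm_inner_le {K : Type*} [Fintype K] {r : ℕ}
    {e f : Fin r → PiLp 2 (fun _ : K => V)} (he : Orthonormal ℂ e) (hf : Orthonormal ℂ f) (t : K)
    (u v : V) : ∑ i, ‖⟪e i t, u⟫_ℂ‖ * ‖⟪v, f i t⟫_ℂ‖ ≤ ‖u‖ * ‖v‖ := by
  have h1 := sum_norm_inner_component_sq_le he t u
  have h2 := sum_norm_inner_component_sq_le hf t v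
  simp only [norm_inner_symm v]
  refine (Real.sum_mul_le_sqrt_mul_sqrt _ _ _).trans ?_
  exact mul_le_mul ((Real.sqrt_le_sqrt h1).trans_eq (Real.sqrt_sq (norm_nonneg _)))
    ((Real.sqrt_le_sqrt h2).trans_eq (Real.sqrt_sq (norm_nonneg _))) (Real.sqrt_nonneg _)
    (norm_nonneg _)

/-- Each block splits as `|x⟩⟨x| - |y⟩⟨y| = |x - y⟩⟨x| + |y⟩⟨x - y|`. Bessel's inequality in each
component and Cauchy–Schwarz bound the contribution of a rank-one block by the product of the two
norms. -/
theorem traceNorm_blockDiag_density_sub_le {K : Type*} [Fintype K] {c : ℝ} (hc : 0 ≤ c)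
    (x y : K → V) :
    traceNorm (blockDiag fun t => (c : ℂ) • density (x t) - (c : ℂ) • density (y t)) ≤
      ENNReal.ofReal (c * ∑ t, (‖x t‖ + ‖y t‖) * ‖x t - y t‖) := by
  refine iSup_le fun r => iSup_le fun e => iSup_le fun f => iSup_le fun he => iSup_le fun hf => ?_
  have h1 : ∀ T : PiLp 2 (fun _ : K => V) →ₗ[ℂ] PiLp 2 (fun _ : K => V),
      ∑ i, ‖⟪e i, T (f i)⟫_ℂ‖ₑ = ENNReal.ofReal (∑ i, ‖⟪e i, T (f i)⟫_ℂ‖) := by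
    intro T
    rw [ENNReal.ofReal_sum_of_nonneg (fun i _ => norm_nonneg _)]
    simp only [ofReal_norm]
  rw [h1]
  apply ENNReal.ofReal_le_ofReal
  have h2 : ∀ i, ‖⟪e i, blockDiag (fun t => (c : ℂ) • density (x t) - (c : ℂ) • density (y t))
      (f i)⟫_ℂ‖ ≤ ∑ t, c * (‖⟪e i t, x t - y t⟫_ℂ‖ * ‖⟪x t, f i t⟫_ℂ‖ +
        ‖⟪e i t, y t⟫_ℂ‖ * ‖⟪x t - y t, f i t⟫_ℂ‖) := by
    intro i
    rw [PiLp.inner_apply]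
    refine (norm_sum_le _ _).trans (Finset.sum_le_sum fun t _ => ?_)
    have e1 : ⟪e i t, blockDiag (fun t => (c : ℂ) • density (x t) - (c : ℂ) • density (y t))
        (f i) t⟫_ℂ = c * (⟪e i t, x t - y t⟫_ℂ * ⟪x t, f i t⟫_ℂ +
          ⟪e i t, y t⟫_ℂ * ⟪x t - y t, f i t⟫_ℂ) := by
      change ⟪e i t, ((c : ℂ) • density (x t) - (c : ℂ) • density (y t)) (f i t)⟫_ℂ = _
      simp only [LinearMap.sub_apply, LinearMap.smul_apply, density_apply, inner_sub_right,
        inner_smul_right, inner_sub_left]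
      ring
    rw [e1, norm_mul, Complex.norm_real, Real.norm_of_nonneg hc]
    refine mul_le_mul_of_nonneg_left ((norm_add_le _ _).trans ?_) hc
    rw [norm_mul, norm_mul]
  refine (Finset.sum_le_sum fun i _ => h2 i).trans ?_
  rw [Finset.sum_comm, Finset.mul_sum]
  refine Finset.sum_le_sum fun t _ => ?_
  rw [← Finset.mul_sum, Finset.sum_add_distrib]
  refine mul_le_mul_of_nonneg_left ?_ hc
  have b1 := sum_norm_inner_mul_norm_inner_le he hf t (x t - y t) (x t)
  have b2 := sum_norm_inner_mul_norm_inner_le he hf t (y t) (x t - y t)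
  linarith

/-- The trace distance of two normalized ensembles of pure states. -/
theorem traceNorm_blockDiag_normalized_le {K : Type*} [Fintype K] {c : ℝ} (hc : 0 ≤ c)
    (u w : K → V) {a b : ℝ} (ha : 0 < a) (hb : 0 ≤ b) (hu : c * ∑ t, ‖u t‖ ^ 2 = a ^ 2)
    (hw : c * ∑ t, ‖w t‖ ^ 2 = b ^ 2) {p : ℝ} (hp : 0 ≤ p)
    (hd : 16 * (c * ∑ t, ‖u t - w t‖ ^ 2) ≤ p ^ 2 * a ^ 2) :
    traceNorm (blockDiag fun t => (c : ℂ) • density ((a : ℂ)⁻¹ • u t) -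
      (c : ℂ) • density ((b : ℂ)⁻¹ • w t)) ≤ ENNReal.ofReal p := by
  refine (traceNorm_blockDiag_density_sub_le hc _ _).trans (ENNReal.ofReal_le_ofReal ?_)
  let r : ℝ := Real.sqrt c
  have hr : r ^ 2 = c := Real.sq_sqrt hc
  let U : PiLp 2 (fun _ : K => V) := (r : ℂ) • WithLp.toLp 2 u
  let W : PiLp 2 (fun _ : K => V) := (r : ℂ) • WithLp.toLp 2 w
  have hnorm : ∀ f : K → V, ‖(r : ℂ) • (WithLp.toLp 2 f : PiLp 2 (fun _ : K => V))‖ ^ 2 =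
      c * ∑ t, ‖f t‖ ^ 2 := by
    intro f
    rw [norm_smul, mul_pow, PiLp.norm_sq_eq_of_L2, Complex.norm_real,
      Real.norm_of_nonneg (Real.sqrt_nonneg c), hr]
  have hU : ‖U‖ = a := by
    rw [← sq_eq_sq₀ (norm_nonneg _) ha.le, ← hu]; exact hnorm u
  have hW : ‖W‖ = b := by
    rw [← sq_eq_sq₀ (norm_nonneg _) hb, ← hw]; exact hnorm w
  -- The factor 16 in `hd` is the square of this 4. One quarter is spent on the difference of the
  -- vectors and one on the difference of their norms, so that `‖X - Y‖ ≤ p / 2`.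
  have hUW : ‖U - W‖ ≤ p * a / 4 := by
    refine le_of_sq_le_sq ?_ (by positivity)
    have : ‖U - W‖ ^ 2 = c * ∑ t, ‖u t - w t‖ ^ 2 := by
      rw [← hnorm (fun t => u t - w t), ← smul_sub]; rfl
    rw [this]; nlinarith
  let X : PiLp 2 (fun _ : K => V) := (a : ℂ)⁻¹ • U
  let Y : PiLp 2 (fun _ : K => V) := (b : ℂ)⁻¹ • W
  have hX : ‖X‖ = 1 := by
    rw [norm_smul, norm_inv, Complex.norm_real, Real.norm_of_nonneg ha.le, hU,
      inv_mul_cancel₀ ha.ne']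
  have hY : ‖Y‖ ≤ 1 := by
    rw [norm_smul, norm_inv, Complex.norm_real, Real.norm_of_nonneg hb, hW]
    exact inv_mul_le_one
  have hba : |b - a| ≤ p * a / 4 := by
    rw [← hW, ← hU]
    exact (abs_norm_sub_norm_le W U).trans (by rw [norm_sub_rev, hU]; exact hUW)
  have hXY : ‖X - Y‖ ≤ p / 2 := by
    -- Only division by `a` occurs, so no lower bound on `b` is needed; for `b = 0` both `W` and `Y`
    -- vanish.
    have e : X - Y = (a : ℂ)⁻¹ • (U - W) + ((b - a : ℝ) : ℂ) • (a : ℂ)⁻¹ • Y := by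
      have ha' : (a : ℂ) ≠ 0 := by exact_mod_cast ha.ne'
      have hWY : W = (b : ℂ) • Y := by
        by_cases hb0 : b = 0
        · have : W = 0 := by rw [← norm_eq_zero, hW, hb0]
          simp [this, Y]
        · have hb' : (b : ℂ) ≠ 0 := by exact_mod_cast hb0
          rw [smul_smul, mul_inv_cancel₀ hb', one_smul]
      have h2 : Y = (a : ℂ)⁻¹ • (a : ℂ) • Y := by
        rw [smul_smul, inv_mul_cancel₀ ha', one_smul]
      rw [smul_sub]
      conv_lhs => rw [h2]
      conv_rhs => rw [hWY]
      push_cast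
      rw [smul_comm _ ((a : ℂ)⁻¹) Y, sub_smul, smul_sub]
      simp only [X]
      abel
    rw [e]
    refine (norm_add_le _ _).trans ?_
    rw [norm_smul, norm_smul, norm_smul, norm_inv, Complex.norm_real, Complex.norm_real,
      Real.norm_of_nonneg ha.le, Real.norm_eq_abs]
    have h1 : a⁻¹ * ‖U - W‖ ≤ p / 4 := by
      rw [inv_mul_le_iff₀ ha]; linarith
    have h2 : |b - a| * (a⁻¹ * ‖Y‖) ≤ p / 4 := by
      have : a⁻¹ * ‖Y‖ ≤ a⁻¹ := mul_le_of_le_one_right (by positivity) hY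
      calc |b - a| * (a⁻¹ * ‖Y‖) ≤ (p * a / 4) * a⁻¹ := by gcongr
        _ = p / 4 := by field_simp
    linarith
  have hXt : ∀ t, ‖X t‖ = r * ‖(a : ℂ)⁻¹ • u t‖ := fun t => by
    change ‖(a : ℂ)⁻¹ • (r : ℂ) • u t‖ = _
    rw [smul_comm, norm_smul, Complex.norm_real, Real.norm_of_nonneg (Real.sqrt_nonneg c)]
  have hYt : ∀ t, ‖Y t‖ = r * ‖(b : ℂ)⁻¹ • w t‖ := fun t => by
    change ‖(b : ℂ)⁻¹ • (r : ℂ) • w t‖ = _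
    rw [smul_comm, norm_smul, Complex.norm_real, Real.norm_of_nonneg (Real.sqrt_nonneg c)]
  have hXYt : ∀ t, ‖(X - Y) t‖ = r * ‖(a : ℂ)⁻¹ • u t - (b : ℂ)⁻¹ • w t‖ := fun t => by
    change ‖(a : ℂ)⁻¹ • (r : ℂ) • u t - (b : ℂ)⁻¹ • (r : ℂ) • w t‖ = _
    rw [smul_comm _ (r : ℂ), smul_comm _ (r : ℂ), ← smul_sub, norm_smul, Complex.norm_real,
      Real.norm_of_nonneg (Real.sqrt_nonneg c)]
  have hcs : ∀ Z D : PiLp 2 (fun _ : K => V), ∑ t, ‖Z t‖ * ‖D t‖ ≤ ‖Z‖ * ‖D‖ := by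
    intro Z D
    refine (Real.sum_mul_le_sqrt_mul_sqrt _ _ _).trans (le_of_eq ?_)
    rw [← PiLp.norm_sq_eq_of_L2, ← PiLp.norm_sq_eq_of_L2, Real.sqrt_sq (norm_nonneg _),
      Real.sqrt_sq (norm_nonneg _)]
  calc c * ∑ t, (‖(a : ℂ)⁻¹ • u t‖ + ‖(b : ℂ)⁻¹ • w t‖) * ‖(a : ℂ)⁻¹ • u t - (b : ℂ)⁻¹ • w t‖
      = ∑ t, ‖X t‖ * ‖(X - Y) t‖ + ∑ t, ‖Y t‖ * ‖(X - Y) t‖ := by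
        rw [← Finset.sum_add_distrib, Finset.mul_sum]
        refine Finset.sum_congr rfl fun t _ => ?_
        rw [hXt, hYt, hXYt, ← hr]; ring
    _ ≤ ‖X‖ * ‖X - Y‖ + ‖Y‖ * ‖X - Y‖ := add_le_add (hcs _ _) (hcs _ _)
    _ ≤ 1 * (p / 2) + 1 * (p / 2) := by rw [hX]; gcongr
    _ = p := by ring

end TraceNorm

/-! ### Concatenated transcripts and sums over the later games. -/

theorem init_append {J m : ℕ} (g : Hist J) (t : Hist (m + 1)) :
    Fin.init (n := J + m) (α := fun _ => Fin 2 × Fin 2)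
        (Fin.append (m := J) (n := m + 1) g t) = Fin.append g (Fin.init t) := by
  have h := Fin.append_snoc g (Fin.init t) (t (Fin.last m))
  rw [Fin.snoc_init_self] at h
  rw [h]
  exact Fin.init_snoc (α := fun _ => Fin 2 × Fin 2) _ _

theorem append_last {J m : ℕ} (g : Hist J) (t : Hist (m + 1)) :
    (Fin.append g t : Hist (J + (m + 1))) (Fin.last (J + m)) = t (Fin.last m) :=
  Fin.append_right g t (Fin.last m)

theorem sum_hist_succ {M : Type*} [AddCommMonoid M] {m : ℕ} (f : Hist (m + 1) → M) :
    ∑ t, f t = ∑ t : Hist m, ∑ z, f (Fin.snoc (α := fun _ => Fin 2 × Fin 2) t z) := by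
  rw [← (Fin.snocEquiv (fun _ => Fin 2 × Fin 2)).sum_comp, Fintype.sum_prod_type_right]
  rfl

/-- Measurements after the transcript `g` preserve the total weight. -/
theorem QubitFamily.sum_norm_measured_append_sq {n : ℕ} {K : Type*} [NormedAddCommGroup K]
    [InnerProductSpace ℂ K] (A : QubitFamily n K) (ψ : K) {J m : ℕ} (hm : J + m ≤ n)
    (g : Hist J) :
    (1 / 2) ^ m * ∑ t : Hist m, ‖A.measured ψ hm (Fin.append g t)‖ ^ 2 =
      ‖A.measured ψ (Nat.le_of_add_right_le hm) g‖ ^ 2 := by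
  induction m with
  | zero =>
    have : ∀ t : Hist 0, (Fin.append g t : Hist (J + 0)) = g := fun t => by
      rw [Subsingleton.elim t Fin.elim0, Fin.append_elim0]; rfl
    simp [this]
  | succ m ih =>
    rw [← ih (Nat.le_of_succ_le hm), sum_hist_succ, pow_succ, mul_assoc, Finset.mul_sum]
    congr 1
    refine Finset.sum_congr rfl fun t _ => ?_
    have e : ∀ z, A.measured ψ hm (Fin.append g (Fin.snoc (α := fun _ => Fin 2 × Fin 2) t z)) =
        A.op ⟨J + m, hm⟩ (Fin.append g t) (measA z)
          (A.measured ψ (Nat.le_of_succ_le hm) (Fin.append g t)) := by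
      intro z
      have h1 := init_append g (Fin.snoc (α := fun _ => Fin 2 × Fin 2) t z)
      have h2 := append_last g (Fin.snoc (α := fun _ => Fin 2 × Fin 2) t z)
      rw [Fin.init_snoc] at h1
      rw [Fin.snoc_last] at h2
      refine (A.measured_succ ψ (k := J + m) hm _).trans ?_
      rw [h1, h2]
    simp only [e, QubitFamily.sum_norm_op_measA_sq_prod]
    ring

theorem overlapProd_append {J m : ℕ} (g h : Hist J) (s t : Hist m) :
    overlapProd (Fin.append g s) (Fin.append h t) = overlapProd g h * overlapProd s t := by
  simp only [overlapProd, Fin.prod_univ_add, Fin.append_left, Fin.append_right]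

theorem sum_norm_overlapProd_sq {m : ℕ} (s : Hist m) :
    ∑ t : Hist m, ‖overlapProd s t‖ ^ 2 = 2 ^ m := by
  simp only [overlapProd, norm_prod, ← Finset.prod_pow]
  have h := Finset.prod_univ_sum (fun _ : Fin m => (Finset.univ : Finset (Fin 2 × Fin 2)))
    (fun i w => ‖overlap (s i) w‖ ^ 2)
  rw [Fintype.piFinset_univ] at h
  rw [← h]
  simp only [sum_norm_overlap_sq_prod]
  simp

/-- The weighted norm of a function that depends on Alice's transcript alone after game `J`. -/
theorem wnorm_append_sq {E : Type*} [NormedAddCommGroup E] [NormedSpace ℂ E] {J m : ℕ}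
    (f : Hist (J + m) × Hist (J + m) → E) (f' : Hist J × Hist J → Hist m → E)
    (hf : ∀ (g h : Hist J) (s t : Hist m), f (Fin.append g s, Fin.append h t) = f' (g, h) s) :
    wnorm (fun h => overlapProd h.1 h.2 • f h) ^ 2 =
      ∑ h : Hist J × Hist J, (1 / 4) ^ J * ‖overlapProd h.1 h.2‖ ^ 2 *
        ((1 / 2) ^ m * ∑ s, ‖f' h s‖ ^ 2) := by
  rw [wnorm_sq, Fintype.sum_prod_type, ← (Fin.appendEquiv J m).sum_comp,
    Fintype.sum_prod_type]
  simp only [← (Fin.appendEquiv J m).sum_comp (fun y => ‖overlapProd _ y • f (_, y)‖ ^ 2)]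
  simp only [Fintype.sum_prod_type]
  rw [Finset.mul_sum]
  refine Finset.sum_congr rfl fun g _ => ?_
  rw [Finset.sum_comm, Finset.mul_sum]
  refine Finset.sum_congr rfl fun h _ => ?_
  have e : ∀ s t : Hist m, ‖overlapProd (Fin.appendEquiv J m (g, s)) (Fin.appendEquiv J m (h, t)) •
      f (Fin.appendEquiv J m (g, s), Fin.appendEquiv J m (h, t))‖ ^ 2 =
      ‖overlapProd g h‖ ^ 2 * ‖f' (g, h) s‖ ^ 2 * ‖overlapProd s t‖ ^ 2 := by
    intro s t
    change ‖overlapProd (Fin.append g s) (Fin.append h t) •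
      f (Fin.append g s, Fin.append h t)‖ ^ 2 = _
    rw [hf, overlapProd_append, norm_smul, norm_mul]; ring
  simp only [e, ← Finset.mul_sum, sum_norm_overlapProd_sq]
  rw [← Finset.sum_mul, ← Finset.mul_sum, pow_add]
  -- Summing out Bob's later transcripts leaves exactly the weight of Alice's uniformly random
  -- questions.
  have : (1 / 4 : ℝ) ^ m * 2 ^ m = (1 / 2) ^ m := by rw [← mul_pow]; norm_num
  rw [← this]; ring

/-! ### Alice's post-measurement ensembles. -/

section Play

variable {n : ℕ} {HA HB HC HA' : Type*}
  [NormedAddCommGroup HA] [InnerProductSpace ℂ HA]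
  [NormedAddCommGroup HB] [InnerProductSpace ℂ HB]
  [NormedAddCommGroup HC] [InnerProductSpace ℂ HC]
  [NormedAddCommGroup HA'] [InnerProductSpace ℂ HA']
  {S : Strategy n HA HB HC} {FA : QubitFrame n HA HA'}

theorem Strategy.joint_prodProj_eq (hA : FA.Realizes idealA S.alice) {k : ℕ} (hk : k ≤ n)
    (g : Hist k) : joint HC (S.alice.prodProj g) LinearMap.id S.state =
      (FA.family.onAlice HC HB).measured S.state hk g := by
  rw [S.alice.prodProj_eq_chain hA measA_eq hk, QubitFamily.measured, QubitFamily.chain_onAlice]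
  rfl

/-- Every branch of the register carries a pure state. Normalization happens only once, after the
transcript `g`; the later projections are left unnormalized. -/
theorem Strategy.playA_rhoA_eq (hA : FA.Realizes idealA S.alice) {J m : ℕ} (hm : J + m ≤ n)
    (g : Hist J) (t : Hist m) :
    S.playA g (S.rhoA g) m t = (((1 / 2) ^ m : ℝ) : ℂ) •
      density ((‖(FA.family.onAlice HC HB).measured S.state (Nat.le_of_add_right_le hm) g‖ : ℂ)⁻¹ •
        (FA.family.onAlice HC HB).measured S.state hm (Fin.append g t)) := by
  induction m with
  | zero =>
    have : (Fin.append g t : Hist (J + 0)) = g := by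
      rw [Subsingleton.elim t Fin.elim0, Fin.append_elim0]; rfl
    rw [Strategy.playA, Strategy.rhoA, normalize, S.joint_prodProj_eq hA hm, this]
    simp
  | succ m ih =>
    have hk : J + m < n := hm
    have hP : joint HC (S.alice.proj (j := J + m) (Fin.append (m := J) (n := m + 1) g t))
        (LinearMap.id : HB →ₗ[ℂ] HB) = (FA.family.onAlice HC HB).op ⟨J + m, hk⟩
          (Fin.append g (Fin.init t)) (measA (t (Fin.last m))) := by
      rw [S.alice.proj_eq_op hA measA_eq hk, append_last, init_append]
      rfl
    have hmeas : (FA.family.onAlice HC HB).measured S.state hm (Fin.append g t) =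
        (FA.family.onAlice HC HB).op ⟨J + m, hk⟩ (Fin.append g (Fin.init t))
          (measA (t (Fin.last m))) ((FA.family.onAlice HC HB).measured S.state hk.le
            (Fin.append g (Fin.init t))) := by
      refine (QubitFamily.measured_succ _ S.state (k := J + m) hm _).trans ?_
      rw [append_last, init_append]
    rw [Strategy.playA, Strategy.stepA, hP, ih hk.le, hmeas, ← map_smul, ← comp_density_comp
      (P' := (FA.family.onAlice HC HB).op ⟨J + m, hk⟩ (Fin.append g (Fin.init t))
        (measA (t (Fin.last m)))) (fun x y => by
          rw [QubitFamily.inner_op, conjTranspose_measA])]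
    rw [LinearMap.smul_comp, LinearMap.comp_smul, smul_smul]
    congr 1
    push_cast
    ring

end Play

/-- Needed for the case of zero error, where a vanishing weighted sum must force every distance to
vanish. -/
theorem norm_overlapProd_pos {k : ℕ} (g h : Hist k) : 0 < ‖overlapProd g h‖ := by
  rw [overlapProd, norm_prod]
  exact Finset.prod_pos fun i _ => norm_overlap_pos _ _

theorem update_append {J m : ℕ} (g : Hist J) (s : Hist m) (i : Fin J) (z : Fin 2 × Fin 2) :
    Function.update (Fin.append g s) (Fin.castAdd m i) z =
      Fin.append (Function.update g i z) s := by
  funext l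
  refine Fin.addCases (fun l => ?_) (fun l => ?_) l
  · rw [Fin.append_left]
    by_cases hl : l = i
    · subst hl; simp
    · rw [Function.update_of_ne hl, Function.update_of_ne, Fin.append_left]
      exact fun h => hl (Fin.castAdd_injective _ _ h)
  · rw [Fin.append_right, Function.update_of_ne, Fin.append_right]
    intro h
    have h1 := congrArg Fin.val h
    have h2 := i.isLt
    simp at h1
    omega

/-- The squared distance of Alice's unnormalized ensembles after `m` more games, for the two
transcripts of `j + 1` games that differ in game `j`, up to the basis change on its qubits. -/
def QubitFamily.ensembleDistSq {n : ℕ} {K : Type*} [NormedAddCommGroup K] [InnerProductSpace ℂ K]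
    (A B : QubitFamily n K) (ψ : K) (j : Fin n) {m : ℕ} (hm : (j : ℕ) + 1 + m ≤ n)
    (z' : Fin 2 × Fin 2) (h : Hist ((j : ℕ) + 1) × Hist ((j : ℕ) + 1)) : ℝ :=
  (1 / 2) ^ m * ∑ t : Hist m, ‖A.measured ψ hm (Fin.append h.1 t) -
    A.op j (Fin.init h.1) (basisChange z'.1 (h.1 (Fin.last j)).1 (z'.2 + (h.1 (Fin.last j)).2))
      (B.op j (Fin.init h.2)
        (basisChange z'.1 (h.1 (Fin.last j)).1 (z'.2 + (h.1 (Fin.last j)).2))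
        (A.measured ψ hm (Fin.append (Function.update h.1 (Fin.last (j : ℕ)) z') t)))‖ ^ 2

theorem QubitFamily.ensembleDistSq_nonneg {n : ℕ} {K : Type*} [NormedAddCommGroup K]
    [InnerProductSpace ℂ K] (A B : QubitFamily n K) (ψ : K) (j : Fin n) {m : ℕ}
    (hm : (j : ℕ) + 1 + m ≤ n) (z' : Fin 2 × Fin 2)
    (h : Hist ((j : ℕ) + 1) × Hist ((j : ℕ) + 1)) :
    0 ≤ A.ensembleDistSq B ψ j hm z' h := by
  unfold QubitFamily.ensembleDistSq; positivity

/-- The vectors compared in `wnorm_measured_update_le` depend on Bob's transcript only through the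
games before `j`, so his later games can be summed out by `wnorm_append_sq`. -/
theorem QubitFamily.sum_ensembleDistSq_le {n : ℕ} {K : Type*} [NormedAddCommGroup K]
    [InnerProductSpace ℂ K] {A B : QubitFamily n K} {ψ : K}
    (hAB : ∀ i g M j h N, Commute (A.op i g M) (B.op j h N)) {η : ℝ}
    (hη : ∀ k (hk : k < n), wnorm (fun h : Hist k × Hist k => A.deviation B ⟨k, hk⟩ h.1 h.2
      (A.transferred B ψ hk.le h.1 h.2)) ≤ η) (j : Fin n) (z' : Fin 2 × Fin 2) {m : ℕ}
    (hm : (j : ℕ) + 1 + m ≤ n) :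
    ∑ h : Hist ((j : ℕ) + 1) × Hist ((j : ℕ) + 1), (1 / 4) ^ ((j : ℕ) + 1) *
      ‖overlapProd h.1 h.2‖ ^ 2 * A.ensembleDistSq B ψ j hm z' h ≤ (80 * n ^ 2 * η) ^ 2 := by
  refine le_trans (le_of_eq ?_) (pow_le_pow_left₀ (wnorm_nonneg _)
    (QubitFamily.wnorm_measured_update_le hAB hη j z' hm) 2)
  refine (wnorm_append_sq _ (fun h t => A.measured ψ hm (Fin.append h.1 t) -
    A.op j (Fin.init h.1) (basisChange z'.1 (h.1 (Fin.last j)).1 (z'.2 + (h.1 (Fin.last j)).2))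
      (B.op j (Fin.init h.2)
        (basisChange z'.1 (h.1 (Fin.last j)).1 (z'.2 + (h.1 (Fin.last j)).2))
        (A.measured ψ hm (Fin.append (Function.update h.1 (Fin.last (j : ℕ)) z') t)))) ?_).symm
  intro g h s t
  have e : ∀ (g : Hist ((j : ℕ) + 1)) (s : Hist m),
      (fun x : Fin j => Fin.append g s (Fin.castLE (by omega) x)) = Fin.init g := by
    intro g s
    funext x
    exact Fin.append_left g s x.castSucc
  simp only [e, Fin.append_left, update_append]

/-! ### From average distance to probability. -/

section Main

variable {n : ℕ} {HA HB HC HA' HB' : Type*}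
  [NormedAddCommGroup HA] [InnerProductSpace ℂ HA]
  [NormedAddCommGroup HB] [InnerProductSpace ℂ HB]
  [NormedAddCommGroup HC] [InnerProductSpace ℂ HC]
  [NormedAddCommGroup HA'] [InnerProductSpace ℂ HA']
  [NormedAddCommGroup HB'] [InnerProductSpace ℂ HB']
  {S : Strategy n HA HB HC} {FA : QubitFrame n HA HA'} {FB : QubitFrame n HB HB'}

/-- If the unnormalized ensembles are close, then the normalized ones are close in trace norm. -/
theorem Strategy.traceNorm_playA_sub_le [FiniteDimensional ℂ HA] [FiniteDimensional ℂ HB]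
    (hA : FA.Realizes idealA S.alice) (j : Fin n) {m : ℕ} (hm : (j : ℕ) + 1 + m ≤ n)
    (h : Hist ((j : ℕ) + 1) × Hist ((j : ℕ) + 1)) (z' : Fin 2 × Fin 2) {p : ℝ} (hp : 0 ≤ p)
    (hv : (FA.family.onAlice HC HB).measured S.state j.isLt h.1 ≠ 0)
    (hD : 16 * (FA.family.onAlice HC HB).ensembleDistSq (FB.family.onBob HC HA) S.state j hm z' h ≤
      p ^ 2 * ‖(FA.family.onAlice HC HB).measured S.state j.isLt h.1‖ ^ 2)
    {M : Matrix (Fin 2) (Fin 2) ℂ}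
    (hM : M = basisChange z'.1 (h.1 (Fin.last j)).1 (z'.2 + (h.1 (Fin.last j)).2)) :
    traceNorm (blockDiag (fun t : Hist m => S.playA h.1 (S.rhoA h.1) m t -
      joint HC (FA.onGameQubit j (Fin.init h.1) M) (FB.onGameQubit j (Fin.init h.2) M) ∘ₗ
        S.playA (Function.update h.1 (Fin.last (j : ℕ)) z')
          (S.rhoA (Function.update h.1 (Fin.last (j : ℕ)) z')) m t ∘ₗ
        joint HC (LinearMap.adjoint (FA.onGameQubit j (Fin.init h.1) M))
          (LinearMap.adjoint (FB.onGameQubit j (Fin.init h.2) M)))) ≤ ENNReal.ofReal p := by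
  set A := FA.family.onAlice HC HB with hAdef
  set B := FB.family.onBob HC HA with hBdef
  set ψ := S.state with hψ
  have hV : joint HC (FA.onGameQubit j (Fin.init h.1) M) (FB.onGameQubit j (Fin.init h.2) M) =
      A.op j (Fin.init h.1) M * B.op j (Fin.init h.2) M := by
    rw [hAdef, hBdef, QubitFamily.onAlice_op, QubitFamily.onBob_op, ← joint_mul, one_mul, mul_one]
    rfl
  have hadj : ∀ x y : JointSpace HA HB HC,
      ⟪joint HC (FA.onGameQubit j (Fin.init h.1) M) (FB.onGameQubit j (Fin.init h.2) M) x, y⟫_ℂ =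
      ⟪x, joint HC (LinearMap.adjoint (FA.onGameQubit j (Fin.init h.1) M))
          (LinearMap.adjoint (FB.onGameQubit j (Fin.init h.2) M)) y⟫_ℂ :=
    inner_joint (fun x y => (LinearMap.adjoint_inner_right _ _ _).symm)
      (fun x y => (LinearMap.adjoint_inner_right _ _ _).symm)
  have hVnorm : ∀ x, ‖(A.op j (Fin.init h.1) M * B.op j (Fin.init h.2) M) x‖ = ‖x‖ := by
    intro x
    rw [Module.End.mul_apply, hM, A.norm_op_basisChange, B.norm_op_basisChange]
  have e : (fun t : Hist m => S.playA h.1 (S.rhoA h.1) m t -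
      joint HC (FA.onGameQubit j (Fin.init h.1) M) (FB.onGameQubit j (Fin.init h.2) M) ∘ₗ
        S.playA (Function.update h.1 (Fin.last (j : ℕ)) z')
          (S.rhoA (Function.update h.1 (Fin.last (j : ℕ)) z')) m t ∘ₗ
        joint HC (LinearMap.adjoint (FA.onGameQubit j (Fin.init h.1) M))
          (LinearMap.adjoint (FB.onGameQubit j (Fin.init h.2) M))) = fun t =>
      (((1 / 2) ^ m : ℝ) : ℂ) • density ((‖A.measured ψ j.isLt h.1‖ : ℂ)⁻¹ •
        A.measured ψ hm (Fin.append h.1 t)) -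
      (((1 / 2) ^ m : ℝ) : ℂ) • density
        ((‖A.measured ψ j.isLt (Function.update h.1 (Fin.last (j : ℕ)) z')‖ : ℂ)⁻¹ •
        (A.op j (Fin.init h.1) M * B.op j (Fin.init h.2) M)
          (A.measured ψ hm (Fin.append (Function.update h.1 (Fin.last (j : ℕ)) z') t))) := by
    funext t
    rw [S.playA_rhoA_eq (HB := HB) (HC := HC) hA hm, S.playA_rhoA_eq (HB := HB) (HC := HC) hA hm,
      LinearMap.smul_comp, LinearMap.comp_smul, comp_density_comp hadj, map_smul, hV]
  rw [e]
  refine traceNorm_blockDiag_normalized_le (by positivity) _ _ (norm_pos_iff.mpr hv)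
    (norm_nonneg _) (A.sum_norm_measured_append_sq ψ hm h.1) ?_ hp ?_
  · simp only [hVnorm]
    exact A.sum_norm_measured_append_sq ψ hm _
  · rw [hM]
    exact hD

theorem Strategy.histProb_eq_transferred (hA : FA.Realizes idealA S.alice)
    (hB : FB.Realizes idealB S.bob) {k : ℕ} (hk : k ≤ n) (h : Hist k × Hist k) :
    S.histProb h = (1 / 4) ^ k * ‖(FA.family.onAlice HC HB).transferred (FB.family.onBob HC HA)
      S.state hk h.1 h.2‖ ^ 2 := by
  rw [S.histProb_eq, S.jointState_eq hA hB hk, QubitFamily.transferred,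
    QubitFamily.norm_chain_transfer]

/-- The probability of a set of transcripts on which Alice's ensembles are far apart. -/
theorem Strategy.sq_mul_prob_le (hA : FA.Realizes idealA S.alice)
    (hB : FB.Realizes idealB S.bob) {η : ℝ}
    (hη : ∀ k (hk : k < n), wnorm (fun h : Hist k × Hist k => (FA.family.onAlice HC HB).deviation
      (FB.family.onBob HC HA) ⟨k, hk⟩ h.1 h.2
      ((FA.family.onAlice HC HB).transferred (FB.family.onBob HC HA) S.state hk.le h.1 h.2)) ≤ η)
    (j : Fin n) {m : ℕ} (hm : (j : ℕ) + 1 + m ≤ n) {p : ℝ}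
    (E : Hist ((j : ℕ) + 1) × Hist ((j : ℕ) + 1) → Prop)
    (hE : ∀ h, E h → p ^ 2 * ‖(FA.family.onAlice HC HB).measured S.state j.isLt h.1‖ ^ 2 ≤
      16 * ∑ z', (FA.family.onAlice HC HB).ensembleDistSq (FB.family.onBob HC HA)
        S.state j hm z' h) :
    p ^ 2 * S.prob E ≤ 128 * (80 * n ^ 2 * η) ^ 2 + 2 * p ^ 2 * (2 * n * η) ^ 2 := by
  classical
  set A := FA.family.onAlice HC HB with hAdef
  set B := FB.family.onBob HC HA with hBdef
  set ψ := S.state with hψ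
  have hAB : ∀ i g M j h N, Commute (A.op i g M) (B.op j h N) :=
    FA.family.commute_onAlice_onBob FB.family
  have hη0 : 0 ≤ η := (wnorm_nonneg _).trans (hη j j.isLt)
  have hw : wnorm (fun h : Hist ((j : ℕ) + 1) × Hist ((j : ℕ) + 1) =>
      A.transferred B ψ j.isLt h.1 h.2 - overlapProd h.1 h.2 • A.measured ψ j.isLt h.1) ^ 2 ≤
      (2 * n * η) ^ 2 := by
    refine pow_le_pow_left₀ (wnorm_nonneg _)
      ((QubitFamily.wnorm_transferred_sub_le hAB hη j.isLt).trans ?_) 2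
    have : (((j : ℕ) + 1 : ℕ) : ℝ) ≤ n := by exact_mod_cast j.isLt
    nlinarith
  have hz := fun z' => QubitFamily.sum_ensembleDistSq_le hAB hη j z' hm
  -- The probability of a transcript is the weighted squared norm of the transferred state. It is
  -- split as twice the approximation error plus twice the overlap-weighted squared norm of Alice's
  -- state, and `hE` trades the latter for ensemble distances; hence `32 = 2 * 16`. Summing over the
  -- four values of `z'` later makes it 128.
  have hterm : ∀ h : Hist ((j : ℕ) + 1) × Hist ((j : ℕ) + 1),
      p ^ 2 * (if E h then S.histProb h else 0) ≤
      32 * ∑ z', ((1 / 4) ^ ((j : ℕ) + 1) * ‖overlapProd h.1 h.2‖ ^ 2 *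
        A.ensembleDistSq B ψ j hm z' h) + 2 * p ^ 2 * ((1 / 4) ^ ((j : ℕ) + 1) *
        ‖A.transferred B ψ j.isLt h.1 h.2 - overlapProd h.1 h.2 • A.measured ψ j.isLt h.1‖ ^ 2) := by
    intro h
    have hsum : 0 ≤ ∑ z', ((1 / 4) ^ ((j : ℕ) + 1) * ‖overlapProd h.1 h.2‖ ^ 2 *
        A.ensembleDistSq B ψ j hm z' h) := Finset.sum_nonneg fun z' _ =>
      mul_nonneg (by positivity) (A.ensembleDistSq_nonneg B ψ j hm z' h)
    by_cases hEh : E h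
    · rw [if_pos hEh, S.histProb_eq_transferred hA hB j.isLt]
      change p ^ 2 * ((1 / 4) ^ ((j : ℕ) + 1) * ‖A.transferred B ψ j.isLt h.1 h.2‖ ^ 2) ≤ _
      have h1 := hE h hEh
      have h2 : ‖A.transferred B ψ j.isLt h.1 h.2‖ ≤
          ‖A.transferred B ψ j.isLt h.1 h.2 - overlapProd h.1 h.2 • A.measured ψ j.isLt h.1‖ +
            ‖overlapProd h.1 h.2‖ * ‖A.measured ψ j.isLt h.1‖ := by
        rw [← norm_smul]
        simpa using norm_add_le (A.transferred B ψ j.isLt h.1 h.2 -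
          overlapProd h.1 h.2 • A.measured ψ j.isLt h.1)
          (overlapProd h.1 h.2 • A.measured ψ j.isLt h.1)
      have h3 : ‖A.transferred B ψ j.isLt h.1 h.2‖ ^ 2 ≤
          2 * ‖A.transferred B ψ j.isLt h.1 h.2 -
            overlapProd h.1 h.2 • A.measured ψ j.isLt h.1‖ ^ 2 +
          2 * (‖overlapProd h.1 h.2‖ ^ 2 * ‖A.measured ψ j.isLt h.1‖ ^ 2) := by
        refine (pow_le_pow_left₀ (norm_nonneg _) h2 2).trans ?_
        rw [← mul_pow]
        exact add_sq_le.trans (by linarith)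
      have h4 : 0 ≤ (1 / 4 : ℝ) ^ ((j : ℕ) + 1) := by positivity
      have h5 := mul_le_mul_of_nonneg_left h1
        (by positivity : 0 ≤ (1 / 4 : ℝ) ^ ((j : ℕ) + 1) * ‖overlapProd h.1 h.2‖ ^ 2)
      have h6 := mul_le_mul_of_nonneg_left h3
        (by positivity : 0 ≤ p ^ 2 * (1 / 4 : ℝ) ^ ((j : ℕ) + 1))
      rw [← Finset.mul_sum]
      linarith
    · rw [if_neg hEh]
      have : 0 ≤ 2 * p ^ 2 * ((1 / 4) ^ ((j : ℕ) + 1) *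
        ‖A.transferred B ψ j.isLt h.1 h.2 -
          overlapProd h.1 h.2 • A.measured ψ j.isLt h.1‖ ^ 2) := by positivity
      linarith
  rw [Strategy.prob, Finset.mul_sum]
  refine (Finset.sum_le_sum fun h _ => hterm h).trans ?_
  rw [Finset.sum_add_distrib, ← Finset.mul_sum, ← Finset.mul_sum, ← Finset.mul_sum, ← wnorm_sq,
    Finset.sum_comm]
  have h1 := Finset.sum_le_sum fun z' (_ : z' ∈ Finset.univ) => hz z'
  simp only [Finset.sum_const, Finset.card_univ, Fintype.card_prod, Fintype.card_fin,
    nsmul_eq_mul] at h1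
  push_cast at h1
  have h2 := mul_le_mul_of_nonneg_left hw (by positivity : 0 ≤ 2 * p ^ 2)
  linarith

end Main

/-- The failure probability dominates the accumulated error. -/
theorem error_le_failure_cube {n : ℕ} (hn : 1 ≤ n) {s p : ℝ} (hs : 0 ≤ s)
    (hp : p = 1000 * (n : ℝ) ^ (1000 : ℝ) * s ^ (1 / 1000 : ℝ)) (hp1 : p < 1) :
    128 * (80 * n ^ 2 * (3 * Real.sqrt s)) ^ 2 + 2 * p ^ 2 * (2 * n * (3 * Real.sqrt s)) ^ 2 ≤
      p ^ 3 := by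
  have hn1 : (1 : ℝ) ≤ n := by exact_mod_cast hn
  have hp0 : 0 ≤ p := by rw [hp]; positivity
  -- For `s > 1` already `p ≥ 1000`. With `s ≤ 1`, lowering the exponent from 1 to `3/1000` only
  -- increases the power.
  have hs1 : s ≤ 1 := by
    by_contra hcon
    push Not at hcon
    have h1 : (1 : ℝ) ≤ s ^ (1 / 1000 : ℝ) := Real.one_le_rpow hcon.le (by norm_num)
    have h2 : (1 : ℝ) ≤ (n : ℝ) ^ (1000 : ℝ) := Real.one_le_rpow hn1 (by norm_num)
    have h3 := one_le_mul_of_one_le_of_one_le h2 h1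
    rw [hp, mul_assoc] at hp1
    linarith
  have h1 : s ≤ (s ^ (1 / 1000 : ℝ)) ^ 3 := by
    rw [← Real.rpow_natCast, ← Real.rpow_mul hs]
    rcases hs.eq_or_lt with h0 | h0
    · rw [← h0, Real.zero_rpow (by norm_num)]
    · calc s = s ^ (1 : ℝ) := (Real.rpow_one s).symm
        _ ≤ _ := Real.rpow_le_rpow_of_exponent_ge h0 hs1 (by norm_num)
  have h2 : (n : ℝ) ^ 4 ≤ ((n : ℝ) ^ (1000 : ℝ)) ^ 3 := by
    rw [← Real.rpow_natCast, ← Real.rpow_natCast, ← Real.rpow_mul (by positivity)]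
    exact Real.rpow_le_rpow_of_exponent_le hn1 (by norm_num)
  have h3 : (n : ℝ) ^ 4 * s ≤ ((n : ℝ) ^ (1000 : ℝ)) ^ 3 * (s ^ (1 / 1000 : ℝ)) ^ 3 := by gcongr
  have h4 : p ^ 3 = 1000000000 * (((n : ℝ) ^ (1000 : ℝ)) ^ 3 * (s ^ (1 / 1000 : ℝ)) ^ 3) := by
    rw [hp]; ring
  have h5 : (n : ℝ) ^ 2 ≤ (n : ℝ) ^ 4 := pow_le_pow_right₀ hn1 (by norm_num)
  have h6 : p ^ 2 ≤ 1 := pow_le_one₀ hp0 hp1.le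
  have hsq : Real.sqrt s ^ 2 = s := Real.sq_sqrt hs
  have h7 : p ^ 2 * ((n : ℝ) ^ 2 * s) ≤ 1 * ((n : ℝ) ^ 4 * s) := by gcongr
  have e1 : (80 * (n : ℝ) ^ 2 * (3 * Real.sqrt s)) ^ 2 = 57600 * ((n : ℝ) ^ 4 * s) := by
    rw [mul_pow, mul_pow, mul_pow, hsq]; ring
  have e2 : (2 * (n : ℝ) * (3 * Real.sqrt s)) ^ 2 = 36 * ((n : ℝ) ^ 2 * s) := by
    rw [mul_pow, mul_pow, mul_pow, hsq]; ring
  have h8 : 0 ≤ (n : ℝ) ^ 4 * s := by positivity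
  rw [e1, e2, h4]
  -- `128 * 57600 + 72` is well below `1000³`.
  linarith

end CHSH
end

theorem theoremt :
    ∃ κ : ℝ, 0 < κ ∧
      ∀ (n : ℕ) (HA HB HC HA' HB' : Type*)
        [NormedAddCommGroup HA] [InnerProductSpace ℂ HA] [FiniteDimensional ℂ HA]
        [NormedAddCommGroup HB] [InnerProductSpace ℂ HB] [FiniteDimensional ℂ HB]
        [NormedAddCommGroup HC] [InnerProductSpace ℂ HC] [CompleteSpace HC]
        [NormedAddCommGroup HA'] [InnerProductSpace ℂ HA']
        [NormedAddCommGroup HB'] [InnerProductSpace ℂ HB']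
        (S : CHSH.Strategy n HA HB HC)
        (FA : CHSH.QubitFrame n HA HA') (FB : CHSH.QubitFrame n HB HB') (δ ε p : ℝ),
        0 ≤ δ → 0 ≤ ε →
        p = κ * (n : ℝ) ^ κ * (δ + ε) ^ (1 / κ) →
        FA.Realizes CHSH.idealA S.alice →
        FB.Realizes CHSH.idealB S.bob →
        S.Structured δ ε →
        ∀ (j : Fin n) (m : ℕ), (j : ℕ) + 1 + m ≤ n →
          1 - p ≤ S.prob (j := (j : ℕ) + 1) (fun h =>
            ∀ a' x' : Fin 2,
              let hA' : CHSH.Hist ((j : ℕ) + 1) := Function.update h.1 (Fin.last (j : ℕ)) (a', x')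
              let M := CHSH.basisChange a' (h.1 (Fin.last (j : ℕ))).1
                (x' + (h.1 (Fin.last (j : ℕ))).2)
              let VA := FA.onGameQubit j (Fin.init h.1) M
              let VB := FB.onGameQubit j (Fin.init h.2) M
              let V := CHSH.joint HC VA VB
              let Vdag := CHSH.joint HC (LinearMap.adjoint VA) (LinearMap.adjoint VB)
              CHSH.traceNorm 
                  (CHSH.blockDiag (fun t : CHSH.Hist m =>
                    S.playA h.1 (S.rhoA h.1) m t
                      - V ∘ₗ S.playA hA' (S.rhoA hA') m t ∘ₗ Vdag))
                ≤ ENNReal.ofReal p) := by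
  -- Any sufficiently large constant works: the argument needs `κ³` to exceed about `7.4 * 10⁶`, `3κ
  -- ≥ 4` and `3/κ ≤ 1`.
  refine ⟨1000, by norm_num, ?_⟩
  intro n HA HB HC HA' HB' _ _ _ _ _ _ _ _ _ _ _ _ _ S FA FB δ ε p hδ hε hp hA hB hS j m hm
  have hp0 : 0 ≤ p := by rw [hp]; positivity
  by_cases hp1 : 1 ≤ p
  · exact (by linarith : 1 - p ≤ 0).trans (S.prob_nonneg _)
  push Not at hp1
  have hn : 1 ≤ n := Nat.one_le_iff_ne_zero.mpr fun h => by
    have := j.isLt; omega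
  have hη := fun k hk => S.wnorm_deviation_le hA hB hδ hε hS (k := k) hk
  have hbound := CHSH.error_le_failure_cube hn (add_nonneg hδ hε) hp hp1
  set A := FA.family.onAlice HC HB with hAdef
  set B := FB.family.onBob HC HA with hBdef
  have htotal := S.sum_histProb hA hB j.isLt
  rw [← S.prob_add_prob_not] at htotal
  rw [← htotal, sub_le_iff_le_add]
  gcongr
  -- The sum over `z'` covers all four replacements of the entry for game `j` at once, so no union
  -- bound over them is needed. A vanishing state of Alice cannot be normalized, so it forms a
  -- separate case.
  have hfar : ∀ h : CHSH.Hist ((j : ℕ) + 1) × CHSH.Hist ((j : ℕ) + 1), ¬ (∀ a' x' : Fin 2,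
      CHSH.traceNorm (CHSH.blockDiag (fun t : CHSH.Hist m => S.playA h.1 (S.rhoA h.1) m t -
        CHSH.joint HC (FA.onGameQubit j (Fin.init h.1)
          (CHSH.basisChange a' (h.1 (Fin.last (j : ℕ))).1 (x' + (h.1 (Fin.last (j : ℕ))).2)))
          (FB.onGameQubit j (Fin.init h.2)
          (CHSH.basisChange a' (h.1 (Fin.last (j : ℕ))).1 (x' + (h.1 (Fin.last (j : ℕ))).2))) ∘ₗ
        S.playA (Function.update h.1 (Fin.last (j : ℕ)) (a', x'))
          (S.rhoA (Function.update h.1 (Fin.last (j : ℕ)) (a', x'))) m t ∘ₗ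
        CHSH.joint HC (LinearMap.adjoint (FA.onGameQubit j (Fin.init h.1)
          (CHSH.basisChange a' (h.1 (Fin.last (j : ℕ))).1 (x' + (h.1 (Fin.last (j : ℕ))).2))))
          (LinearMap.adjoint (FB.onGameQubit j (Fin.init h.2)
          (CHSH.basisChange a' (h.1 (Fin.last (j : ℕ))).1
            (x' + (h.1 (Fin.last (j : ℕ))).2)))))) ≤ ENNReal.ofReal p) →
      A.measured S.state j.isLt h.1 = 0 ∨
        p ^ 2 * ‖A.measured S.state j.isLt h.1‖ ^ 2 <
          16 * ∑ z', A.ensembleDistSq B S.state j hm z' h := by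
    intro h hnot
    by_contra hcon
    push Not at hcon
    refine hnot fun a' x' => S.traceNorm_playA_sub_le hA j hm h (a', x') hp0 hcon.1
      (le_trans ?_ hcon.2) rfl
    refine mul_le_mul_of_nonneg_left ?_ (by norm_num)
    exact Finset.single_le_sum (f := fun z' => A.ensembleDistSq B S.state j hm z' h)
      (fun z' _ => A.ensembleDistSq_nonneg B S.state j hm z' h) (Finset.mem_univ (a', x'))
  -- The Markov bound ends with a division by `p²`, so `p = 0` is treated apart. There `δ + ε = 0`,
  -- every ensemble distance vanishes, and the only transcripts that can fail have `measured = 0`,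
  -- hence probability zero.
  rcases hp0.eq_or_lt with hpz | hpos
  · have hs : δ + ε = 0 := by
      rw [← hpz] at hp
      have hn0 : (n : ℝ) ≠ 0 := by exact_mod_cast (by omega : n ≠ 0)
      have h1 : (n : ℝ) ^ (1000 : ℝ) ≠ 0 := (Real.rpow_pos_of_pos (by positivity) _).ne'
      have h2 : (δ + ε) ^ (1 / 1000 : ℝ) = 0 := by
        rcases mul_eq_zero.mp hp.symm with h | h
        · exact absurd h (mul_ne_zero (by norm_num) h1)
        · exact h
      exact ((Real.rpow_eq_zero (add_nonneg hδ hε) (by norm_num)).mp h2)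
    have hD : ∀ h z', A.ensembleDistSq B S.state j hm z' h = 0 := by
      intro h z'
      have h1 := CHSH.QubitFamily.sum_ensembleDistSq_le
        (FA.family.commute_onAlice_onBob (HC := HC) FB.family) hη j z' hm
      rw [hs, Real.sqrt_zero, mul_zero, mul_zero, zero_pow two_ne_zero] at h1
      have hnn : ∀ h : CHSH.Hist ((j : ℕ) + 1) × CHSH.Hist ((j : ℕ) + 1),
          0 ≤ (1 / 4) ^ ((j : ℕ) + 1) * ‖CHSH.overlapProd h.1 h.2‖ ^ 2 *
            A.ensembleDistSq B S.state j hm z' h := fun h =>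
        mul_nonneg (by positivity) (A.ensembleDistSq_nonneg B S.state j hm z' h)
      have h2 := (Finset.sum_eq_zero_iff_of_nonneg fun h _ => hnn h).mp
        (le_antisymm h1 (Finset.sum_nonneg fun h _ => hnn h)) h (Finset.mem_univ h)
      have h3 : 0 < (1 / 4 : ℝ) ^ ((j : ℕ) + 1) * ‖CHSH.overlapProd h.1 h.2‖ ^ 2 := by
        have := CHSH.norm_overlapProd_pos h.1 h.2
        positivity
      exact (mul_eq_zero.mp h2).resolve_left h3.ne'
    refine le_trans ?_ hp0
    refine Finset.sum_nonpos fun h _ => ?_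
    split_ifs with hnot
    · rcases hfar h hnot with h0 | hlt
      · rw [S.histProb_eq_transferred hA hB j.isLt, CHSH.QubitFamily.transferred, h0, map_zero]
        simp
      · simp [hD, ← hpz] at hlt
    · exact le_rfl
  · have hle := S.sq_mul_prob_le hA hB hη j hm (p := p) _ (fun h hnot => by
      rcases hfar h hnot with h0 | hlt
      · rw [h0, norm_zero]
        have := Finset.sum_nonneg fun z' (_ : z' ∈ Finset.univ) =>
          A.ensembleDistSq_nonneg B S.state j hm z' h
        simpa using this
      · exact hlt.le)
    -- The failure probability times `p²` is at most `p³`.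
    have h2 := hle.trans hbound
    rw [pow_succ p 2] at h2
    exact le_of_mul_le_mul_left h2 (by positivity)
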